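/- Let $\Gamma(\mathbb C)=\bigoplus_{n\ge 0}\mathbb C^{\otimes n}\cong\ell^2(\mathbb N)$ be the bosonic Fock space with number basis $|n\rangle$, $n\ge 0$; let $e(z)=\sum_n \frac{z^n}{\sqrt{n!}}|n\rangle$ and $|z\rangle=e^{-|z|^2/2}e(z)$ for $z\in\mathbb C$, and let $\mathcal B_1$ be the space of trace class operators with the trace norm. For $z\in\mathbb C$ there is exactly one unitary operator $W(z)$ with $W(z)e(w)=\exp\left(-\tfrac12|z|^2-\bar z w\right)e(z+w)$ for all $w\in\mathbb C$; put $W_0(\theta)=W(\theta)$ for $\theta\in\mathbb R$. **Logarithmic derivatives.** For a positive injective trace class operator $\rho$ and a bounded self-adjoint $X$ consider the four forms $$\int_0^\infty\langle(\rho+x)^{-1}u,X(\rho+x)^{-1}v\rangle\,dx,\qquad \tfrac12\left(\langle\rho^{-1}u,Xv\rangle+\langle Xu,\rho^{-1}v\rangle\right),$$ $$\langle\rho^{-1/2}u,X\rho^{-1/2}v\rangle,\qquad \int_0^\infty\langle e^{-s\rho/2}u,Xe^{-s\rho/2}v\rangle\,ds$$ (the BvN, $LD_1$, $LD_2$ and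 $LD_3$ models), with form domain $D(\rho^{-1})$ for $LD_1$ and $D(\rho^{-1/2})$ for the others, and let $H$ be the operator associated with the form: $v$ in the form domain lies in the domain of $H$, with $Hv=w$, if $\langle u,w\rangle$ is the value of the form at $(u,v)$ for every $u$ in the form domain. The logarithmic derivative (LD) $H(\theta)$ of a family $\rho_\theta$ is obtained from $\rho=\rho_\theta$, $X=\rho_\theta'$. Given a spectral decomposition $\rho_\theta=\sum_k\lambda_k(\theta)P_k(\theta)$ with distinct positive eigenvalues and nonzero mutually orthogonal projections, all differentiable in $\theta$, the parts $H_1(\theta)$ and $H_2(\theta)$ are obtained from $X=\sum_k\lambda_k'P_k$ and $X=\sum_k\lambda_kP_k'$ respectively. The quantum Fisher information (QFI) is $\boldsymbol I=\int_0^1\|\rho^{(1-t)/2}H\rho^{t/2}\|_2^2\,dt$ in the BvN model and $\boldsymbol I=\|H\rho^{1/2}\|_2^2=\operatorname{Tr}\rho H^2$ in the other three; $\boldsymbol I_1$ is the same expression for $H_1$, and $\boldsymbol I_2=\boldsymbol I-\boldsymbol I_1$. **Theorem.** For every probability density $\phi$ on $\mathbb C$ the operator $\int_{\mathbb C}|z\rangle\langle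 z|\,\phi(z)\,d^2z$ is positive and of trace class, with trace $1$. Now let $M>0$, and for $\theta\in\mathbb R$ put $$\phi_\theta(x+iy)=\frac1{\pi M}\exp\left(-\frac{(x-\theta)^2+y^2}{M}\right),\qquad \rho_\theta=\int_{\mathbb C}|z\rangle\langle z|\,\phi_\theta(z)\,d^2z .$$ 1. Each $\rho_\theta$ is positive and of trace class with trace $1$, and $\rho_\theta=W_0(\theta)\rho_0W_0(\theta)^*$. 2. $\theta\mapsto\rho_\theta\in\mathcal B_1$ is real-analytic on $\mathbb R$. 3. $\rho_0=\sum_{k\ge0}\lambda_k|k\rangle\langle k|$ with $\lambda_k=M^{-1}\left(1+\frac1M\right)^{-(1+k)}$. 4. $\rho_\theta=\sum_k\lambda_kP_k(\theta)$ with $P_k(\theta)=W_0(\theta)|k\rangle\langle k|W_0(\theta)^*$; this is a differentiable spectral decomposition, and $\rho_\theta$ is injective. 5. For every differentiable spectral decomposition of the family, in each of the four models: $H_1(\theta)=0$ on the form domain; $H_2(\theta)=H(\theta)$ is densely defined; and $H_2(\theta)=W_0(\theta)H_2(0)W_0(\theta)^*$, with equality of domains. In the BvN model $H_2(\theta)v=\sum_k\ln\lambda_k(\theta)\,P_k'(\theta)v$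 for every eigenvector $v$ of $\rho_\theta$. 6. In each of the four models $\boldsymbol I(\theta)$ is finite, $\boldsymbol I_1(\theta)=0$, $\boldsymbol I_2(\theta)=\boldsymbol I(\theta)$, and $\boldsymbol I(\theta)=\boldsymbol I(0)$, $\boldsymbol I_2(\theta)=\boldsymbol I_2(0)$ for all $\theta\in\mathbb R$. 7. The BvN QFI is $\boldsymbol I(0)=\boldsymbol I_2(0)=2\ln\left(1+\frac1M\right)$, and the $LD_2$ QFI is $\widehat{\boldsymbol I}(0)=\widehat{\boldsymbol I}_2(0)=\dfrac{2M+1}{M(M+1)}$. -/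

import Mathlib

noncomputable section

namespace CoherentQFI

open MeasureTheory Set
open scoped ENNReal InnerProductSpace

section Generic

variable {H : Type*} [NormedAddCommGroup H] [InnerProductSpace ℂ H]

/-! ### Trace class operators -/

/-- The trace norm `‖T‖₁ = Tr |T|`, written as the supremum of `∑ |⟪f i, T (g i)⟫|` over all
pairs of finite orthonormal families. It is finite exactly on the trace class. -/
def traceNorm (T : H →L[ℂ] H) : ℝ≥0∞ :=
  ⨆ (n : ℕ) (f : Fin n → H) (g : Fin n → H) (_ : Orthonormal ℂ f) (_ : Orthonormal ℂ g),
    ∑ i, ‖⟪f i, T (g i)⟫_ℂ‖ₑ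

def IsTraceClass (T : H →L[ℂ] H) : Prop := traceNorm T < ⊤

theorem le_traceNorm (T : H →L[ℂ] H) {n : ℕ} {f g : Fin n → H} (hf : Orthonormal ℂ f)
    (hg : Orthonormal ℂ g) : ∑ i, ‖⟪f i, T (g i)⟫_ℂ‖ₑ ≤ traceNorm T := by
  unfold traceNorm
  exact le_iSup_of_le n (le_iSup_of_le f (le_iSup_of_le g
    (le_iSup_of_le hf (le_iSup_of_le hg le_rfl))))

theorem traceNorm_le (T : H →L[ℂ] H) {C : ℝ≥0∞}
    (h : ∀ (n : ℕ) (f g : Fin n → H), Orthonormal ℂ f → Orthonormal ℂ g →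
      ∑ i, ‖⟪f i, T (g i)⟫_ℂ‖ₑ ≤ C) : traceNorm T ≤ C := by
  unfold traceNorm
  exact iSup_le fun n => iSup_le fun f => iSup_le fun g => iSup_le fun hf => iSup_le fun hg =>
    h n f g hf hg

theorem traceNorm_zero : traceNorm (0 : H →L[ℂ] H) = 0 := by
  refine le_antisymm (traceNorm_le _ fun n f g _ _ => ?_) bot_le
  simp

theorem traceNorm_add_le (S T : H →L[ℂ] H) : traceNorm (S + T) ≤ traceNorm S + traceNorm T := by
  refine traceNorm_le _ fun n f g hf hg => ?_
  calc ∑ i, ‖⟪f i, (S + T) (g i)⟫_ℂ‖ₑ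
      ≤ ∑ i, (‖⟪f i, S (g i)⟫_ℂ‖ₑ + ‖⟪f i, T (g i)⟫_ℂ‖ₑ) := by
        refine Finset.sum_le_sum fun i _ => ?_
        rw [add_apply, inner_add_right]
        exact enorm_add_le _ _
    _ = ∑ i, ‖⟪f i, S (g i)⟫_ℂ‖ₑ + ∑ i, ‖⟪f i, T (g i)⟫_ℂ‖ₑ := Finset.sum_add_distrib
    _ ≤ _ := add_le_add (le_traceNorm S hf hg) (le_traceNorm T hf hg)

theorem traceNorm_smul_le (c : ℂ) (T : H →L[ℂ] H) :
    traceNorm (c • T) ≤ ‖c‖ₑ * traceNorm T := by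
  refine traceNorm_le _ fun n f g hf hg => ?_
  calc ∑ i, ‖⟪f i, (c • T) (g i)⟫_ℂ‖ₑ = ‖c‖ₑ * ∑ i, ‖⟪f i, T (g i)⟫_ℂ‖ₑ := by
        rw [Finset.mul_sum]
        refine Finset.sum_congr rfl fun i _ => ?_
        rw [smul_apply, inner_smul_right, enorm_mul]
    _ ≤ _ := by gcongr; exact le_traceNorm T hf hg

theorem traceNorm_smul (c : ℂ) (T : H →L[ℂ] H) :
    traceNorm (c • T) = ‖c‖ₑ * traceNorm T := by
  rcases eq_or_ne c 0 with rfl | hc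
  · simp [traceNorm_zero]
  refine le_antisymm (traceNorm_smul_le c T) ?_
  have h := traceNorm_smul_le c⁻¹ (c • T)
  rw [smul_smul, inv_mul_cancel₀ hc, one_smul, enorm_inv hc] at h
  calc ‖c‖ₑ * traceNorm T ≤ ‖c‖ₑ * (‖c‖ₑ⁻¹ * traceNorm (c • T)) := by gcongr
    _ = traceNorm (c • T) := by
      rw [← mul_assoc, ENNReal.mul_inv_cancel (by simpa using hc) (by simp), one_mul]

theorem eq_zero_of_traceNorm (T : H →L[ℂ] H) (h : traceNorm T = 0) : T = 0 := by
  have key : ∀ x y : H, ‖x‖ = 1 → ‖y‖ = 1 → ⟪x, T y⟫_ℂ = 0 := by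
    intro x y hx hy
    have hX : Orthonormal ℂ (fun _ : Fin 1 => x) :=
      ⟨fun _ => hx, fun i j hij => absurd (Subsingleton.elim i j) hij⟩
    have hY : Orthonormal ℂ (fun _ : Fin 1 => y) :=
      ⟨fun _ => hy, fun i j hij => absurd (Subsingleton.elim i j) hij⟩
    have := le_traceNorm T hX hY
    rw [h] at this
    simpa using this
  ext y
  by_contra hne
  have hy : y ≠ 0 := by rintro rfl; simp at hne
  have hTy : T y ≠ 0 := by simpa using hne
  have := key (((‖T y‖⁻¹ : ℝ) : ℂ) • T y) (((‖y‖⁻¹ : ℝ) : ℂ) • y)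
    (by rw [norm_smul, Complex.norm_real, norm_inv, norm_norm,
          inv_mul_cancel₀ (norm_ne_zero_iff.2 hTy)])
    (by rw [norm_smul, Complex.norm_real, norm_inv, norm_norm,
          inv_mul_cancel₀ (norm_ne_zero_iff.2 hy)])
  rw [map_smul, inner_smul_left, inner_smul_right] at this
  simp [hTy, hy] at this

variable (H) in
def traceClassSubmodule : Submodule ℂ (H →L[ℂ] H) where
  carrier := {T | IsTraceClass T}
  zero_mem' := by
    change traceNorm (0 : H →L[ℂ] H) < ⊤
    simp [traceNorm_zero]
  add_mem' {S T} hS hT := lt_of_le_of_lt (traceNorm_add_le S T) (ENNReal.add_lt_top.2 ⟨hS, hT⟩)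
  smul_mem' c T hT :=
    lt_of_le_of_lt (traceNorm_smul_le c T) (ENNReal.mul_lt_top enorm_lt_top hT)

variable (H) in
/-- The space of trace class operators, normed below by the trace norm. -/
def TraceClass : Type _ := traceClassSubmodule H

instance : AddCommGroup (TraceClass H) := inferInstanceAs (AddCommGroup (traceClassSubmodule H))

instance : Module ℂ (TraceClass H) := inferInstanceAs (Module ℂ (traceClassSubmodule H))

/-- The bounded operator underlying a trace class operator. -/
def TraceClass.op : TraceClass H →ₗ[ℂ] (H →L[ℂ] H) := (traceClassSubmodule H).subtype

theorem TraceClass.lt_top (T : TraceClass H) : traceNorm T.op < ⊤ := T.2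

instance : Norm (TraceClass H) := ⟨fun T => (traceNorm T.op).toReal⟩

theorem TraceClass.norm_def (T : TraceClass H) : ‖T‖ = (traceNorm T.op).toReal := rfl

theorem TraceClass.core : NormedSpace.Core ℂ (TraceClass H) where
  norm_nonneg T := ENNReal.toReal_nonneg
  norm_smul c T := by
    simp only [TraceClass.norm_def]
    rw [map_smul, traceNorm_smul, ENNReal.toReal_mul, toReal_enorm]
  norm_triangle S T := by
    simp only [TraceClass.norm_def]
    rw [map_add, ← ENNReal.toReal_add S.lt_top.ne T.lt_top.ne]
    exact ENNReal.toReal_mono (ENNReal.add_lt_top.2 ⟨S.lt_top, T.lt_top⟩).ne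
      (traceNorm_add_le _ _)
  norm_eq_zero_iff T := by
    rw [TraceClass.norm_def, ENNReal.toReal_eq_zero_iff, or_iff_left T.lt_top.ne]
    constructor
    · intro h
      exact Subtype.ext (eq_zero_of_traceNorm _ h)
    · rintro rfl
      rw [map_zero, traceNorm_zero]

instance : NormedAddCommGroup (TraceClass H) := NormedAddCommGroup.ofCore TraceClass.core

instance : NormedSpace ℂ (TraceClass H) := NormedSpace.ofCore TraceClass.core

/-! ### Unbounded operators -/

/-- The operator `A T B` on its natural domain `{v | B v ∈ dom T}`, for bounded `A` and `B`. -/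
def sandwich (A : H →L[ℂ] H) (T : H →ₗ.[ℂ] H) (B : H →L[ℂ] H) : H →ₗ.[ℂ] H where
  domain := T.domain.comap (B : H →ₗ[ℂ] H)
  toFun := (A : H →ₗ[ℂ] H) ∘ₗ T.toFun ∘ₗ
    (((B : H →ₗ[ℂ] H) ∘ₗ (T.domain.comap (B : H →ₗ[ℂ] H)).subtype).codRestrict T.domain
      fun v => v.2)

open Classical in
/-- The squared Hilbert-Schmidt norm of a densely defined operator: the supremum of
`∑ ‖T (f i)‖²` over the finite orthonormal families in its domain. A finite value means that `T`
extends to a Hilbert-Schmidt operator, and it is the squared norm of that extension. -/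
def hsNormSq (T : H →ₗ.[ℂ] H) : ℝ≥0∞ :=
  if Dense (T.domain : Set H) then
    ⨆ (n : ℕ) (f : Fin n → T.domain) (_ : Orthonormal ℂ fun i => (f i : H)), ∑ i, ‖T (f i)‖ₑ ^ 2
  else ⊤

/-- The operator associated with a sesquilinear form `h` (antilinear in its first argument) on a
form domain `D`: its domain is `{v ∈ D | ∃ w, ∀ u ∈ D, ⟪u, w⟫ = h u v}`, and `v ↦ w` there.
The pairs `(v, w)` already form a subspace, and `w` is unique if `D` is dense. -/
def formOperator (D : Submodule ℂ H) (h : H → H → ℂ) : H →ₗ.[ℂ] H :=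
  (Submodule.span ℂ {p : H × H | p.1 ∈ D ∧ ∀ u ∈ D, ⟪u, p.2⟫_ℂ = h u p.1}).toLinearPMap

/-- `A⁻¹ u`, for an injective `A` and `u` in the range of `A`. -/
def preim (A : H →L[ℂ] H) (u : H) : H := Function.invFun A u

/-! ### Logarithmic derivatives and quantum Fisher informations -/

/-- The four logarithmic derivatives: Boltzmann - von Neumann, `LD₁`, `LD₂`, and the symmetric
one, `LD₃`. -/
inductive LDModel
  | bvn
  | ld1
  | ld2
  | ld3

variable [CompleteSpace H]

/-- `D(ρ⁻¹)` for `LD₁`, and `D(ρ^(-1/2))` in the other three models. -/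
def ldDomain (m : LDModel) (ρ : H →L[ℂ] H) : Submodule ℂ H :=
  match m with
  | .ld1 => LinearMap.range (ρ : H →ₗ[ℂ] H)
  | _ => LinearMap.range ((ρ ^ (1 / 2 : ℝ) : H →L[ℂ] H) : H →ₗ[ℂ] H)

/-- The quadratic forms of
`∫₀^∞ (ρ + x)⁻¹ X (ρ + x)⁻¹ dx`, `(ρ⁻¹ X + X ρ⁻¹) / 2`, `ρ^(-1/2) X ρ^(-1/2)` and
`∫₀^∞ e^(-sρ/2) X e^(-sρ/2) ds`, in this order. -/
def ldForm (m : LDModel) (ρ X : H →L[ℂ] H) (u v : H) : ℂ :=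
  match m with
  | .bvn => ∫ x in Ioi (0 : ℝ),
      ⟪Ring.inverse (ρ + (x : ℂ) • (1 : H →L[ℂ] H)) u,
        X (Ring.inverse (ρ + (x : ℂ) • (1 : H →L[ℂ] H)) v)⟫_ℂ
  | .ld1 => (⟪preim ρ u, X v⟫_ℂ + ⟪X u, preim ρ v⟫_ℂ) / 2
  | .ld2 => ⟪preim (ρ ^ (1 / 2 : ℝ)) u, X (preim (ρ ^ (1 / 2 : ℝ)) v)⟫_ℂ
  | .ld3 => ∫ s in Ioi (0 : ℝ),
      ⟪NormedSpace.exp ((-(s / 2) : ℂ) • ρ) u, X (NormedSpace.exp ((-(s / 2) : ℂ) • ρ) v)⟫_ℂ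

/-- The logarithmic derivative of the state `ρ` in the direction `X`; the logarithmic derivative
of a family `ρ θ` is the case `X = ρ' θ`. -/
def ld (m : LDModel) (ρ X : H →L[ℂ] H) : H →ₗ.[ℂ] H :=
  formOperator (ldDomain m ρ) (ldForm m ρ X)

/-- The variance, in the state `ρ`, of a logarithmic derivative `T` of mean zero:
`∫₀¹ ‖ρ^((1-t)/2) T ρ^(t/2)‖₂² dt = ∫₀¹ Tr (ρ^t T ρ^(1-t) T) dt` in the Boltzmann - von Neumann
model, and `‖T ρ^(1/2)‖₂² = Tr (ρ T²)` in the other three. -/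
def ldVariance (m : LDModel) (ρ : H →L[ℂ] H) (T : H →ₗ.[ℂ] H) : ℝ≥0∞ :=
  match m with
  | .bvn => ∫⁻ t in Ioo (0 : ℝ) 1,
      hsNormSq (sandwich (ρ ^ ((1 - t) / 2) : H →L[ℂ] H) T (ρ ^ (t / 2) : H →L[ℂ] H))
  | _ => hsNormSq (sandwich 1 T (ρ ^ (1 / 2 : ℝ) : H →L[ℂ] H))

/-- The quantum Fisher information of the family `ρ` at `θ`. -/
def qfi (m : LDModel) (ρ : ℝ → H →L[ℂ] H) (θ : ℝ) : ℝ≥0∞ :=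
  ldVariance m (ρ θ) (ld m (ρ θ) (deriv ρ θ))

/-- A differentiable spectral decomposition `ρ θ = ∑ k, lam k θ • P k θ` of a family of faithful
states, with distinct eigenvalues `lam k θ` and eigenprojections `P k θ`. -/
structure IsSpectralFamily (ρ : ℝ → H →L[ℂ] H) (lam : ℕ → ℝ → ℝ) (P : ℕ → ℝ → H →L[ℂ] H) :
    Prop where
  pos : ∀ k θ, 0 < lam k θ
  distinct : ∀ θ, Function.Injective fun k => lam k θ
  isProj : ∀ k θ, IsStarProjection (P k θ)
  ne_zero : ∀ k θ, P k θ ≠ 0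
  orthogonal : ∀ j k θ, j ≠ k → P j θ * P k θ = 0
  hasSum : ∀ θ, HasSum (fun k => (lam k θ : ℂ) • P k θ) (ρ θ)
  differentiable_eigenvalue : ∀ k, Differentiable ℝ (lam k)
  differentiable_proj : ∀ k, Differentiable ℝ (P k)

/-- The part `H₁` of the logarithmic derivative, coming from the part `∑ k, lam k' • P k` of
`ρ'`. -/
def ldPart1 (m : LDModel) (ρ : ℝ → H →L[ℂ] H) (lam : ℕ → ℝ → ℝ) (P : ℕ → ℝ → H →L[ℂ] H)
    (θ : ℝ) : H →ₗ.[ℂ] H :=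
  ld m (ρ θ) (∑' k, ((deriv (lam k) θ : ℝ) : ℂ) • P k θ)

/-- The part `H₂` of the logarithmic derivative, coming from the part `∑ k, lam k • P k'` of
`ρ'`. -/
def ldPart2 (m : LDModel) (ρ : ℝ → H →L[ℂ] H) (lam : ℕ → ℝ → ℝ) (P : ℕ → ℝ → H →L[ℂ] H)
    (θ : ℝ) : H →ₗ.[ℂ] H :=
  ld m (ρ θ) (∑' k, ((lam k θ : ℝ) : ℂ) • deriv (P k) θ)

/-- The component `I₁` of the quantum Fisher information: the variance of `H₁`. -/
def qfiPart1 (m : LDModel) (ρ : ℝ → H →L[ℂ] H) (lam : ℕ → ℝ → ℝ) (P : ℕ → ℝ → H →L[ℂ] H)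
    (θ : ℝ) : ℝ≥0∞ :=
  ldVariance m (ρ θ) (ldPart1 m ρ lam P θ)

/-- `I₂ = I - I₁`. -/
def qfiPart2 (m : LDModel) (ρ : ℝ → H →L[ℂ] H) (lam : ℕ → ℝ → ℝ) (P : ℕ → ℝ → H →L[ℂ] H)
    (θ : ℝ) : ℝ≥0∞ :=
  qfi m ρ θ - qfiPart1 m ρ lam P θ

end Generic

/-! ### Coherent states on Fock space -/

/-- The bosonic Fock space `Γ(ℂ) = ⨁ ℂ^(⊗n)`, that is `ℓ²(ℕ)`. -/
def Fock : Type := lp (fun _ : ℕ => ℂ) 2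

instance : NormedAddCommGroup Fock := inferInstanceAs (NormedAddCommGroup (lp (fun _ : ℕ => ℂ) 2))

instance : InnerProductSpace ℂ Fock :=
  inferInstanceAs (InnerProductSpace ℂ (lp (fun _ : ℕ => ℂ) 2))

instance : CompleteSpace Fock := inferInstanceAs (CompleteSpace (lp (fun _ : ℕ => ℂ) 2))

/-- The number (`n`-particle) state `|n⟩`. -/
def ket (n : ℕ) : Fock := (lp.single 2 n (1 : ℂ) : lp (fun _ : ℕ => ℂ) 2)

/-- The trace of a trace class operator. -/
def opTrace (T : Fock →L[ℂ] Fock) : ℂ := ∑' n, ⟪ket n, T (ket n)⟫_ℂ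

theorem memlp_expVec (z : ℂ) :
    Memℓp (fun n : ℕ => z ^ n / (Real.sqrt (n.factorial : ℝ) : ℂ)) 2 := by
  refine memℓp_gen ?_
  have h : ∀ n : ℕ, ‖z ^ n / (Real.sqrt (n.factorial : ℝ) : ℂ)‖ ^ (2 : ℝ≥0∞).toReal
      = (‖z‖ ^ 2) ^ n / (n.factorial : ℝ) := by
    intro n
    have h2 : (2 : ℝ≥0∞).toReal = ((2 : ℕ) : ℝ) := by simp
    rw [h2, Real.rpow_natCast, norm_div, norm_pow, Complex.norm_real, div_pow, Real.norm_eq_abs,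
      sq_abs, Real.sq_sqrt (by positivity), ← pow_mul, ← pow_mul, mul_comm]
  simp only [h]
  exact Real.summable_pow_div_factorial _

/-- The exponential vector `e(z) = ∑ n, z^n / √(n!) |n⟩`. -/
def expVec (z : ℂ) : Fock :=
  (⟨fun n => z ^ n / (Real.sqrt (n.factorial : ℝ) : ℂ), memlp_expVec z⟩ :
    lp (fun _ : ℕ => ℂ) 2)

/-- The coherent state `|z⟩ = e^(-|z|²/2) e(z)`. -/
def coherent (z : ℂ) : Fock := (Real.exp (-(‖z‖ ^ 2 / 2)) : ℂ) • expVec z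

/-- The projection `|z⟩⟨z|`. -/
def cohProj (z : ℂ) : Fock →L[ℂ] Fock := InnerProductSpace.rankOne ℂ (coherent z) (coherent z)

/-- The mixture `∫ |z⟩⟨z| φ(z) d²z` of coherent states. -/
def mixture (φ : ℂ → ℝ) : Fock →L[ℂ] Fock := ∫ z : ℂ, (φ z : ℂ) • cohProj z

/-- A probability density function with respect to Lebesgue measure on `ℂ`. -/
structure IsProbDensity (φ : ℂ → ℝ) : Prop where
  nonneg : ∀ z, 0 ≤ φ z
  integrable : Integrable φ
  integral_eq_one : ∫ z : ℂ, φ z = 1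

/-- `U` is the Weyl operator at `z`: the unitary operator with
`U e(w) = exp(-|z|²/2 - conj z * w) e(z + w)` for all `w`. -/
def IsWeyl (z : ℂ) (U : Fock →L[ℂ] Fock) : Prop :=
  U ∈ unitary (Fock →L[ℂ] Fock) ∧
    ∀ w : ℂ, U (expVec w) =
      Complex.exp (-((‖z‖ ^ 2 / 2 : ℝ) : ℂ) - (starRingEnd ℂ) z * w) • expVec (z + w)

/-- The Weyl operator `W(z)`: the operator determined by `IsWeyl z`. -/
def weyl (z : ℂ) : Fock →L[ℂ] Fock := Classical.epsilon (IsWeyl z)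

/-- `W₀(θ) = W((θ, 0))`. -/
def weyl0 (θ : ℝ) : Fock →L[ℂ] Fock := weyl (θ : ℂ)

/-- The Gaussian density with parameter `M`, displaced by `θ`. -/
def gaussDensity (M θ : ℝ) (z : ℂ) : ℝ :=
  1 / (Real.pi * M) * Real.exp (-((z.re - θ) ^ 2 + z.im ^ 2) / M)

/-- The family `ρ_θ = ∫ |z⟩⟨z| φ_θ(z) d²z`. -/
def rho (M θ : ℝ) : Fock →L[ℂ] Fock := mixture (gaussDensity M θ)

/-- `λ_k = M⁻¹ (1 + 1/M)^(-(1+k))`. -/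
def eigval (M : ℝ) (k : ℕ) : ℝ := M⁻¹ * ((1 + 1 / M) ^ (1 + k))⁻¹

/-- `P_k = |k⟩⟨k|`. -/
def numProj (k : ℕ) : Fock →L[ℂ] Fock := InnerProductSpace.rankOne ℂ (ket k) (ket k)

/-- `P_k(θ) = W₀(θ) P_k W₀(θ)*`. -/
def dispProj (k : ℕ) (θ : ℝ) : Fock →L[ℂ] Fock := weyl0 θ * numProj k * star (weyl0 θ)

end CoherentQFI

end

open CoherentQFI

noncomputable section

namespace CoherentQFI

open MeasureTheory Set Filter
open scoped ENNReal InnerProductSpace Topology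

section Generic

variable {H : Type*} [NormedAddCommGroup H] [InnerProductSpace ℂ H]

/-! ### Form operators -/

/-! Translating the Gaussian by θ conjugates ρ_0 by W_0(θ), so everything is decided by ρ_0 and the
generator of the Weyl group. Matrix elements between exponential vectors are Gaussian integrals
(`inner_rho_expVec`), and they show that ρ_0 is diagonal in the number basis with geometric
eigenvalues of ratio q = (1 + 1/M)⁻¹. On number states the generator is D = a† - a, the difference
of creation and annihilation (`weyl0_ket_sub`). In the displaced number basis ρ_θ' is therefore the
commutator of D with ρ_θ, a matrix with entries only next to the diagonal.

Each of the four models multiplies the entry of X between eigenvectors for a and c by a kernel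
`ldKernel` that is homogeneous of degree -1. Along a geometric spectrum (λ_k - λ_{k+1}) times the
kernel does not depend on k (`kernel_eq`), so on the basis H is a constant multiple, `ldFactor`, of
a† + a. Its rows are finite, and the Fisher informations reduce to the single series Σ (k+1) λ_k = M
+ 1. `IsLadderPair` isolates the data needed for this.

The spectrum is simple and does not move. An eigenvalue branch of any differentiable decomposition
is continuous with values in a countable set, hence constant, so every decomposition is a
relabelling of the displaced one (`exists_equiv`). This kills H₁ and gives H₂ = H. Covariance of H
with its domain follows because the unitary carries the pairs defining one form operator to those of
the other (`ld_conj_of_unitary`).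

Analyticity rests on the bound of the trace norm of a mixture by the L¹ norm of its weight
(`traceNorm_mixture_le`): the Taylor expansion of the Gaussian in its displacement converges in L¹.
-/

theorem formOperator_domain_of_mem {D : Submodule ℂ H} {h : H → H → ℂ} {v w : H} (hv : v ∈ D)
    (hw : ∀ u ∈ D, ⟪u, w⟫_ℂ = h u v) : v ∈ (formOperator D h).domain :=
  ⟨(v, w), Submodule.subset_span ⟨hv, hw⟩, rfl⟩

section Basis

variable (b : HilbertBasis ℕ ℂ H)

theorem hilbertBasis_ext_inner {v w : H} (h : ∀ i, ⟪b i, v⟫_ℂ = ⟪b i, w⟫_ℂ) : v = w := by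
  apply b.repr.injective
  ext i
  rw [b.repr_apply_apply, b.repr_apply_apply, h]

theorem hilbertBasis_clm_ext {E : Type*} [NormedAddCommGroup E] [NormedSpace ℂ E]
    {S T : H →L[ℂ] E} (h : ∀ i, S (b i) = T (b i)) : S = T := by
  refine ContinuousLinearMap.ext_on
    (Submodule.dense_iff_topologicalClosure_eq_top.2 b.dense_span) ?_
  rintro _ ⟨i, rfl⟩
  exact h i

/-- A form with matrix rows `r i` determines a single valued operator with the same rows. -/
theorem formOperator_graph {D : Submodule ℂ H} {h : H → H → ℂ} {r : ℕ → H}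
    (hb : ∀ i, b i ∈ D) (hr : ∀ i, ∀ v ∈ D, h (b i) v = ⟪r i, v⟫_ℂ) :
    (formOperator D h).graph =
      Submodule.span ℂ {p : H × H | p.1 ∈ D ∧ ∀ u ∈ D, ⟪u, p.2⟫_ℂ = h u p.1} ∧
    ∀ (v : (formOperator D h).domain) (i : ℕ), ⟪b i, formOperator D h v⟫_ℂ = ⟪r i, (v : H)⟫_ℂ := by
  have key : ∀ p ∈ Submodule.span ℂ {p : H × H | p.1 ∈ D ∧ ∀ u ∈ D, ⟪u, p.2⟫_ℂ = h u p.1},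
      ∀ i, ⟪b i, p.2⟫_ℂ = ⟪r i, p.1⟫_ℂ := by
    intro p hp i
    induction hp using Submodule.span_induction with
    | mem p hp => rw [hp.2 _ (hb i), hr i _ hp.1]
    | zero => simp
    | add p q _ _ hp hq => simp [hp, hq]
    | smul c p _ hp => simp [hp]
  have hgraph := Submodule.toLinearPMap_graph_eq
    (Submodule.span ℂ {p : H × H | p.1 ∈ D ∧ ∀ u ∈ D, ⟪u, p.2⟫_ℂ = h u p.1})
    (fun x hx hx0 => hilbertBasis_ext_inner b fun i => by rw [key x hx i, hx0]; simp)
  refine ⟨hgraph, fun v i => ?_⟩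
  have := LinearPMap.mem_graph (formOperator D h) v
  rw [show (formOperator D h).graph = _ from hgraph] at this
  exact key _ this i

theorem formOperator_zero {D : Submodule ℂ H} {h : H → H → ℂ}
    (hb : ∀ i, b i ∈ D) (h0 : ∀ u ∈ D, ∀ v ∈ D, h u v = 0) :
    formOperator D h = ⟨D, 0⟩ := by
  have hg := formOperator_graph b (h := h) (r := fun _ => 0) hb
    (fun i v hv => by rw [h0 _ (hb i) _ hv, inner_zero_left])
  have hdom : (formOperator D h).domain = D := by
    refine le_antisymm ?_ fun v hv => formOperator_domain_of_mem (w := 0) hv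
      fun u hu => by rw [h0 u hu v hv, inner_zero_right]
    rintro _ ⟨p, hp, rfl⟩
    induction hp using Submodule.span_induction with
    | mem p hp => exact hp.1
    | zero => simp
    | add p q _ _ hp hq => exact D.add_mem hp hq
    | smul c p _ hp => exact D.smul_mem c hp
  refine LinearPMap.ext hdom fun v => ?_
  intro hv _
  refine hilbertBasis_ext_inner b fun i => ?_
  rw [hg.2]
  simp

variable {b} in
/-- A vector representing the form functional at a basis vector is the value of the operator. -/
theorem formOperator_apply {D : Submodule ℂ H} {h : H → H → ℂ} {r : ℕ → H}
    (hb : ∀ i, b i ∈ D) (hr : ∀ i, ∀ v ∈ D, h (b i) v = ⟪r i, v⟫_ℂ) {v w : H} (hv : v ∈ D)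
    (hw : ∀ u ∈ D, ⟪u, w⟫_ℂ = h u v) :
    formOperator D h ⟨v, formOperator_domain_of_mem hv hw⟩ = w := by
  refine hilbertBasis_ext_inner b fun i => ?_
  rw [(formOperator_graph b hb hr).2, hw _ (hb i), hr i v hv]

/-! ### Hilbert-Schmidt norms -/

theorem hilbertBasis_tsum_enorm_inner_sq (v : H) : ∑' i, ‖⟪b i, v⟫_ℂ‖ₑ ^ 2 = ‖v‖ₑ ^ 2 := by
  have h := b.hasSum_inner_mul_inner v v
  have h2 : HasSum (fun i => ‖⟪b i, v⟫_ℂ‖ ^ 2) (‖v‖ ^ 2) := by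
    have h3 := Complex.hasSum_re h
    have e1 : (⟪v, v⟫_ℂ).re = ‖v‖ ^ 2 := by
      rw [inner_self_eq_norm_sq_to_K]; norm_cast
    rw [e1] at h3
    refine h3.congr_fun ?_
    intro i
    rw [← inner_conj_symm v (b i), ← Complex.normSq_eq_conj_mul_self, Complex.ofReal_re,
      Complex.normSq_eq_norm_sq]
  have h4 : ∀ x : ℝ, 0 ≤ x → ENNReal.ofReal x ^ 2 = ENNReal.ofReal (x ^ 2) := fun x hx =>
    (ENNReal.ofReal_pow hx 2).symm
  simp only [← ofReal_norm, h4 _ (norm_nonneg _)]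
  rw [← ENNReal.ofReal_tsum_of_nonneg (fun _ => by positivity) h2.summable, h2.tsum_eq]

/-- The squared Hilbert-Schmidt norm is the sum of the squared norms of the matrix rows. -/
theorem hsNormSq_eq_tsum (T : H →ₗ.[ℂ] H) (s : ℕ → H) (hb : ∀ i, b i ∈ T.domain)
    (hT : ∀ (v : T.domain) (i : ℕ), ⟪b i, T v⟫_ℂ = ⟪s i, (v : H)⟫_ℂ) :
    hsNormSq T = ∑' i, ‖s i‖ₑ ^ 2 := by
  have hdense : Dense (T.domain : Set H) := by
    refine (Submodule.dense_iff_topologicalClosure_eq_top.2 b.dense_span).mono ?_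
    exact Submodule.span_le.2 (by rintro _ ⟨i, rfl⟩; exact hb i)
  rw [hsNormSq, if_pos hdense]
  have hTv : ∀ v : T.domain, ‖T v‖ₑ ^ 2 = ∑' i, ‖⟪s i, (v : H)⟫_ℂ‖ₑ ^ 2 := fun v => by
    rw [← hilbertBasis_tsum_enorm_inner_sq b]
    simp only [hT]
  refine le_antisymm (iSup_le fun n => iSup_le fun f => iSup_le fun hf => ?_) ?_
  -- Upper bound: exchange the two sums and apply Bessel to each row.
  · simp only [hTv]
    rw [← Summable.tsum_finsetSum (fun _ _ => ENNReal.summable)]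
    refine ENNReal.tsum_le_tsum fun i => ?_
    have h := hf.sum_inner_products_le (x := s i) (s := Finset.univ)
    have h2 : ∀ j, ‖⟪s i, (f j : H)⟫_ℂ‖ₑ ^ 2 = ENNReal.ofReal (‖⟪(f j : H), s i⟫_ℂ‖ ^ 2) := by
      intro j
      rw [ENNReal.ofReal_pow (norm_nonneg _), ofReal_norm, ← inner_conj_symm, ← ofReal_norm,
        RCLike.norm_conj, ofReal_norm]
    simp only [h2]
    rw [← ENNReal.ofReal_sum_of_nonneg (fun _ _ => by positivity), ← ofReal_norm,
      ← ENNReal.ofReal_pow (norm_nonneg _)]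
    exact ENNReal.ofReal_le_ofReal h
  -- Lower bound: by Tonelli the sum over rows is the sum over columns T (b k), whose partial sums
  -- come from the admissible families b 0, ..., b (n-1).
  · have hcomm : ∑' i, ‖s i‖ₑ ^ 2 = ∑' k, ‖T ⟨b k, hb k⟩‖ₑ ^ 2 := by
      simp only [hTv]
      rw [ENNReal.tsum_comm]
      refine tsum_congr fun i => ?_
      rw [← hilbertBasis_tsum_enorm_inner_sq b]
      refine tsum_congr fun k => ?_
      rw [← inner_conj_symm, ← ofReal_norm, RCLike.norm_conj, ofReal_norm]
    rw [hcomm, ENNReal.tsum_eq_iSup_nat]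
    refine iSup_le fun n => ?_
    refine le_iSup_of_le n (le_iSup_of_le (fun i : Fin n => ⟨b i, hb i⟩) (le_iSup_of_le ?_ ?_))
    · exact b.orthonormal.comp _ Fin.val_injective
    · rw [Finset.sum_range]

end Basis

/-- Graphs record domain and values together, so covariance with equality of domains becomes one
statement about pairs. -/
theorem mem_graph_sandwich {A B : H →L[ℂ] H} {T : H →ₗ.[ℂ] H} {v w : H} :
    (v, w) ∈ (sandwich A T B).graph ↔ ∃ y, (B v, y) ∈ T.graph ∧ A y = w := by
  constructor
  · intro h
    obtain ⟨x, hx, hy⟩ := (LinearPMap.mem_graph_iff _).1 h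
    obtain ⟨x, hxd⟩ := x
    subst hx
    exact ⟨T ⟨B x, hxd⟩, LinearPMap.mem_graph T ⟨B x, hxd⟩, hy⟩
  · rintro ⟨y, hy, rfl⟩
    obtain ⟨x, hx, hy⟩ := (LinearPMap.mem_graph_iff _).1 hy
    have hd : B v ∈ T.domain := by
      have := x.2
      rwa [show (x : H) = B v from hx] at this
    rw [LinearPMap.mem_graph_iff]
    refine ⟨⟨v, hd⟩, rfl, ?_⟩
    have hxe : (⟨B v, hd⟩ : T.domain) = x := Subtype.ext hx.symm
    exact congrArg A ((congrArg T hxe).trans hy)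

end Generic

/-! ### Preimages and functional calculus on eigenvectors. -/

section Generic

variable {H : Type*} [NormedAddCommGroup H] [InnerProductSpace ℂ H]

theorem preim_spec {A : H →L[ℂ] H} {u : H} (hu : u ∈ LinearMap.range (A : H →ₗ[ℂ] H)) :
    A (preim A u) = u := Function.invFun_eq hu

theorem preim_eigenvector {A : H →L[ℂ] H} (hA : Function.Injective A) {v : H} {c : ℝ}
    (hc : c ≠ 0) (hv : A v = (c : ℂ) • v) : preim A v = ((c⁻¹ : ℝ) : ℂ) • v := by
  have h0 : (c : ℂ) ≠ 0 := by exact_mod_cast hc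
  have h1 : A (((c⁻¹ : ℝ) : ℂ) • v) = v := by
    rw [map_smul, hv, smul_smul, Complex.ofReal_inv, inv_mul_cancel₀ h0, one_smul]
  conv_lhs => rw [← h1]
  exact Function.leftInverse_invFun hA _

variable [CompleteSpace H]

/-! ### Functions of an operator at an eigenvector -/

/-- The claim holds for constants and the identity and is stable under sums, products and uniform
limits, so Stone-Weierstrass gives it for all continuous functions on the spectrum. -/
theorem cfc_apply_eigenvector {ρ : H →L[ℂ] H} (hρ : IsSelfAdjoint ρ) {f : ℝ → ℝ}
    (hf : ContinuousOn f (spectrum ℝ ρ)) {v : H} {a : ℝ} (hv : ρ v = (a : ℂ) • v) :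
    cfc f ρ v = (f a : ℂ) • v := by
  rcases eq_or_ne v 0 with rfl | hv0
  · simp
  -- An eigenvalue is spectral: an inverse of a - ρ would send 0 to v.
  have ha : a ∈ spectrum ℝ ρ := by
    rw [spectrum.mem_iff]
    intro hu
    have h1 : (algebraMap ℝ (H →L[ℂ] H) a - ρ) v = 0 := by
      rw [sub_apply, hv, Algebra.algebraMap_eq_smul_one, smul_apply]
      simp
    obtain ⟨u, hu⟩ := hu
    apply hv0
    have h2 : ((u⁻¹ : (H →L[ℂ] H)ˣ) * (u : H →L[ℂ] H)) v = v := by simp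
    rw [← h2, mul_apply_eq_comp, hu, h1, map_zero]
  have key : ∀ g : C(spectrum ℝ ρ, ℝ), cfcHom hρ g v = (g ⟨a, ha⟩ : ℂ) • v := by
    intro g
    have hid : cfcHom hρ (.restrict (spectrum ℝ ρ) <| .id ℝ) v = (a : ℂ) • v := by
      rw [cfcHom_id, hv]
    induction g using ContinuousMap.induction_on_of_compact with
    | const r =>
      have : ContinuousMap.const (spectrum ℝ ρ) r = algebraMap ℝ _ r := rfl
      rw [this, AlgHomClass.commutes, Algebra.algebraMap_eq_smul_one, smul_apply]
      simp
    | id => rw [hid]; rfl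
    | star_id => rw [show star (ContinuousMap.restrict (spectrum ℝ ρ) (.id ℝ)) =
        ContinuousMap.restrict (spectrum ℝ ρ) (.id ℝ) from by ext; simp, hid]; rfl
    | add g₁ g₂ h₁ h₂ => rw [map_add, add_apply, h₁, h₂, ← add_smul]; simp
    | mul g₁ g₂ h₁ h₂ =>
      rw [map_mul, mul_apply_eq_comp, h₂, map_smul, h₁, smul_smul]
      simp [mul_comm]
    | frequently g hg =>
      have hcl : IsClosed {g : C(spectrum ℝ ρ, ℝ) | cfcHom hρ g v = (g ⟨a, ha⟩ : ℂ) • v} := by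
        refine isClosed_eq ?_ ?_
        · have := cfcHom_continuous (R := ℝ) hρ
          fun_prop
        · have := continuous_eval_const (F := C(spectrum ℝ ρ, ℝ)) ⟨a, ha⟩
          fun_prop
      exact hcl.mem_of_frequently_of_tendsto hg tendsto_id
  rw [cfc_apply f ρ, key]
  rfl

theorem rpow_apply_eigenvector {ρ : H →L[ℂ] H} (hρ : 0 ≤ ρ) {v : H} {a : ℝ}
    (hv : ρ v = (a : ℂ) • v) {s : ℝ} (hs : 0 ≤ s) :
    (ρ ^ s : H →L[ℂ] H) v = ((a ^ s : ℝ) : ℂ) • v := by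
  rw [CFC.rpow_eq_cfc_real]
  exact cfc_apply_eigenvector (IsSelfAdjoint.of_nonneg hρ)
    (Real.continuous_rpow_const hs).continuousOn hv

theorem exp_apply_eigenvector {ρ : H →L[ℂ] H} {v : H} {a : ℂ} (hv : ρ v = a • v) (c : ℂ) :
    NormedSpace.exp (c • ρ) v = Complex.exp (c * a) • v := by
  have h1 := (NormedSpace.exp_series_hasSum_exp' (𝕂 := ℂ) (c • ρ)).mapL
    (ContinuousLinearMap.apply ℂ H v)
  have hpow : ∀ n : ℕ, ((c • ρ) ^ n) v = (c * a) ^ n • v := by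
    intro n
    induction n with
    | zero => simp
    | succ n ih =>
      rw [pow_succ', mul_apply_eq_comp, ih, map_smul, smul_apply, hv, smul_smul,
        smul_smul, pow_succ, mul_assoc]
  have h2 := (NormedSpace.exp_series_hasSum_exp' (𝕂 := ℂ) (c * a)).smul_const v
  rw [← Complex.exp_eq_exp_ℂ] at h2
  refine h1.unique ?_
  convert h2 using 2 with n
  simp [hpow, smul_smul]

theorem isUnit_add_smul_one {ρ : H →L[ℂ] H} (hρ : 0 ≤ ρ) {x : ℝ} (hx : 0 < x) :
    IsUnit (ρ + (x : ℂ) • (1 : H →L[ℂ] H)) := by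
  have h : -x ∉ spectrum ℝ ρ := fun h => by
    have := spectrum_nonneg_of_nonneg hρ h
    linarith
  rw [spectrum.notMem_iff] at h
  have e : ρ + (x : ℂ) • (1 : H →L[ℂ] H) = -(algebraMap ℝ (H →L[ℂ] H) (-x) - ρ) := by
    rw [Algebra.algebraMap_eq_smul_one]
    ext v
    simp [add_comm]
  rw [e]
  exact h.neg

theorem inverse_apply_eigenvector {ρ : H →L[ℂ] H} (hρ : 0 ≤ ρ) {v : H} {a x : ℝ}
    (hv : ρ v = (a : ℂ) • v) (ha : 0 < a) (hx : 0 < x) :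
    Ring.inverse (ρ + (x : ℂ) • (1 : H →L[ℂ] H)) v = (((a + x)⁻¹ : ℝ) : ℂ) • v := by
  have hu := isUnit_add_smul_one hρ hx
  have h0 : ((a : ℂ) + x) ≠ 0 := by exact_mod_cast (by positivity : a + x ≠ 0)
  have h1 : (ρ + (x : ℂ) • (1 : H →L[ℂ] H)) ((((a + x)⁻¹ : ℝ) : ℂ) • v) = v := by
    rw [map_smul, add_apply, smul_apply, hv, one_apply_eq_self, ← add_smul, smul_smul]
    push_cast
    rw [inv_mul_cancel₀ h0, one_smul]
  conv_lhs => rw [← h1]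
  rw [← mul_apply_eq_comp, Ring.inverse_mul_cancel _ hu, one_apply_eq_self]

theorem isSelfAdjoint_inverse_add {ρ : H →L[ℂ] H} (hρ : 0 ≤ ρ) (x : ℝ) :
    IsSelfAdjoint (Ring.inverse (ρ + (x : ℂ) • (1 : H →L[ℂ] H))) := by
  refine IsSelfAdjoint.ringInverse ((IsSelfAdjoint.of_nonneg hρ).add ?_)
  refine IsSelfAdjoint.smul ?_ (IsSelfAdjoint.one _)
  simp [isSelfAdjoint_iff]

theorem isSelfAdjoint_exp_smul {ρ : H →L[ℂ] H} (hρ : 0 ≤ ρ) (s : ℝ) :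
    IsSelfAdjoint (NormedSpace.exp ((-(s / 2) : ℂ) • ρ)) := by
  refine IsSelfAdjoint.exp (IsSelfAdjoint.smul ?_ (IsSelfAdjoint.of_nonneg hρ))
  simp [isSelfAdjoint_iff]

theorem inner_preim_eigenvector {A : H →L[ℂ] H} (hA : IsSelfAdjoint A) {u e : H} {c : ℝ}
    (hc : c ≠ 0) (hu : u ∈ LinearMap.range (A : H →ₗ[ℂ] H)) (he : A e = (c : ℂ) • e) :
    ⟪preim A u, e⟫_ℂ = ((c⁻¹ : ℝ) : ℂ) * ⟪u, e⟫_ℂ := by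
  have h := hA.isSymmetric (preim A u) e
  have h1 : ⟪u, e⟫_ℂ = c * ⟪preim A u, e⟫_ℂ := by
    rw [← inner_smul_right, ← he]
    refine Eq.trans ?_ h
    congr 1
    exact (preim_spec hu).symm
  have h0 : (c : ℂ) ≠ 0 := by exact_mod_cast hc
  rw [h1, Complex.ofReal_inv, inv_mul_cancel_left₀ h0]

end Generic

/-! ### Kernels of the logarithmic derivatives -/

/-- Partial fractions give the antiderivative (log (c + x) - log (a + x)) / (a - c), which vanishes
at infinity; integrability comes from the positivity of the integrand. -/
theorem integral_inv_mul_inv {a c : ℝ} (ha : 0 < a) (hc : 0 < c) (hac : a ≠ c) :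
    IntegrableOn (fun x => (a + x)⁻¹ * (c + x)⁻¹) (Ioi (0 : ℝ)) ∧
    ∫ x in Ioi (0 : ℝ), (a + x)⁻¹ * (c + x)⁻¹ = (Real.log a - Real.log c) / (a - c) := by
  have hd : ∀ x ∈ Ici (0 : ℝ), HasDerivAt
      (fun x => (Real.log (c + x) - Real.log (a + x)) / (a - c)) ((a + x)⁻¹ * (c + x)⁻¹) x := by
    intro x hx
    have h1 : c + x ≠ 0 := by have := mem_Ici.1 hx; positivity
    have h2 : a + x ≠ 0 := by have := mem_Ici.1 hx; positivity
    have h3 : a - c ≠ 0 := sub_ne_zero.2 hac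
    have := ((((hasDerivAt_id x).const_add c).log h1).sub
      (((hasDerivAt_id x).const_add a).log h2)).div_const (a - c)
    refine this.congr_deriv ?_
    simp only [id_eq]
    field_simp
    ring
  have hlim : Tendsto (fun x : ℝ => (Real.log (c + x) - Real.log (a + x)) / (a - c)) atTop
      (𝓝 0) := by
    have h1 : Tendsto (fun x : ℝ => (c - a) / (a + x) + 1) atTop (𝓝 (0 + 1)) :=
      (tendsto_const_nhds.div_atTop (tendsto_atTop_add_const_left _ _ tendsto_id)).add_const 1
    have h2 : Tendsto (fun x : ℝ => Real.log ((c - a) / (a + x) + 1) / (a - c)) atTop (𝓝 0) := by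
      have := (h1.log (by norm_num)).div_const (a - c)
      simpa using this
    refine h2.congr' ?_
    filter_upwards [eventually_gt_atTop 0] with x hx
    have h1 : c + x ≠ 0 := by positivity
    have h2 : a + x ≠ 0 := by positivity
    rw [← Real.log_div h1 h2]
    congr 2
    field_simp
    ring
  have hpos : ∀ x ∈ Ioi (0 : ℝ), 0 ≤ (a + x)⁻¹ * (c + x)⁻¹ := by
    intro x hx
    have := mem_Ioi.1 hx
    positivity
  refine ⟨integrableOn_Ioi_deriv_of_nonneg' hd hpos hlim, ?_⟩
  rw [integral_Ioi_of_hasDerivAt_of_nonneg' hd hpos hlim]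
  simp
  ring

theorem integral_exp_neg_half {a : ℝ} (ha : 0 < a) :
    IntegrableOn (fun s => Real.exp (-(s / 2) * a)) (Ioi (0 : ℝ)) ∧
    ∫ s in Ioi (0 : ℝ), Real.exp (-(s / 2) * a) = 2 / a := by
  have e : (fun s : ℝ => Real.exp (-(s / 2) * a)) = fun s => Real.exp ((-(a / 2)) * s) := by
    ext s; ring_nf
  have h : -(a / 2) < 0 := by linarith
  rw [e]
  refine ⟨integrableOn_exp_mul_Ioi h 0, ?_⟩
  rw [integral_exp_mul_Ioi h]
  simp

/-- The Schur multiplier that carries `X` to its logarithmic derivative in an eigenbasis. -/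
def ldKernel (m : LDModel) (a c : ℝ) : ℝ :=
  match m with
  | .bvn => (Real.log a - Real.log c) / (a - c)
  | .ld1 => (a⁻¹ + c⁻¹) / 2
  | .ld2 => (a ^ (1 / 2 : ℝ))⁻¹ * (c ^ (1 / 2 : ℝ))⁻¹
  | .ld3 => 2 / (a + c)

theorem ldKernel_comm (m : LDModel) (a c : ℝ) : ldKernel m a c = ldKernel m c a := by
  cases m
  · simp only [ldKernel]; rw [← neg_sub a c, ← neg_sub (Real.log a), neg_div_neg_eq]
  · simp only [ldKernel]; ring
  · simp only [ldKernel]; ring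
  · simp only [ldKernel]; ring

/-! ### The logarithmic derivative forms at eigenvectors. -/

section Generic

variable {H : Type*} [NormedAddCommGroup H] [InnerProductSpace ℂ H] [CompleteSpace H]

/-- Each form treats its two arguments alike, so it is hermitian when X is. This converts knowledge
of the columns of the form into knowledge of its rows. -/
theorem ldForm_conj (m : LDModel) {ρ X : H →L[ℂ] H} (hX : IsSelfAdjoint X) (u v : H) :
    (starRingEnd ℂ) (ldForm m ρ X u v) = ldForm m ρ X v u := by
  have hs : ∀ x y : H, ⟪X x, y⟫_ℂ = ⟪x, X y⟫_ℂ := fun x y => hX.isSymmetric x y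
  cases m
  · simp only [ldForm]
    rw [← integral_conj]
    simp only [inner_conj_symm, hs]
  · simp only [ldForm]
    simp only [map_div₀, map_add, inner_conj_symm, hs, map_ofNat]
    rw [add_comm]
  · simp only [ldForm, inner_conj_symm, hs]
  · simp only [ldForm]
    rw [← integral_conj]
    simp only [inner_conj_symm, hs]

theorem injective_sqrt {ρ : H →L[ℂ] H} (hρ : 0 ≤ ρ) (hinj : Function.Injective ρ) :
    Function.Injective (ρ ^ (1 / 2 : ℝ) : H →L[ℂ] H) := by
  rw [← CFC.sqrt_eq_rpow]
  intro x y hxy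
  apply hinj
  rw [← CFC.sqrt_mul_sqrt_self ρ, mul_apply_eq_comp, hxy]
  rfl

/-- The form of a logarithmic derivative at an eigenvector that `X` maps to a finite combination of
eigenvectors for other eigenvalues. -/
theorem ldForm_eigenvector (m : LDModel) {ρ X : H →L[ℂ] H} (hρ : 0 ≤ ρ)
    (hinj : Function.Injective ρ) (hX : IsSelfAdjoint X) {ι : Type*} (s : Finset ι) {e : ι → H}
    {c : ι → ℝ} {x : ι → ℂ} {v : H} {a : ℝ} (ha : 0 < a) (hv : ρ v = (a : ℂ) • v)
    (hc : ∀ i ∈ s, 0 < c i) (hca : ∀ i ∈ s, c i ≠ a) (he : ∀ i ∈ s, ρ (e i) = (c i : ℂ) • e i)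
    (hXv : X v = ∑ i ∈ s, x i • e i) {u : H} (hu : u ∈ ldDomain m ρ) :
    ⟪u, ∑ i ∈ s, (x i * (ldKernel m (c i) a : ℂ)) • e i⟫_ℂ = ldForm m ρ X u v := by
  have hsa := IsSelfAdjoint.of_nonneg hρ
  rw [inner_sum]
  simp only [inner_smul_right]
  cases m
  · simp only [ldForm, ldKernel]
    -- The vector u is arbitrary; self-adjointness of the resolvent moves it onto the eigenvectors e
    -- i, where it is a scalar.
    have h1 : ∀ t ∈ Ioi (0 : ℝ), ⟪Ring.inverse (ρ + (t : ℂ) • (1 : H →L[ℂ] H)) u,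
        X (Ring.inverse (ρ + (t : ℂ) • (1 : H →L[ℂ] H)) v)⟫_ℂ =
        ∑ i ∈ s, ((((c i + t)⁻¹ * (a + t)⁻¹ : ℝ) : ℂ)) * (x i * ⟪u, e i⟫_ℂ) := by
      intro t ht
      rw [inverse_apply_eigenvector hρ hv ha ht, map_smul, hXv, inner_smul_right, inner_sum,
        Finset.mul_sum]
      refine Finset.sum_congr rfl fun i hi => ?_
      rw [inner_smul_right]
      have := (isSelfAdjoint_inverse_add hρ t).isSymmetric u (e i)
      simp only [ContinuousLinearMap.coe_coe] at this
      rw [this, inverse_apply_eigenvector hρ (he i hi) (hc i hi) ht, inner_smul_right]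
      push_cast
      ring
    -- Distinctness matters in this model: at c i = a the kernel is 0 by the convention on division,
    -- while the integral is 1/a.
    rw [setIntegral_congr_fun measurableSet_Ioi h1, integral_finsetSum]
    · refine Finset.sum_congr rfl fun i hi => ?_
      rw [integral_mul_const, integral_complex_ofReal, (integral_inv_mul_inv (hc i hi) ha (hca i hi)).2]
      ring
    · intro i hi
      exact ((integral_inv_mul_inv (hc i hi) ha (hca i hi)).1.ofReal).mul_const _
  · simp only [ldForm, ldKernel]
    have h2 : ⟪X u, preim ρ v⟫_ℂ = ((a⁻¹ : ℝ) : ℂ) * ⟪u, X v⟫_ℂ := by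
      rw [preim_eigenvector hinj ha.ne' hv, inner_smul_right]
      congr 1
      exact hX.isSymmetric u v
    rw [h2, hXv, inner_sum, inner_sum, Finset.mul_sum, ← Finset.sum_add_distrib, Finset.sum_div]
    refine Finset.sum_congr rfl fun i hi => ?_
    rw [inner_smul_right, inner_smul_right, inner_preim_eigenvector hsa (hc i hi).ne' hu (he i hi)]
    push_cast
    ring
  · simp only [ldForm, ldKernel]
    have hrs : IsSelfAdjoint (ρ ^ (1 / 2 : ℝ) : H →L[ℂ] H) :=
      IsSelfAdjoint.of_nonneg CFC.rpow_nonneg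
    have ha2 : 0 < a ^ (1 / 2 : ℝ) := by positivity
    rw [preim_eigenvector (injective_sqrt hρ hinj) ha2.ne'
      (rpow_apply_eigenvector hρ hv (by norm_num)), map_smul, inner_smul_right, hXv, inner_sum,
      Finset.mul_sum]
    refine Finset.sum_congr rfl fun i hi => ?_
    have hc2 : 0 < c i ^ (1 / 2 : ℝ) := Real.rpow_pos_of_pos (hc i hi) _
    rw [inner_smul_right, inner_preim_eigenvector hrs hc2.ne' hu
      (rpow_apply_eigenvector hρ (he i hi) (by norm_num))]
    push_cast
    ring
  · simp only [ldForm, ldKernel]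
    have h1 : ∀ t ∈ Ioi (0 : ℝ), ⟪NormedSpace.exp ((-(t / 2) : ℂ) • ρ) u,
        X (NormedSpace.exp ((-(t / 2) : ℂ) • ρ) v)⟫_ℂ =
        ∑ i ∈ s, ((Real.exp (-(t / 2) * (c i + a)) : ℝ) : ℂ) * (x i * ⟪u, e i⟫_ℂ) := by
      intro t ht
      rw [exp_apply_eigenvector hv, map_smul, hXv, inner_smul_right, inner_sum,
        Finset.mul_sum]
      refine Finset.sum_congr rfl fun i hi => ?_
      rw [inner_smul_right]
      have := (isSelfAdjoint_exp_smul hρ t).isSymmetric u (e i)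
      simp only [ContinuousLinearMap.coe_coe] at this
      rw [this, exp_apply_eigenvector (he i hi), inner_smul_right]
      push_cast
      rw [mul_add, Complex.exp_add]
      ring
    rw [setIntegral_congr_fun measurableSet_Ioi h1, integral_finsetSum]
    · refine Finset.sum_congr rfl fun i hi => ?_
      rw [integral_mul_const, integral_complex_ofReal,
        (integral_exp_neg_half (add_pos (hc i hi) ha)).2]
      ring
    · intro i hi
      exact ((integral_exp_neg_half (add_pos (hc i hi) ha)).1.ofReal).mul_const _

end Generic

/-! ### Ladder pairs: diagonal states with geometric spectrum. -/

section Generic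

variable {H : Type*} [NormedAddCommGroup H] [InnerProductSpace ℂ H]

/-- Symmetry moves A onto `b i`, where it is the scalar α i, and moves B onto the row r i. -/
theorem sandwich_rows {b : HilbertBasis ℕ ℂ H} {A B : H →L[ℂ] H} {T : H →ₗ.[ℂ] H} {α : ℕ → ℝ}
    {r : ℕ → H} (hA : A.toLinearMap.IsSymmetric) (hB : B.toLinearMap.IsSymmetric)
    (hAb : ∀ i, A (b i) = (α i : ℂ) • b i)
    (hT : ∀ (v : T.domain) (i : ℕ), ⟪b i, T v⟫_ℂ = ⟪r i, (v : H)⟫_ℂ)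
    (v : (sandwich A T B).domain) (i : ℕ) :
    ⟪b i, sandwich A T B v⟫_ℂ = ⟪(α i : ℂ) • B (r i), (v : H)⟫_ℂ := by
  have h1 : sandwich A T B v = A (T ⟨B v, v.2⟩) := rfl
  have h2 : ⟪b i, A (T ⟨B v, v.2⟩)⟫_ℂ = ⟪A (b i), T ⟨B v, v.2⟩⟫_ℂ := (hA _ _).symm
  have h3 : ⟪r i, B (v : H)⟫_ℂ = ⟪B (r i), (v : H)⟫_ℂ := (hB _ _).symm
  rw [h1, h2, hAb, inner_smul_left, inner_smul_left, hT, h3]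

theorem mem_sandwich_domain {A B : H →L[ℂ] H} {T : H →ₗ.[ℂ] H} {v : H} {β : ℂ}
    (hBv : B v = β • v) (hv : v ∈ T.domain) : v ∈ (sandwich A T B).domain := by
  change B v ∈ T.domain
  rw [hBv]
  exact T.domain.smul_mem _ hv

/-- The image `√(j+1) b (j+1) + √j b (j-1)` of a basis vector under the sum of the creation and
annihilation operators. -/
def ladderSum (b : ℕ → H) (j : ℕ) : H :=
  ((√(j + 1 : ℝ) : ℝ) : ℂ) • b (j + 1) + ((√(j : ℝ) : ℝ) : ℂ) • b (j - 1)

/-- The image `√(j+1) b (j+1) - √j b (j-1)` of a basis vector under the difference of the creation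
and annihilation operators. -/
def ladderDiff (b : ℕ → H) (j : ℕ) : H :=
  ((√(j + 1 : ℝ) : ℝ) : ℂ) • b (j + 1) - ((√(j : ℝ) : ℝ) : ℂ) • b (j - 1)

variable [CompleteSpace H]

/-- `ρ` is diagonal in the basis `b` with geometric eigenvalues `l`, and `X` is its commutator with
the difference of the ladder operators. -/
structure IsLadderPair (b : HilbertBasis ℕ ℂ H) (l : ℕ → ℝ) (q : ℝ) (ρ X : H →L[ℂ] H) : Prop where
  nonneg : 0 ≤ ρ
  selfAdjoint : IsSelfAdjoint X
  q_pos : 0 < q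
  q_lt_one : q < 1
  pos : ∀ k, 0 < l k
  succ : ∀ k, l (k + 1) = q * l k
  apply_basis : ∀ k, ρ (b k) = (l k : ℂ) • b k
  -- At j = 0 the truncated index j - 1 is 0, but the factor √0 removes that term.
  apply_deriv : ∀ j, X (b j) = (((l j - l (j + 1)) * √(j + 1 : ℝ) : ℝ) : ℂ) • b (j + 1) +
    (((l (j - 1) - l j) * √(j : ℝ) : ℝ) : ℂ) • b (j - 1)

theorem injective_of_diagonal {b : HilbertBasis ℕ ℂ H} {l : ℕ → ℝ} {ρ : H →L[ℂ] H} (hρ : 0 ≤ ρ)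
    (hl : ∀ k, l k ≠ 0) (hb : ∀ k, ρ (b k) = (l k : ℂ) • b k) : Function.Injective ρ := by
  rw [injective_iff_map_eq_zero]
  intro v hv
  refine hilbertBasis_ext_inner b fun i => ?_
  have h1 : ⟪ρ (b i), v⟫_ℂ = ⟪b i, ρ v⟫_ℂ := (IsSelfAdjoint.of_nonneg hρ).isSymmetric _ _
  rw [hb, hv, inner_smul_left, inner_zero_right, Complex.conj_ofReal] at h1
  rw [inner_zero_right]
  exact (mul_eq_zero.1 h1).resolve_left (by exact_mod_cast hl i)

theorem eigenvector_mem_ldDomain (m : LDModel) {ρ : H →L[ℂ] H} (hρ : 0 ≤ ρ) {v : H} {a : ℝ}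
    (ha : 0 < a) (hv : ρ v = (a : ℂ) • v) : v ∈ ldDomain m ρ := by
  have key : ∀ (A : H →L[ℂ] H) (c : ℝ), 0 < c → A v = (c : ℂ) • v →
      v ∈ LinearMap.range (A : H →ₗ[ℂ] H) := by
    intro A c hc hA
    refine ⟨((c : ℂ)⁻¹) • v, ?_⟩
    have h0 : (c : ℂ) ≠ 0 := by exact_mod_cast hc.ne'
    rw [ContinuousLinearMap.coe_coe, map_smul, hA, smul_smul, inv_mul_cancel₀ h0, one_smul]
  have h2 := key _ _ (Real.rpow_pos_of_pos ha (1 / 2))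
    (rpow_apply_eigenvector hρ hv (by norm_num : (0 : ℝ) ≤ 1 / 2))
  cases m
  · exact h2
  · exact key ρ a ha hv
  · exact h2
  · exact h2

theorem ldVariance_zero {b : HilbertBasis ℕ ℂ H} {l : ℕ → ℝ} {ρ : H →L[ℂ] H} (m : LDModel)
    (hρ : 0 ≤ ρ) (hl : ∀ k, 0 < l k) (hb : ∀ k, ρ (b k) = (l k : ℂ) • b k) :
    ldVariance m ρ ⟨ldDomain m ρ, 0⟩ = 0 := by
  have key : ∀ (A : H →L[ℂ] H) (s : ℝ), 0 ≤ s →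
      hsNormSq (sandwich A ⟨ldDomain m ρ, 0⟩ (ρ ^ s : H →L[ℂ] H)) = 0 := by
    intro A s hs
    rw [hsNormSq_eq_tsum b _ (fun _ => 0)]
    · simp
    · exact fun i => mem_sandwich_domain (rpow_apply_eigenvector hρ (hb i) hs)
        (eigenvector_mem_ldDomain m hρ (hl i) (hb i))
    · intro v i
      have : sandwich A ⟨ldDomain m ρ, 0⟩ (ρ ^ s : H →L[ℂ] H) v = A 0 := rfl
      rw [this, map_zero, inner_zero_right, inner_zero_left]
  cases m
  · simp only [ldVariance]
    rw [setLIntegral_congr_fun measurableSet_Ioo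
      (g := fun _ => 0) fun t ht => key _ _ (by have := ht.1; positivity)]
    simp
  all_goals
    simp only [ldVariance]
    exact key _ _ (by norm_num)

/-- Homogeneity of degree -1, shared by the four kernels, is the only property of them that makes
the factor in `kernel_eq` constant. -/
theorem ldKernel_smul (m : LDModel) {t a c : ℝ} (ht : 0 < t) (ha : 0 < a) (hc : 0 < c) :
    ldKernel m (t * a) (t * c) = t⁻¹ * ldKernel m a c := by
  cases m
  · simp only [ldKernel]
    rw [Real.log_mul ht.ne' ha.ne', Real.log_mul ht.ne' hc.ne', ← mul_sub, mul_comm t,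
      ← div_div, add_sub_add_left_eq_sub, div_eq_inv_mul]
  · simp only [ldKernel]
    field_simp
  · simp only [ldKernel]
    rw [Real.mul_rpow ht.le ha.le, Real.mul_rpow ht.le hc.le]
    have : t ^ (1 / 2 : ℝ) * t ^ (1 / 2 : ℝ) = t := by
      rw [← Real.rpow_add ht]; norm_num
    conv_rhs => rw [← this]
    field_simp
  · simp only [ldKernel]
    rw [← mul_add]
    field_simp

/-- The factor by which a logarithmic derivative of a ladder pair exceeds the ladder sum. -/
def ldFactor (m : LDModel) (q : ℝ) : ℝ := (1 - q) * ldKernel m q 1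

namespace IsLadderPair

variable {b : HilbertBasis ℕ ℂ H} {l : ℕ → ℝ} {q : ℝ} {ρ X : H →L[ℂ] H}

theorem injective (h : IsLadderPair b l q ρ X) : Function.Injective ρ :=
  injective_of_diagonal h.nonneg (fun k => (h.pos k).ne') h.apply_basis

theorem succ_ne (h : IsLadderPair b l q ρ X) (k : ℕ) : l (k + 1) ≠ l k := by
  rw [h.succ]
  have := h.pos k
  have := h.q_lt_one
  nlinarith

/-- The difference l k - l (k+1) = (1 - q) l k has degree 1 in l k and the kernel has degree -1, so
l k cancels. -/
theorem kernel_eq (h : IsLadderPair b l q ρ X) (m : LDModel) (k : ℕ) :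
    (l k - l (k + 1)) * ldKernel m (l (k + 1)) (l k) = ldFactor m q := by
  have hk := h.pos k
  have e : ldKernel m (l (k + 1)) (l k) = (l k)⁻¹ * ldKernel m q 1 := by
    rw [← ldKernel_smul m hk h.q_pos one_pos, h.succ, mul_one, mul_comm]
  rw [e, h.succ, ldFactor]
  field_simp

/-- The entries of X are (l j - l (j+1)) √(j+1) above and (l (j-1) - l j) √j below; as the kernel is
symmetric, both get the same positive-signed factor. Thus the commutator with a† - a becomes a
multiple of a† + a. -/
theorem inner_ladderSum (h : IsLadderPair b l q ρ X) (m : LDModel) (j : ℕ) {u : H}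
    (hu : u ∈ ldDomain m ρ) :
    ⟪u, (ldFactor m q : ℂ) • ladderSum b j⟫_ℂ = ldForm m ρ X u (b j) := by
  -- For j = 0 the lowering index would be 0 itself, violating distinctness of the eigenvalues, so
  -- only index 1 is kept.
  rcases j with _ | k
  · have h1 := ldForm_eigenvector m h.nonneg h.injective h.selfAdjoint ({1} : Finset ℕ)
      (e := b) (c := l) (x := fun _ => ((l 0 - l 1 : ℝ) : ℂ)) (h.pos 0) (h.apply_basis 0)
      (fun i _ => h.pos i) (by simpa using h.succ_ne 0) (fun i _ => h.apply_basis i)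
      (by rw [h.apply_deriv]; simp) hu
    rw [← h1, Finset.sum_singleton, ← h.kernel_eq m 0]
    simp [ladderSum]
  · have hne : k + 2 ≠ k := by omega
    have h1 := ldForm_eigenvector m h.nonneg h.injective h.selfAdjoint ({k + 2, k} : Finset ℕ)
      (e := b) (c := l) (x := fun i => if i = k then (((l k - l (k + 1)) * √(k + 1 : ℝ) : ℝ) : ℂ)
        else (((l (k + 1) - l (k + 2)) * √(k + 2 : ℝ) : ℝ) : ℂ)) (h.pos (k + 1))
      (h.apply_basis (k + 1))
      (fun i _ => h.pos i) (by simpa using ⟨h.succ_ne (k + 1), (h.succ_ne k).symm⟩)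
      (fun i _ => h.apply_basis i)
      (by
        rw [h.apply_deriv, Finset.sum_pair hne, if_neg hne, if_pos rfl]
        norm_num [add_assoc]) hu
    rw [← h1, Finset.sum_pair hne, if_neg hne, if_pos rfl, ladderSum, smul_add, smul_smul,
      smul_smul]
    congr 3
    · rw [← h.kernel_eq m (k + 1)]
      push_cast
      rw [add_assoc, one_add_one_eq_two]
      ring_nf
    · rw [← h.kernel_eq m k, ldKernel_comm]
      push_cast
      ring

theorem basis_mem_ldDomain (h : IsLadderPair b l q ρ X) (m : LDModel) (j : ℕ) :
    b j ∈ ldDomain m ρ :=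
  eigenvector_mem_ldDomain m h.nonneg (h.pos j) (h.apply_basis j)

theorem ldForm_row (h : IsLadderPair b l q ρ X) (m : LDModel) (i : ℕ) {v : H}
    (hv : v ∈ ldDomain m ρ) :
    ldForm m ρ X (b i) v = ⟪(ldFactor m q : ℂ) • ladderSum b i, v⟫_ℂ := by
  rw [← ldForm_conj m h.selfAdjoint, ← h.inner_ladderSum m i hv, inner_conj_symm]

theorem basis_mem_domain (h : IsLadderPair b l q ρ X) (m : LDModel) (j : ℕ) :
    b j ∈ (ld m ρ X).domain :=
  formOperator_domain_of_mem (h.basis_mem_ldDomain m j) fun _ hu => h.inner_ladderSum m j hu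

theorem ld_apply_basis (h : IsLadderPair b l q ρ X) (m : LDModel) (j : ℕ) :
    ld m ρ X ⟨b j, h.basis_mem_domain m j⟩ = (ldFactor m q : ℂ) • ladderSum b j :=
  formOperator_apply (h.basis_mem_ldDomain m) (fun i _ hv => h.ldForm_row m i hv)
    (h.basis_mem_ldDomain m j) fun _ hu => h.inner_ladderSum m j hu

theorem ld_rows (h : IsLadderPair b l q ρ X) (m : LDModel) (v : (ld m ρ X).domain) (i : ℕ) :
    ⟪b i, ld m ρ X v⟫_ℂ = ⟪(ldFactor m q : ℂ) • ladderSum b i, (v : H)⟫_ℂ :=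
  (formOperator_graph b (h.basis_mem_ldDomain m) (fun i _ hv => h.ldForm_row m i hv)).2 v i

theorem ld_graph (h : IsLadderPair b l q ρ X) (m : LDModel) :
    (ld m ρ X).graph = Submodule.span ℂ {p : H × H | p.1 ∈ ldDomain m ρ ∧
      ∀ u ∈ ldDomain m ρ, ⟪u, p.2⟫_ℂ = ldForm m ρ X u p.1} :=
  (formOperator_graph b (h.basis_mem_ldDomain m) (fun i _ hv => h.ldForm_row m i hv)).1

theorem dense_domain (h : IsLadderPair b l q ρ X) (m : LDModel) :
    Dense ((ld m ρ X).domain : Set H) := by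
  refine (Submodule.dense_iff_topologicalClosure_eq_top.2 b.dense_span).mono ?_
  exact Submodule.span_le.2 (by rintro _ ⟨i, rfl⟩; exact h.basis_mem_domain m i)

/-- Row i has entries only at i + 1 and i - 1, with squared weights l_i^(1-t) l_{i±1}^t = q^(±t)
l_i. -/
theorem norm_row_sq (h : IsLadderPair b l q ρ X) (m : LDModel) {t : ℝ} (ht : t ∈ Icc (0 : ℝ) 1)
    (i : ℕ) :
    ‖((l i ^ ((1 - t) / 2) : ℝ) : ℂ) • (ρ ^ (t / 2) : H →L[ℂ] H)
      ((ldFactor m q : ℂ) • ladderSum b i)‖ ^ 2 =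
    ldFactor m q ^ 2 * (q ^ t * ((i + 1) * l i) + q ^ (-t) * (i * l i)) := by
  have hq := h.q_pos
  have hr : ∀ k, (ρ ^ (t / 2) : H →L[ℂ] H) (b k) = ((l k ^ (t / 2) : ℝ) : ℂ) • b k := fun k =>
    rpow_apply_eigenvector h.nonneg (h.apply_basis k) (by have := ht.1; positivity)
  have hsq : ∀ {a : ℝ} (_ : 0 < a) (s : ℝ), (a ^ (s / 2)) ^ 2 = a ^ s := fun ha s => by
    rw [← Real.rpow_natCast, ← Real.rpow_mul ha.le]; norm_num
  rw [map_smul, norm_smul, norm_smul, mul_pow, mul_pow, Complex.norm_real, Complex.norm_real,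
    Real.norm_eq_abs, Real.norm_eq_abs, sq_abs, sq_abs, hsq (h.pos i), ladderSum, map_add, map_smul,
    map_smul, hr, hr, smul_smul, smul_smul]
  have hon : ∀ x y : ℝ, ‖(x : ℂ) • b (i + 1) + (y : ℂ) • b (i - 1)‖ ^ 2 = x ^ 2 + y ^ 2 := by
    intro x y
    have h0 : ⟪(x : ℂ) • b (i + 1), (y : ℂ) • b (i - 1)⟫_ℂ = 0 := by
      rw [inner_smul_left, inner_smul_right, b.orthonormal.2 (by omega)]
      simp
    rw [sq, norm_add_sq_eq_norm_sq_add_norm_sq_of_inner_eq_zero _ _ h0, norm_smul, norm_smul,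
      b.orthonormal.1, b.orthonormal.1, Complex.norm_real, Complex.norm_real, Real.norm_eq_abs,
      Real.norm_eq_abs, mul_one, mul_one, abs_mul_abs_self, abs_mul_abs_self, sq, sq]
  rw [← Complex.ofReal_mul, ← Complex.ofReal_mul, hon, mul_pow, mul_pow, hsq (h.pos _),
    hsq (h.pos _), Real.sq_sqrt (by positivity), Real.sq_sqrt (by positivity), h.succ,
    Real.mul_rpow hq.le (h.pos i).le]
  have e1 : l i ^ (1 - t) * l i ^ t = l i := by
    rw [← Real.rpow_add (h.pos i)]; simp
  rcases i with _ | k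
  · simp only [CharP.cast_eq_zero, zero_mul, mul_zero, add_zero, zero_add, one_mul]
    linear_combination (ldFactor m q ^ 2 * q ^ t) * e1
  · have e2 : l k ^ t = q ^ (-t) * l (k + 1) ^ t := by
      rw [h.succ, Real.mul_rpow hq.le (h.pos k).le, ← mul_assoc, ← Real.rpow_add hq]
      simp
    rw [Nat.add_sub_cancel, e2]
    linear_combination (ldFactor m q ^ 2 * ((((k + 1 : ℕ) : ℝ) + 1) * q ^ t +
      ((k + 1 : ℕ) : ℝ) * q ^ (-t))) * e1

theorem hsNormSq_sandwich (h : IsLadderPair b l q ρ X) (m : LDModel) {N : ℝ}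
    (hN : HasSum (fun i : ℕ => ((i : ℝ) + 1) * l i) N) {t : ℝ} (ht : t ∈ Icc (0 : ℝ) 1) :
    hsNormSq (sandwich (ρ ^ ((1 - t) / 2) : H →L[ℂ] H) (ld m ρ X) (ρ ^ (t / 2) : H →L[ℂ] H)) =
      ENNReal.ofReal (ldFactor m q ^ 2 * N * (q ^ t + q ^ (1 - t))) := by
  have hsa : ∀ s : ℝ, ((ρ ^ s : H →L[ℂ] H) : H →ₗ[ℂ] H).IsSymmetric := fun s =>
    (IsSelfAdjoint.of_nonneg (CFC.rpow_nonneg (a := ρ) (y := s))).isSymmetric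
  have ht1 : 0 ≤ (1 - t) / 2 := by have := ht.2; linarith
  have ht2 : 0 ≤ t / 2 := by have := ht.1; linarith
  rw [hsNormSq_eq_tsum b _ _
    (fun i => mem_sandwich_domain (rpow_apply_eigenvector h.nonneg (h.apply_basis i) ht2)
      (h.basis_mem_domain m i))
    (sandwich_rows (hsa _) (hsa _)
      (fun i => rpow_apply_eigenvector h.nonneg (h.apply_basis i) ht1) (h.ld_rows m))]
  simp only [← ofReal_norm]
  simp only [← ENNReal.ofReal_pow (norm_nonneg _), h.norm_row_sq m ht]
  -- Shifting the index in Σ i l_i and using l (i+1) = q l i gives q N; this turns q^(-t) into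
  -- q^(1-t).
  have hN2 : HasSum (fun i : ℕ => (i : ℝ) * l i) (q * N) := by
    rw [← hasSum_nat_add_iff' 1]
    simp only [Finset.range_one, Finset.sum_singleton, CharP.cast_eq_zero, zero_mul, sub_zero]
    refine (hN.mul_left q).congr_fun ?_
    intro i
    rw [h.succ]
    push_cast
    ring
  have hq := h.q_pos
  have hsum := ((hN.mul_left (q ^ t)).add (hN2.mul_left (q ^ (-t)))).mul_left (ldFactor m q ^ 2)
  rw [← ENNReal.ofReal_tsum_of_nonneg _ hsum.summable, hsum.tsum_eq]
  · congr 1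
    have : q ^ (1 - t) = q ^ (-t) * q := by
      rw [sub_eq_neg_add, Real.rpow_add hq, Real.rpow_one]
    rw [this]
    ring
  · intro i
    have := h.pos i
    positivity

theorem ldVariance_eq (h : IsLadderPair b l q ρ X) {m : LDModel} (hm : m ≠ .bvn) {N : ℝ}
    (hN : HasSum (fun i : ℕ => ((i : ℝ) + 1) * l i) N) :
    ldVariance m ρ (ld m ρ X) = ENNReal.ofReal (ldFactor m q ^ 2 * N * (q + 1)) := by
  have e : hsNormSq (sandwich 1 (ld m ρ X) (ρ ^ (1 / 2 : ℝ) : H →L[ℂ] H)) =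
      ENNReal.ofReal (ldFactor m q ^ 2 * N * (q + 1)) := by
    -- The three remaining models put the whole square root of ρ on the right, which is the endpoint
    -- t = 1.
    have := h.hsNormSq_sandwich m hN (t := 1) (by norm_num)
    have hρ := h.nonneg
    rwa [sub_self, zero_div, CFC.rpow_zero ρ, Real.rpow_one, Real.rpow_zero] at this
  cases m
  · exact absurd rfl hm
  all_goals exact e

theorem ldVariance_bvn (h : IsLadderPair b l q ρ X) {N : ℝ}
    (hN : HasSum (fun i : ℕ => ((i : ℝ) + 1) * l i) N) :
    ldVariance .bvn ρ (ld .bvn ρ X) = ENNReal.ofReal (2 * N * (1 - q) * (-Real.log q)) := by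
  have hq := h.q_pos
  have hlog : Real.log q ≠ 0 := (Real.log_neg hq h.q_lt_one).ne
  have hN0 : 0 ≤ N := hN.nonneg fun i => by have := h.pos i; positivity
  simp only [ldVariance]
  rw [setLIntegral_congr_fun measurableSet_Ioo
    fun t ht => h.hsNormSq_sandwich .bvn hN (Ioo_subset_Icc_self ht)]
  -- The integral over [0, 1] is 2 (q - 1) / log q. In this model `ldFactor` equals -log q, so its
  -- square leaves one factor log q.
  have hd : ∀ t : ℝ, HasDerivAt (fun t => (q ^ t - q ^ (1 - t)) / Real.log q)
      (q ^ t + q ^ (1 - t)) t := by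
    intro t
    have h1 := (hasDerivAt_id t).const_rpow hq
    have h2 := ((hasDerivAt_id t).const_sub 1).const_rpow hq
    refine ((h1.sub h2).div_const (Real.log q)).congr_deriv ?_
    simp only [id_eq]
    field_simp
    ring
  have hc : Continuous fun t : ℝ => q ^ t + q ^ (1 - t) := by
    have := Real.continuous_const_rpow hq.ne'
    fun_prop
  have hint := intervalIntegral.integral_eq_sub_of_hasDerivAt (a := 0) (b := 1)
    (fun t _ => hd t) (hc.intervalIntegrable _ _)
  rw [← ofReal_integral_eq_lintegral_ofReal]
  · rw [integral_const_mul, ← integral_Ioc_eq_integral_Ioo,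
      ← intervalIntegral.integral_of_le zero_le_one, hint]
    congr 1
    have h1 : (1 - q) ≠ 0 := by have := h.q_lt_one; linarith
    have h2 : q - 1 ≠ 0 := by have := h.q_lt_one; linarith
    simp only [ldFactor, ldKernel, Real.log_one, sub_zero, sub_self, Real.rpow_one, Real.rpow_zero]
    field_simp
    ring
  · exact ((continuous_const.mul hc).integrableOn_Icc (a := 0) (b := 1)).mono_set Ioo_subset_Icc_self
  · exact Filter.Eventually.of_forall fun t => by positivity

end IsLadderPair

end Generic

section Generic

variable {H : Type*} [NormedAddCommGroup H] [InnerProductSpace ℂ H] [CompleteSpace H]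

/-! ### Unitary covariance of logarithmic derivatives -/

section Unitary

variable {U : H →L[ℂ] H}

theorem star_apply_apply_of_unitary (hU : U ∈ unitary (H →L[ℂ] H)) (v : H) : star U (U v) = v := by
  rw [← mul_apply_eq_comp, Unitary.star_mul_self_of_mem hU, one_apply_eq_self]

theorem apply_star_apply_of_unitary (hU : U ∈ unitary (H →L[ℂ] H)) (v : H) : U (star U v) = v := by
  rw [← mul_apply_eq_comp, Unitary.mul_star_self_of_mem hU, one_apply_eq_self]

theorem inner_apply_eq_inner_star (U : H →L[ℂ] H) (u v : H) : ⟪u, U v⟫_ℂ = ⟪star U u, v⟫_ℂ := by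
  rw [ContinuousLinearMap.star_eq_adjoint, ContinuousLinearMap.adjoint_inner_left]

theorem conj_mul_conj_of_unitary (hU : U ∈ unitary (H →L[ℂ] H)) (A B : H →L[ℂ] H) :
    U * A * star U * (U * B * star U) = U * (A * B) * star U := by
  have := Unitary.star_mul_self_of_mem hU
  calc _ = U * A * (star U * U) * B * star U := by simp only [mul_assoc]
    _ = _ := by rw [this, mul_one]; simp only [mul_assoc]

theorem sqrt_conj_of_unitary (hU : U ∈ unitary (H →L[ℂ] H)) {ρ : H →L[ℂ] H} (hρ : 0 ≤ ρ) :
    ((U * ρ * star U) ^ (1 / 2 : ℝ) : H →L[ℂ] H) = U * ρ ^ (1 / 2 : ℝ) * star U := by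
  rw [← CFC.sqrt_eq_rpow, ← CFC.sqrt_eq_rpow]
  refine CFC.sqrt_unique ?_ (star_right_conjugate_nonneg (CFC.sqrt_nonneg ρ) U)
  rw [conj_mul_conj_of_unitary hU, CFC.sqrt_mul_sqrt_self ρ]

theorem isUnit_of_mem_unitary (hU : U ∈ unitary (H →L[ℂ] H)) : IsUnit U :=
  ⟨⟨U, star U, Unitary.mul_star_self_of_mem hU, Unitary.star_mul_self_of_mem hU⟩, rfl⟩

theorem inverse_of_mem_unitary (hU : U ∈ unitary (H →L[ℂ] H)) : Ring.inverse U = star U :=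
  Ring.inverse_unit
    ⟨U, star U, Unitary.mul_star_self_of_mem hU, Unitary.star_mul_self_of_mem hU⟩

/-- Valid for every A: when A is not invertible both sides are 0. -/
theorem inverse_conj_of_unitary (hU : U ∈ unitary (H →L[ℂ] H)) (A : H →L[ℂ] H) :
    Ring.inverse (U * A * star U) = U * Ring.inverse A * star U := by
  have hV := Unitary.star_mem hU
  rw [Ring.inverse_mul (Or.inr (isUnit_of_mem_unitary hV)),
    Ring.inverse_mul (Or.inl (isUnit_of_mem_unitary hU)), inverse_of_mem_unitary hU,
    inverse_of_mem_unitary hV, star_star, mul_assoc]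

theorem exp_conj_of_unitary (hU : U ∈ unitary (H →L[ℂ] H)) (A : H →L[ℂ] H) :
    NormedSpace.exp (U * A * star U) = U * NormedSpace.exp A * star U :=
  letI := NormedAlgebra.restrictScalars ℚ ℂ (H →L[ℂ] H)
  NormedSpace.exp_units_conj
    ⟨U, star U, Unitary.mul_star_self_of_mem hU, Unitary.star_mul_self_of_mem hU⟩ A

theorem mem_range_conj_of_unitary (hU : U ∈ unitary (H →L[ℂ] H)) {A : H →L[ℂ] H} {u : H} :
    u ∈ LinearMap.range ((U * A * star U : H →L[ℂ] H) : H →ₗ[ℂ] H) ↔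
      star U u ∈ LinearMap.range (A : H →ₗ[ℂ] H) := by
  constructor
  · rintro ⟨x, rfl⟩
    exact ⟨star U x, (star_apply_apply_of_unitary hU _).symm⟩
  · rintro ⟨x, hx⟩
    refine ⟨U x, ?_⟩
    change U (A (star U (U x))) = u
    rw [star_apply_apply_of_unitary hU, show A x = star U u from hx,
      apply_star_apply_of_unitary hU]

/-- `preim` chooses some preimage; injectivity of A makes the choice unique and hence compatible
with conjugation. -/
theorem preim_conj_of_unitary (hU : U ∈ unitary (H →L[ℂ] H)) {A : H →L[ℂ] H}
    (hA : Function.Injective A) {u : H} (hu : star U u ∈ LinearMap.range (A : H →ₗ[ℂ] H)) :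
    preim (U * A * star U) u = U (preim A (star U u)) := by
  have h1 : A (preim A (star U u)) = star U u := preim_spec hu
  have h2 := preim_spec ((mem_range_conj_of_unitary hU).2 hu)
  have h3 : U (A (star U (preim (U * A * star U) u))) = u := h2
  have h4 : A (star U (preim (U * A * star U) u)) = A (preim A (star U u)) := by
    rw [h1]
    conv_rhs => rw [← h3]
    rw [star_apply_apply_of_unitary hU]
  rw [← hA h4, apply_star_apply_of_unitary hU]

theorem mem_ldDomain_conj (hU : U ∈ unitary (H →L[ℂ] H)) (m : LDModel) {ρ : H →L[ℂ] H} (hρ : 0 ≤ ρ)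
    {u : H} : u ∈ ldDomain m (U * ρ * star U) ↔ star U u ∈ ldDomain m ρ := by
  have h2 : u ∈ LinearMap.range (((U * ρ * star U) ^ (1 / 2 : ℝ) : H →L[ℂ] H) : H →ₗ[ℂ] H) ↔
      star U u ∈ LinearMap.range ((ρ ^ (1 / 2 : ℝ) : H →L[ℂ] H) : H →ₗ[ℂ] H) := by
    rw [sqrt_conj_of_unitary hU hρ]
    exact mem_range_conj_of_unitary hU
  cases m
  · exact h2
  · exact mem_range_conj_of_unitary hU
  · exact h2
  · exact h2

theorem inner_conj_conj_of_unitary (hU : U ∈ unitary (H →L[ℂ] H)) (R X : H →L[ℂ] H) (u v : H) :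
    ⟪(U * R * star U) u, (U * X * star U) ((U * R * star U) v)⟫_ℂ =
      ⟪R (star U u), X (R (star U v))⟫_ℂ := by
  have h : (U * X * star U) ((U * R * star U) v) = U (X (R (star U v))) := by
    change U (X (star U (U (R (star U v))))) = _
    rw [star_apply_apply_of_unitary hU]
  rw [h, inner_apply_eq_inner_star]
  change ⟪star U (U (R (star U u))), _⟫_ℂ = _
  rw [star_apply_apply_of_unitary hU]

theorem ldForm_conj_of_unitary (hU : U ∈ unitary (H →L[ℂ] H)) (m : LDModel) {ρ X : H →L[ℂ] H}
    (hρ : 0 ≤ ρ) (hinj : Function.Injective ρ) {u v : H} (hu : star U u ∈ ldDomain m ρ)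
    (hv : star U v ∈ ldDomain m ρ) :
    ldForm m (U * ρ * star U) (U * X * star U) u v = ldForm m ρ X (star U u) (star U v) := by
  have hUV := Unitary.mul_star_self_of_mem hU
  cases m
  · simp only [ldForm]
    refine integral_congr_ae (Eventually.of_forall fun x => ?_)
    have e : U * ρ * star U + (x : ℂ) • (1 : H →L[ℂ] H) =
        U * (ρ + (x : ℂ) • (1 : H →L[ℂ] H)) * star U := by
      rw [mul_add, add_mul, mul_smul_comm, smul_mul_assoc, mul_one, hUV]
    simp only [e, inverse_conj_of_unitary hU]
    exact inner_conj_conj_of_unitary hU _ _ _ _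
  · simp only [ldForm]
    rw [preim_conj_of_unitary hU hinj hu, preim_conj_of_unitary hU hinj hv]
    congr 2
    · change ⟪_, U (X (star U v))⟫_ℂ = _
      rw [inner_apply_eq_inner_star, star_apply_apply_of_unitary hU]
    · rw [inner_apply_eq_inner_star]
      change ⟪star U (U (X (star U u))), _⟫_ℂ = _
      rw [star_apply_apply_of_unitary hU]
  · simp only [ldForm]
    rw [sqrt_conj_of_unitary hU hρ, preim_conj_of_unitary hU (injective_sqrt hρ hinj) hu,
      preim_conj_of_unitary hU (injective_sqrt hρ hinj) hv]
    change ⟪_, U (X (star U (U _)))⟫_ℂ = _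
    rw [inner_apply_eq_inner_star, star_apply_apply_of_unitary hU, star_apply_apply_of_unitary hU]
  · simp only [ldForm]
    refine integral_congr_ae (Eventually.of_forall fun s => ?_)
    have e : (-(s / 2) : ℂ) • (U * ρ * star U) = U * ((-(s / 2) : ℂ) • ρ) * star U := by
      rw [mul_smul_comm, smul_mul_assoc]
    simp only [e, exp_conj_of_unitary hU]
    exact inner_conj_conj_of_unitary hU _ _ _ _

/-- The graphs are compared. U × U carries the generating pairs of one form operator onto those of
the other, hence also their spans. The two ladder pairs guarantee that these spans are the graphs.
-/
theorem ld_conj_of_unitary (hU : U ∈ unitary (H →L[ℂ] H)) (m : LDModel) {ρ X : H →L[ℂ] H}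
    {b b' : HilbertBasis ℕ ℂ H} {l : ℕ → ℝ} {q : ℝ} (h : IsLadderPair b l q ρ X)
    (h' : IsLadderPair b' l q (U * ρ * star U) (U * X * star U)) :
    ld m (U * ρ * star U) (U * X * star U) = sandwich U (ld m ρ X) (star U) := by
  have hV := Unitary.star_mem hU
  refine LinearPMap.eq_of_eq_graph ?_
  have key : ∀ p : H × H, p ∈ {p : H × H | p.1 ∈ ldDomain m (U * ρ * star U) ∧
      ∀ u ∈ ldDomain m (U * ρ * star U),
        ⟪u, p.2⟫_ℂ = ldForm m (U * ρ * star U) (U * X * star U) u p.1} ↔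
      (star U p.1, star U p.2) ∈ {p : H × H | p.1 ∈ ldDomain m ρ ∧
      ∀ u ∈ ldDomain m ρ, ⟪u, p.2⟫_ℂ = ldForm m ρ X u p.1} := by
    intro p
    simp only [mem_ofPred_eq, mem_ldDomain_conj hU m h.nonneg]
    refine and_congr_right fun hp => ⟨fun hh u hu => ?_, fun hh u hu => ?_⟩
    · have hu' : star U (U u) ∈ ldDomain m ρ := by rwa [star_apply_apply_of_unitary hU]
      have := hh (U u) hu'
      rw [ldForm_conj_of_unitary hU m h.nonneg h.injective hu' hp,
        star_apply_apply_of_unitary hU] at this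
      rw [← this, inner_apply_eq_inner_star, star_star]
    · rw [ldForm_conj_of_unitary hU m h.nonneg h.injective hu hp, ← hh _ hu,
        inner_apply_eq_inner_star, star_star, apply_star_apply_of_unitary hU]
  have hgr : ∀ p : H × H, p ∈ (sandwich U (ld m ρ X) (star U)).graph ↔
      (star U p.1, star U p.2) ∈ (ld m ρ X).graph := by
    rintro ⟨v, w⟩
    rw [mem_graph_sandwich]
    constructor
    · rintro ⟨y, hy, rfl⟩
      rwa [star_apply_apply_of_unitary hU]
    · intro hh
      exact ⟨_, hh, apply_star_apply_of_unitary hU w⟩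
  have hmap : ∀ (V : H →L[ℂ] H) (S S' : Set (H × H)), (∀ p ∈ S, (V p.1, V p.2) ∈ S') →
      ∀ p ∈ Submodule.span ℂ S, (V p.1, V p.2) ∈ Submodule.span ℂ S' := by
    intro V S S' hS p hp
    induction hp using Submodule.span_induction with
    | mem p hp => exact Submodule.subset_span (hS p hp)
    | zero =>
      simp only [Prod.fst_zero, Prod.snd_zero, map_zero]
      exact (Submodule.span ℂ S').zero_mem
    | add p q _ _ hp hq => simpa using Submodule.add_mem _ hp hq
    | smul c p _ hp => simpa using Submodule.smul_mem _ c hp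
  ext p
  rw [hgr, h'.ld_graph m, h.ld_graph m]
  constructor
  · exact hmap (star U) _ _ (fun p hp => (key p).1 hp) p
  · intro hp
    have := hmap U _ _ (fun p hp => (key (U p.1, U p.2)).2 (by
      simp only [star_apply_apply_of_unitary hU]; exact hp)) _ hp
    simpa only [apply_star_apply_of_unitary hU] using this

end Unitary

end Generic

/-! ### Entire power series -/

section PowerSeries

variable {E : Type*} [NormedAddCommGroup E] [NormedSpace ℂ E]

/-- Summability at the real point r makes ‖c n‖ r^n tend to 0, so the radius is at least r for every
r. -/
theorem hasFPowerSeriesOnBall_of_hasSum {c : ℕ → E} {f : ℂ → E}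
    (h : ∀ z : ℂ, HasSum (fun n => z ^ n • c n) (f z)) :
    HasFPowerSeriesOnBall f (fun n => ContinuousMultilinearMap.mkPiRing ℂ (Fin n) (c n)) 0 ⊤ where
  r_le := by
    refine le_of_eq (Eq.symm (ENNReal.eq_top_of_forall_nnreal_le fun r => ?_))
    refine FormalMultilinearSeries.le_radius_of_tendsto _ (l := 0) ?_
    have := (h (r : ℝ)).summable.tendsto_atTop_zero.norm
    rw [norm_zero] at this
    refine this.congr fun n => ?_
    rw [norm_smul, norm_pow, Complex.norm_real, ContinuousMultilinearMap.norm_mkPiRing, mul_comm]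
    simp
  r_pos := by simp
  hasSum := by
    intro y _
    simpa using h y

theorem eq_zero_of_hasSum_zero {c : ℕ → E} (h : ∀ z : ℂ, HasSum (fun n => z ^ n • c n) 0) (n : ℕ) :
    c n = 0 := by
  have h1 := (hasFPowerSeriesOnBall_of_hasSum (f := 0) h).hasFPowerSeriesAt.eq_zero
  have h2 := congrFun h1 n
  simpa using congrArg (fun p => p (fun _ => (1 : ℂ))) h2

/-- The coefficients of an entire function with values in a closed subspace lie in it. -/
theorem coeff_mem_of_hasSum {c : ℕ → E} {f : ℂ → E} (G : Submodule ℂ E)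
    (hG : IsClosed (G : Set E)) (h : ∀ z : ℂ, HasSum (fun n => z ^ n • c n) (f z))
    (hf : ∀ z, f z ∈ G) (n : ℕ) : c n ∈ G := by
  -- Closedness makes E ⧸ G a normed space; there the image of f is identically 0, so its
  -- coefficients vanish.
  have := hG
  rw [← Submodule.Quotient.mk_eq_zero]
  refine eq_zero_of_hasSum_zero (c := fun n => (Submodule.Quotient.mk (c n) : E ⧸ G)) ?_ n
  intro z
  have h1 := (h z).mapL (Submodule.mkQL G)
  have h2 : Submodule.mkQL G (f z) = 0 := (Submodule.Quotient.mk_eq_zero G).2 (hf z)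
  rw [h2] at h1
  simpa using h1

end PowerSeries

/-! ### Fock space and exponential vectors -/

/-- The number basis of Fock space. -/
def ketBasis : HilbertBasis ℕ ℂ Fock :=
  HilbertBasis.ofRepr (LinearIsometryEquiv.refl ℂ (lp (fun _ : ℕ => ℂ) 2))

theorem ketBasis_apply (n : ℕ) : ketBasis n = ket n := ketBasis.repr_self n

theorem inner_ket_expVec (n : ℕ) (z : ℂ) :
    ⟪ket n, expVec z⟫_ℂ = z ^ n / (√(n.factorial : ℝ) : ℂ) := by
  rw [← ketBasis_apply, ← ketBasis.repr_apply_apply]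
  rfl

theorem inner_ket_ket (j k : ℕ) : ⟪ket j, ket k⟫_ℂ = if j = k then 1 else 0 := by
  have := orthonormal_iff_ite.1 ketBasis.orthonormal j k
  simpa only [ketBasis_apply] using this

theorem norm_ket (n : ℕ) : ‖ket n‖ = 1 := by
  rw [← ketBasis_apply]
  exact ketBasis.orthonormal.1 n

/-- The Taylor coefficients at `0` of the exponential vectors. -/
def expCoeff (n : ℕ) : Fock := ((√(n.factorial : ℝ) : ℂ))⁻¹ • ket n

theorem hasSum_expVec (z : ℂ) : HasSum (fun n => z ^ n • expCoeff n) (expVec z) := by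
  have := ketBasis.hasSum_repr (expVec z)
  simp only [ketBasis.repr_apply_apply, ketBasis_apply, inner_ket_expVec, div_eq_mul_inv,
    ← smul_smul] at this
  exact this

theorem inner_expVec (u v : ℂ) : ⟪expVec u, expVec v⟫_ℂ = Complex.exp ((starRingEnd ℂ) u * v) := by
  have h := ketBasis.hasSum_inner_mul_inner (expVec u) (expVec v)
  have h2 := NormedSpace.expSeries_div_hasSum_exp ((starRingEnd ℂ) u * v)
  rw [← Complex.exp_eq_exp_ℂ] at h2
  refine h.unique (h2.congr_fun ?_)
  intro n
  rw [← inner_conj_symm, ketBasis_apply, inner_ket_expVec, inner_ket_expVec, map_div₀, map_pow,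
    Complex.conj_ofReal, div_mul_div_comm, ← mul_pow, ← Complex.ofReal_mul,
    Real.mul_self_sqrt (by positivity), Complex.ofReal_natCast]

theorem analyticOnNhd_expVec : AnalyticOnNhd ℂ expVec univ := by
  have h := (hasFPowerSeriesOnBall_of_hasSum hasSum_expVec).analyticOnNhd
  simpa using h

theorem differentiable_expVec : Differentiable ℂ expVec := fun z =>
  (analyticOnNhd_expVec z (mem_univ z)).differentiableAt

theorem continuous_expVec : Continuous expVec := differentiable_expVec.continuous

/-- The Taylor coefficients of e(z) are nonzero multiples of the number states and lie in the closed
span of the values. -/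
theorem span_expVec_dense : Dense (Submodule.span ℂ (range expVec) : Set Fock) := by
  have h : ∀ n, ket n ∈ (Submodule.span ℂ (range expVec)).topologicalClosure := by
    intro n
    have h1 := coeff_mem_of_hasSum (Submodule.span ℂ (range expVec)).topologicalClosure
      (Submodule.isClosed_topologicalClosure _) hasSum_expVec
      (fun z => Submodule.le_topologicalClosure _ (Submodule.subset_span ⟨z, rfl⟩)) n
    have h0 : (√(n.factorial : ℝ) : ℂ) ≠ 0 := by
      have : (0 : ℝ) < √(n.factorial : ℝ) := by positivity
      exact_mod_cast this.ne'
    have h2 := Submodule.smul_mem _ (√(n.factorial : ℝ) : ℂ) h1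
    rwa [expCoeff, smul_smul, mul_inv_cancel₀ h0, one_smul] at h2
  rw [Submodule.dense_iff_topologicalClosure_eq_top, eq_top_iff, ← ketBasis.dense_span]
  refine Submodule.topologicalClosure_minimal _ ?_ (Submodule.isClosed_topologicalClosure _)
  rw [Submodule.span_le]
  rintro _ ⟨n, rfl⟩
  rw [ketBasis_apply]
  exact h n

theorem clm_ext_expVec {E : Type*} [NormedAddCommGroup E] [NormedSpace ℂ E] {S T : Fock →L[ℂ] E}
    (h : ∀ w, S (expVec w) = T (expVec w)) : S = T := by
  refine ContinuousLinearMap.ext_on span_expVec_dense ?_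
  rintro _ ⟨w, rfl⟩
  exact h w

theorem clm_ext_inner_expVec {S T : Fock →L[ℂ] Fock}
    (h : ∀ u v, ⟪expVec u, S (expVec v)⟫_ℂ = ⟪expVec u, T (expVec v)⟫_ℂ) : S = T := by
  refine clm_ext_expVec fun v => ?_
  have : innerSL ℂ (S (expVec v)) = innerSL ℂ (T (expVec v)) := by
    refine clm_ext_expVec fun u => ?_
    rw [innerSL_apply_apply, innerSL_apply_apply, ← inner_conj_symm, h, inner_conj_symm]
  exact (innerSL_inj).1 this

/-! ### Weyl operators -/

/-- The value `exp(-|z|²/2 - conj z * w) e(z + w)` of a Weyl operator at an exponential vector. -/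
def weylVec (z w : ℂ) : Fock :=
  Complex.exp (-((‖z‖ ^ 2 / 2 : ℝ) : ℂ) - (starRingEnd ℂ) z * w) • expVec (z + w)

/-- The prefactors exactly cancel the terms |z|², conj z * v and conj u * z in the expansion of conj
(z + u) * (z + v). -/
theorem inner_weylVec (z u v : ℂ) : ⟪weylVec z u, weylVec z v⟫_ℂ = ⟪expVec u, expVec v⟫_ℂ := by
  rw [weylVec, weylVec, inner_smul_left, inner_smul_right, inner_expVec, inner_expVec,
    ← Complex.exp_conj, ← Complex.exp_add, ← Complex.exp_add]
  congr 1
  have h : ((‖z‖ ^ 2 / 2 : ℝ) : ℂ) = (starRingEnd ℂ) z * z / 2 := by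
    rw [mul_comm, Complex.mul_conj, Complex.normSq_eq_norm_sq]
    push_cast
    ring
  simp only [map_sub, map_neg, map_mul, map_add, Complex.conj_conj, Complex.conj_ofReal]
  rw [h]
  ring

theorem span_weylVec_dense (z : ℂ) : Dense (Submodule.span ℂ (range (weylVec z)) : Set Fock) := by
  refine span_expVec_dense.mono ?_
  refine Submodule.span_le.2 ?_
  rintro _ ⟨w, rfl⟩
  have h : weylVec z (w - z) ∈ Submodule.span ℂ (range (weylVec z)) :=
    Submodule.subset_span ⟨_, rfl⟩
  have h2 := Submodule.smul_mem _
    (Complex.exp (-((‖z‖ ^ 2 / 2 : ℝ) : ℂ) - (starRingEnd ℂ) z * (w - z)))⁻¹ h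
  rwa [weylVec, smul_smul, inv_mul_cancel₀ (Complex.exp_ne_zero _), one_smul,
    add_sub_cancel] at h2

theorem isWeyl_unique {z : ℂ} {U V : Fock →L[ℂ] Fock} (hU : IsWeyl z U) (hV : IsWeyl z V) :
    U = V :=
  clm_ext_expVec fun w => by rw [hU.2, hV.2]

/-- Passing to finitely supported functions avoids checking that e(w) ↦ `weylVec z w` is well
defined on the span. The two maps from this free space have equal Gram forms and dense ranges, so
they induce a surjective isometry. -/
theorem exists_isWeyl (z : ℂ) : ∃ U, IsWeyl z U := by
  let e₁ : (ℂ →₀ ℂ) →ₗ[ℂ] Fock := Finsupp.linearCombination ℂ expVec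
  let e₂ : (ℂ →₀ ℂ) →ₗ[ℂ] Fock := Finsupp.linearCombination ℂ (weylVec z)
  have hd₁ : DenseRange e₁ := by
    have := span_expVec_dense
    rwa [← Finsupp.range_linearCombination] at this
  have hd₂ : DenseRange e₂ := by
    have := span_weylVec_dense z
    rwa [← Finsupp.range_linearCombination] at this
  have hin : ∀ c d, ⟪e₂ c, e₂ d⟫_ℂ = ⟪e₁ c, e₁ d⟫_ℂ := by
    intro c d
    induction c using Finsupp.induction_linear with
    | zero => simp
    | add c c' hc hc' => rw [map_add, map_add, inner_add_left, inner_add_left, hc, hc']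
    | single w a =>
      induction d using Finsupp.induction_linear with
      | zero => simp
      | add c c' hc hc' => rw [map_add, map_add, inner_add_right, inner_add_right, hc, hc']
      | single w' a' =>
        simp only [e₁, e₂, Finsupp.linearCombination_single, inner_smul_left, inner_smul_right,
          inner_weylVec]
  have hn : ∀ c, ‖e₂ (LinearEquiv.refl ℂ _ c)‖ = ‖e₁ c‖ := by
    intro c
    rw [LinearEquiv.refl_apply, @norm_eq_sqrt_re_inner ℂ, @norm_eq_sqrt_re_inner ℂ _ _ _ _ (e₁ c),
      hin]
  let W : Fock ≃ₗᵢ[ℂ] Fock := (LinearEquiv.refl ℂ (ℂ →₀ ℂ)).extendOfIsometry e₁ e₂ hd₁ hd₂ hn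
  have hW : ∀ c, W (e₁ c) = e₂ c := fun c => by
    simp [W, LinearEquiv.extendOfIsometry]
  refine ⟨(Unitary.linearIsometryEquiv.symm W : unitary (Fock →L[ℂ] Fock)), Subtype.mem _, ?_⟩
  intro w
  have := hW (Finsupp.single w 1)
  simp only [e₁, e₂, Finsupp.linearCombination_single, one_smul] at this
  exact this

theorem isWeyl_weyl (z : ℂ) : IsWeyl z (weyl z) := Classical.epsilon_spec (exists_isWeyl z)

theorem weyl_unitary (z : ℂ) : weyl z ∈ unitary (Fock →L[ℂ] Fock) := (isWeyl_weyl z).1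

theorem weyl_expVec (z w : ℂ) : weyl z (expVec w) = weylVec z w := (isWeyl_weyl z).2 w

theorem weyl0_unitary (θ : ℝ) : weyl0 θ ∈ unitary (Fock →L[ℂ] Fock) := weyl_unitary θ

theorem weyl0_expVec (θ : ℝ) (w : ℂ) : weyl0 θ (expVec w) =
    Complex.exp (-((θ : ℂ) ^ 2 / 2) - θ * w) • expVec (θ + w) := by
  rw [weyl0, weyl_expVec, weylVec, Complex.conj_ofReal, Complex.norm_real, Real.norm_eq_abs, sq_abs]
  push_cast
  rfl

theorem weyl0_zero : weyl0 0 = 1 := by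
  refine clm_ext_expVec fun w => ?_
  rw [weyl0_expVec]
  simp

/-! ### Coherent states -/

theorem norm_expVec_sq (z : ℂ) : ‖expVec z‖ ^ 2 = Real.exp (‖z‖ ^ 2) := by
  have h := inner_expVec z z
  rw [inner_self_eq_norm_sq_to_K, mul_comm, Complex.mul_conj, Complex.normSq_eq_norm_sq] at h
  have h2 : ((‖expVec z‖ ^ 2 : ℝ) : ℂ) = ((Real.exp (‖z‖ ^ 2) : ℝ) : ℂ) := by
    push_cast
    push_cast at h
    exact h
  exact_mod_cast h2

theorem norm_coherent (z : ℂ) : ‖coherent z‖ = 1 := by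
  have h : ‖coherent z‖ ^ 2 = 1 := by
    rw [coherent, norm_smul, mul_pow, norm_expVec_sq, Complex.norm_real, Real.norm_eq_abs, sq_abs,
      sq, ← Real.exp_add, ← Real.exp_add, ← Real.exp_zero]
    congr 1
    ring
  nlinarith [norm_nonneg (coherent z)]

theorem continuous_coherent : Continuous coherent := by
  have := continuous_expVec
  unfold coherent
  fun_prop

theorem continuous_cohProj : Continuous cohProj := by
  unfold cohProj
  have := continuous_coherent
  have h1 : Continuous fun z => (innerSL ℂ (coherent z)).smulRight (coherent z) := by
    fun_prop
  exact h1

theorem norm_cohProj (z : ℂ) : ‖cohProj z‖ = 1 := by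
  rw [cohProj, InnerProductSpace.norm_rankOne, norm_coherent, one_mul]

theorem rankOne_conj_of_unitary {H : Type*} [NormedAddCommGroup H] [InnerProductSpace ℂ H]
    [CompleteSpace H] (U : H →L[ℂ] H) (x y : H) :
    U * InnerProductSpace.rankOne ℂ x y * star U = InnerProductSpace.rankOne ℂ (U x) (U y) := by
  ext v
  change U (⟪y, star U v⟫_ℂ • x) = ⟪U y, v⟫_ℂ • U x
  rw [map_smul, inner_apply_eq_inner_star, star_star]

theorem weyl0_conj_cohProj (θ : ℝ) (z : ℂ) :
    weyl0 θ * cohProj z * star (weyl0 θ) = cohProj (z + θ) := by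
  rw [cohProj, rankOne_conj_of_unitary]
  have h : ∃ c : ℂ, ‖c‖ = 1 ∧ weyl0 θ (coherent z) = c • coherent (z + θ) := by
    have h1 : (Real.exp (-(‖z + θ‖ ^ 2 / 2)) : ℂ) ≠ 0 := by
      exact_mod_cast (Real.exp_pos _).ne'
    have h2 : ∃ c : ℂ, weyl0 θ (coherent z) = c • coherent (z + θ) := by
      refine ⟨(Real.exp (-(‖z‖ ^ 2 / 2)) : ℂ) * Complex.exp (-((θ : ℂ) ^ 2 / 2) - θ * z) *
        (Real.exp (-(‖z + θ‖ ^ 2 / 2)) : ℂ)⁻¹, ?_⟩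
      rw [coherent, map_smul, weyl0_expVec, coherent, smul_smul, smul_smul,
        mul_assoc _ (_⁻¹) _, inv_mul_cancel₀ h1, mul_one, add_comm z]
    obtain ⟨c, hc⟩ := h2
    refine ⟨c, ?_, hc⟩
    -- The scalar has modulus 1 because both vectors are unit vectors, and such a phase cancels in
    -- the projection.
    have h3 := ContinuousLinearMap.norm_map_of_mem_unitary (weyl0_unitary θ) (coherent z)
    rwa [hc, norm_smul, norm_coherent, norm_coherent, mul_one] at h3
  obtain ⟨c, hc, h⟩ := h
  rw [h, cohProj]
  ext v
  rw [InnerProductSpace.rankOne_apply, InnerProductSpace.rankOne_apply, inner_smul_left, smul_smul]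
  congr 1
  have : (starRingEnd ℂ) c * c = 1 := by
    rw [mul_comm, Complex.mul_conj, Complex.normSq_eq_norm_sq, hc]; simp
  linear_combination (⟪coherent (z + θ), v⟫_ℂ) * this

/-! ### Mixtures of coherent states -/

theorem integrable_smul_cohProj {φ : ℂ → ℝ} (hφ : Integrable φ) :
    Integrable fun z : ℂ => (φ z : ℂ) • cohProj z := by
  have hm : AEStronglyMeasurable (fun z : ℂ => (φ z : ℂ) • cohProj z) :=
    (Complex.continuous_ofReal.comp_aestronglyMeasurable hφ.1).smul
      continuous_cohProj.aestronglyMeasurable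
  refine hφ.norm.mono' hm (Eventually.of_forall fun z => ?_)
  rw [norm_smul, norm_cohProj, mul_one, Complex.norm_real]

/-- The matrix element `⟨u| z⟩⟨z| v⟩`. -/
def cohElem (u v : Fock) (z : ℂ) : ℂ := ⟪u, coherent z⟫_ℂ * ⟪coherent z, v⟫_ℂ

theorem inner_cohProj (u v : Fock) (z : ℂ) : ⟪u, cohProj z v⟫_ℂ = cohElem u v z := by
  rw [cohProj, InnerProductSpace.rankOne_apply, inner_smul_right, mul_comm, cohElem]

theorem continuous_cohElem (u v : Fock) : Continuous (cohElem u v) := by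
  have := continuous_coherent
  unfold cohElem
  fun_prop

theorem norm_cohElem_le (u v : Fock) (z : ℂ) : ‖cohElem u v z‖ ≤ ‖u‖ * ‖v‖ := by
  rw [cohElem, norm_mul]
  have h1 := norm_inner_le_norm (𝕜 := ℂ) u (coherent z)
  have h2 := norm_inner_le_norm (𝕜 := ℂ) (coherent z) v
  rw [norm_coherent] at h1 h2
  rw [mul_one] at h1
  rw [one_mul] at h2
  gcongr

theorem integrable_mul_cohElem {φ : ℂ → ℝ} (hφ : Integrable φ) (u v : Fock) :
    Integrable fun z : ℂ => (φ z : ℂ) * cohElem u v z := by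
  refine (hφ.norm.mul_const (‖u‖ * ‖v‖)).mono' (hφ.ofReal.aestronglyMeasurable.mul
    (continuous_cohElem u v).aestronglyMeasurable) (Eventually.of_forall fun z => ?_)
  rw [norm_mul, Complex.norm_real]
  gcongr
  exact norm_cohElem_le u v z

theorem inner_mixture {φ : ℂ → ℝ} (hφ : Integrable φ) (u v : Fock) :
    ⟪u, mixture φ v⟫_ℂ = ∫ z : ℂ, (φ z : ℂ) * cohElem u v z := by
  have h := ContinuousLinearMap.integral_comp_comm
    ((innerSL ℂ u).comp (ContinuousLinearMap.apply ℂ Fock v)) (integrable_smul_cohProj hφ)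
  rw [mixture]
  refine Eq.trans h.symm ?_
  refine integral_congr_ae (Eventually.of_forall fun z => ?_)
  change ⟪u, ((φ z : ℂ) • cohProj z) v⟫_ℂ = _
  rw [smul_apply, inner_smul_right, inner_cohProj]

/-- Bessel's inequality for a coherent state and two orthonormal families. -/
theorem sum_norm_cohElem_le {ι : Type*} (s : Finset ι) {f g : ι → Fock} (hf : Orthonormal ℂ f)
    (hg : Orthonormal ℂ g) (z : ℂ) : ∑ i ∈ s, ‖cohElem (f i) (g i) z‖ ≤ 1 := by
  have h1 := hf.sum_inner_products_le (x := coherent z) (s := s)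
  have h2 := hg.sum_inner_products_le (x := coherent z) (s := s)
  rw [norm_coherent, one_pow] at h1 h2
  have h3 : ∀ i ∈ s, ‖cohElem (f i) (g i) z‖ ≤
      (‖⟪f i, coherent z⟫_ℂ‖ ^ 2 + ‖⟪g i, coherent z⟫_ℂ‖ ^ 2) / 2 := by
    intro i _
    rw [cohElem, norm_mul, norm_inner_symm (coherent z)]
    nlinarith [sq_nonneg (‖⟪f i, coherent z⟫_ℂ‖ - ‖⟪g i, coherent z⟫_ℂ‖)]
  calc _ ≤ _ := Finset.sum_le_sum h3
    _ = (∑ i ∈ s, ‖⟪f i, coherent z⟫_ℂ‖ ^ 2 + ∑ i ∈ s, ‖⟪g i, coherent z⟫_ℂ‖ ^ 2) / 2 := by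
      rw [← Finset.sum_add_distrib, Finset.sum_div]
    _ ≤ 1 := by linarith

/-- The norms stay inside the integral, so the same estimate bounds the trace norm and justifies
exchanging sum and integral in the trace. -/
theorem sum_norm_mixture_le {φ : ℂ → ℝ} (hφ : Integrable φ) {ι : Type*} (s : Finset ι)
    {f g : ι → Fock} (hf : Orthonormal ℂ f) (hg : Orthonormal ℂ g) :
    ∑ i ∈ s, ∫ z : ℂ, ‖(φ z : ℂ) * cohElem (f i) (g i) z‖ ≤ ∫ z : ℂ, |φ z| := by
  rw [← integral_finsetSum _ fun i _ => (integrable_mul_cohElem hφ _ _).norm]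
  refine integral_mono (integrable_finsetSum _ fun i _ => (integrable_mul_cohElem hφ _ _).norm)
    hφ.norm fun z => ?_
  simp only [norm_mul, Complex.norm_real]
  rw [← Finset.mul_sum]
  exact mul_le_of_le_one_right (norm_nonneg _) (sum_norm_cohElem_le s hf hg z)

theorem traceNorm_mixture_le {φ : ℂ → ℝ} (hφ : Integrable φ) :
    traceNorm (mixture φ) ≤ ENNReal.ofReal (∫ z : ℂ, |φ z|) := by
  refine traceNorm_le _ fun n f g hf hg => ?_
  simp only [← ofReal_norm]
  rw [← ENNReal.ofReal_sum_of_nonneg fun _ _ => norm_nonneg _]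
  refine ENNReal.ofReal_le_ofReal (le_trans (Finset.sum_le_sum fun i _ => ?_)
    (sum_norm_mixture_le hφ Finset.univ hf hg))
  rw [inner_mixture hφ]
  exact norm_integral_le_integral_norm _

theorem isTraceClass_mixture {φ : ℂ → ℝ} (hφ : Integrable φ) : IsTraceClass (mixture φ) :=
  lt_of_le_of_lt (traceNorm_mixture_le hφ) ENNReal.ofReal_lt_top

theorem cohElem_self (v : Fock) (z : ℂ) : cohElem v v z = ((‖⟪coherent z, v⟫_ℂ‖ ^ 2 : ℝ) : ℂ) := by
  rw [cohElem, ← inner_conj_symm, ← Complex.normSq_eq_conj_mul_self, Complex.normSq_eq_norm_sq]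

theorem isPositive_mixture {φ : ℂ → ℝ} (hφ : Integrable φ) (h0 : ∀ z, 0 ≤ φ z) :
    (mixture φ).IsPositive := by
  rw [ContinuousLinearMap.isPositive_iff_complex]
  intro v
  have h1 : ⟪v, mixture φ v⟫_ℂ = ((∫ z : ℂ, φ z * ‖⟪coherent z, v⟫_ℂ‖ ^ 2 : ℝ) : ℂ) := by
    rw [inner_mixture hφ, ← integral_complex_ofReal]
    refine integral_congr_ae (Eventually.of_forall fun z => ?_)
    simp only [cohElem_self]
    push_cast
    rfl
  have h2 : ⟪mixture φ v, v⟫_ℂ = ((∫ z : ℂ, φ z * ‖⟪coherent z, v⟫_ℂ‖ ^ 2 : ℝ) : ℂ) := by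
    rw [← inner_conj_symm, h1, Complex.conj_ofReal]
  rw [h2]
  refine ⟨rfl, ?_⟩
  refine integral_nonneg fun z => ?_
  have := h0 z
  positivity

theorem hasSum_cohElem (z : ℂ) : HasSum (fun n => cohElem (ket n) (ket n) z) 1 := by
  have h := ketBasis.hasSum_inner_mul_inner (coherent z) (coherent z)
  rw [inner_self_eq_norm_sq_to_K, norm_coherent, RCLike.ofReal_one, one_pow] at h
  refine h.congr_fun (fun n => ?_)
  rw [cohElem, mul_comm, ketBasis_apply]

theorem orthonormal_ket : Orthonormal ℂ ket := by
  have := ketBasis.orthonormal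
  rwa [show (ketBasis : ℕ → Fock) = ket from funext ketBasis_apply] at this

/-- After the exchange, the sum over n of the diagonal elements of |z⟩⟨z| is ‖|z⟩‖² = 1. -/
theorem opTrace_mixture {φ : ℂ → ℝ} (hφ : Integrable φ) :
    opTrace (mixture φ) = ((∫ z : ℂ, φ z : ℝ) : ℂ) := by
  have hs : Summable fun n => ∫ z : ℂ, ‖(φ z : ℂ) * cohElem (ket n) (ket n) z‖ :=
    summable_of_sum_le (fun n => integral_nonneg fun z => norm_nonneg _)
      fun s => sum_norm_mixture_le hφ s orthonormal_ket orthonormal_ket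
  rw [opTrace]
  simp only [inner_mixture hφ]
  rw [integral_tsum_of_summable_integral_norm
    (fun n => integrable_mul_cohElem hφ (ket n) (ket n)) hs, ← integral_complex_ofReal]
  refine integral_congr_ae (Eventually.of_forall fun z => ?_)
  simp only [tsum_mul_left, (hasSum_cohElem z).tsum_eq, mul_one]

/-! ### Gaussian densities -/

/-- Fubini in the real and imaginary parts; the `+ 0` matches the general one-dimensional quadratic
exponent. Each variable contributes (π/β)^(1/2). -/
theorem integrable_and_integral_gauss {β : ℝ} (hβ : 0 < β) (c d : ℂ) :
    Integrable (fun z : ℂ => Complex.exp (-β * (z.re : ℂ) ^ 2 + c * z.re + 0) *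
      Complex.exp (-β * (z.im : ℂ) ^ 2 + d * z.im + 0)) ∧
    ∫ z : ℂ, Complex.exp (-β * (z.re : ℂ) ^ 2 + c * z.re + 0) *
      Complex.exp (-β * (z.im : ℂ) ^ 2 + d * z.im + 0) =
      Real.pi / β * Complex.exp ((c ^ 2 + d ^ 2) / (4 * β)) := by
  have hb : (-(β : ℂ)).re < 0 := by simpa using hβ
  have hb0 : (β : ℂ) ≠ 0 := by exact_mod_cast hβ.ne'
  have mp := Complex.volume_preserving_equiv_real_prod
  constructor
  · have h := (integrable_cexp_quadratic' hb c 0).mul_prod (integrable_cexp_quadratic' hb d 0)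
    exact (mp.integrable_comp_emb Complex.measurableEquivRealProd.measurableEmbedding).2 h
  · have h := integral_prod_mul (μ := (volume : Measure ℝ)) (ν := (volume : Measure ℝ))
      (fun x : ℝ => Complex.exp (-β * (x : ℂ) ^ 2 + c * x + 0))
      (fun x : ℝ => Complex.exp (-β * (x : ℂ) ^ 2 + d * x + 0))
    rw [integral_cexp_quadratic hb, integral_cexp_quadratic hb] at h
    have h2 := mp.integral_comp Complex.measurableEquivRealProd.measurableEmbedding
      (fun p : ℝ × ℝ => Complex.exp (-β * (p.1 : ℂ) ^ 2 + c * p.1 + 0) *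
        Complex.exp (-β * (p.2 : ℂ) ^ 2 + d * p.2 + 0))
    refine Eq.trans h2 (Eq.trans h ?_)
    have hpi : (Real.pi : ℂ) / β ≠ 0 := div_ne_zero (by exact_mod_cast Real.pi_ne_zero) hb0
    have h3 : ((Real.pi : ℂ) / β) ^ (1 / 2 : ℂ) * ((Real.pi : ℂ) / β) ^ (1 / 2 : ℂ) =
        (Real.pi : ℂ) / β := by
      rw [← Complex.cpow_add _ _ hpi]
      norm_num
    rw [neg_neg, mul_mul_mul_comm, h3, ← Complex.exp_add]
    congr 2
    field_simp
    ring

theorem ofReal_gaussDensity (M θ : ℝ) (z : ℂ) : (gaussDensity M θ z : ℂ) =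
    (1 / (Real.pi * M) * Real.exp (-(θ ^ 2 / M)) : ℝ) *
      (Complex.exp (-((1 / M : ℝ) : ℂ) * (z.re : ℂ) ^ 2 + (2 * θ / M : ℂ) * z.re + 0) *
      Complex.exp (-((1 / M : ℝ) : ℂ) * (z.im : ℂ) ^ 2 + 0 * z.im + 0)) := by
  rw [gaussDensity]
  push_cast
  rw [mul_assoc, ← Complex.exp_add, ← Complex.exp_add]
  congr 2
  ring

theorem integrable_gaussDensity {M : ℝ} (hM : 0 < M) (θ : ℝ) : Integrable (gaussDensity M θ) := by
  have h := ((integrable_and_integral_gauss (one_div_pos.2 hM) (2 * θ / M : ℂ) 0).1.const_mul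
    ((1 / (Real.pi * M) * Real.exp (-(θ ^ 2 / M)) : ℝ) : ℂ)).re
  refine h.congr (Eventually.of_forall fun z => ?_)
  simp only [← ofReal_gaussDensity]
  rfl

theorem gaussDensity_nonneg {M : ℝ} (hM : 0 < M) (θ : ℝ) (z : ℂ) : 0 ≤ gaussDensity M θ z := by
  unfold gaussDensity
  positivity

theorem isProbDensity_gaussDensity {M : ℝ} (hM : 0 < M) (θ : ℝ) :
    IsProbDensity (gaussDensity M θ) where
  nonneg := gaussDensity_nonneg hM θ
  integrable := integrable_gaussDensity hM θ
  integral_eq_one := by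
    have h : ((∫ z : ℂ, gaussDensity M θ z : ℝ) : ℂ) = 1 := by
      rw [← integral_complex_ofReal]
      simp only [ofReal_gaussDensity]
      rw [integral_const_mul, (integrable_and_integral_gauss (one_div_pos.2 hM) _ 0).2]
      have h1 : (M : ℂ) ≠ 0 := by exact_mod_cast hM.ne'
      have h2 : (Real.pi : ℂ) ≠ 0 := by exact_mod_cast Real.pi_ne_zero
      have h3 : Complex.exp (((2 * θ / M : ℂ) ^ 2 + 0 ^ 2) / (4 * ((1 / M : ℝ) : ℂ))) =
          (Complex.exp (-(θ ^ 2 / M)))⁻¹ := by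
        rw [← Complex.exp_neg]
        congr 1
        push_cast
        field_simp
        ring
      rw [h3]
      push_cast
      have h4 := Complex.exp_ne_zero (-((θ : ℂ) ^ 2 / M))
      field_simp
    exact_mod_cast h

/-- Completing the square splits the dependence on h into a scalar factor and an exponential that is
linear in h, the part to be expanded. -/
theorem gaussDensity_add (M θ h : ℝ) (z : ℂ) :
    gaussDensity M (θ + h) z =
      Real.exp (-(h ^ 2 / M)) * (gaussDensity M θ z * Real.exp (2 * (z.re - θ) / M * h)) := by
  rw [gaussDensity, gaussDensity, mul_assoc, mul_left_comm, ← Real.exp_add, ← Real.exp_add]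
  congr 2
  ring

theorem gaussDensity_sub (M θ : ℝ) (z : ℂ) : gaussDensity M 0 (z - θ) = gaussDensity M θ z := by
  simp [gaussDensity]

/-- Conjugation is continuous and linear, so it passes under the integral and shifts each coherent
projection; translation invariance of Lebesgue measure does the rest. -/
theorem rho_eq_conj {M : ℝ} (hM : 0 < M) (θ : ℝ) :
    rho M θ = weyl0 θ * rho M 0 * star (weyl0 θ) := by
  have h := ContinuousLinearMap.integral_comp_comm
    (((ContinuousLinearMap.mul ℂ (Fock →L[ℂ] Fock)).flip (star (weyl0 θ))).comp
      (ContinuousLinearMap.mul ℂ (Fock →L[ℂ] Fock) (weyl0 θ)))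
    (integrable_smul_cohProj (integrable_gaussDensity hM 0))
  simp only [ContinuousLinearMap.comp_apply, ContinuousLinearMap.flip_apply,
    ContinuousLinearMap.mul_apply'] at h
  rw [rho, rho, mixture, mixture, ← h]
  have h2 := integral_sub_right_eq_self
    (fun z : ℂ => weyl0 θ * ((gaussDensity M 0 z : ℂ) • cohProj z) * star (weyl0 θ)) (θ : ℂ)
    (μ := volume)
  rw [← h2]
  refine integral_congr_ae (Eventually.of_forall fun z => ?_)
  simp only [gaussDensity_sub, mul_smul_comm, smul_mul_assoc, weyl0_conj_cohProj, sub_add_cancel]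

/-! ### The thermal state -/

theorem eigval_pos {M : ℝ} (hM : 0 < M) (k : ℕ) : 0 < eigval M k := by
  unfold eigval
  positivity

theorem eigval_eq (M : ℝ) (k : ℕ) :
    eigval M k = (M * (1 + 1 / M))⁻¹ * ((1 + 1 / M)⁻¹) ^ k := by
  rw [eigval, pow_add, pow_one, mul_inv, mul_inv, inv_pow, mul_assoc]

theorem eigval_succ (M : ℝ) (k : ℕ) : eigval M (k + 1) = (1 + 1 / M)⁻¹ * eigval M k := by
  rw [eigval_eq, eigval_eq, pow_succ]
  ring

theorem ratio_lt_one {M : ℝ} (hM : 0 < M) : (1 + 1 / M)⁻¹ < 1 := by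
  have : 0 < 1 / M := by positivity
  exact inv_lt_one_of_one_lt₀ (by linarith)

theorem summable_eigval {M : ℝ} (hM : 0 < M) : Summable (eigval M) := by
  have h := (summable_geometric_of_lt_one (r := (1 + 1 / M)⁻¹) (by positivity)
    (ratio_lt_one hM)).mul_left (M * (1 + 1 / M))⁻¹
  exact h.congr fun k => (eigval_eq M k).symm

theorem norm_numProj (k : ℕ) : ‖numProj k‖ = 1 := by
  rw [numProj, InnerProductSpace.norm_rankOne, norm_ket, one_mul]

theorem cohElem_expVec (u v z : ℂ) : cohElem (expVec u) (expVec v) z =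
    Complex.exp (-((‖z‖ ^ 2 : ℝ) : ℂ) + (starRingEnd ℂ) u * z + (starRingEnd ℂ) z * v) := by
  rw [cohElem, coherent, inner_smul_left, inner_smul_right, inner_expVec, inner_expVec,
    Complex.conj_ofReal, Complex.ofReal_exp, mul_mul_mul_comm, ← Complex.exp_add,
    ← Complex.exp_add, ← Complex.exp_add]
  congr 1
  push_cast
  ring

theorem inner_rho_expVec {M : ℝ} (hM : 0 < M) (u v : ℂ) :
    ⟪expVec u, rho M 0 (expVec v)⟫_ℂ = ((M * (1 + 1 / M))⁻¹ : ℝ) *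
      Complex.exp (((1 + 1 / M)⁻¹ : ℝ) * ((starRingEnd ℂ) u * v)) := by
  rw [rho, inner_mixture (integrable_gaussDensity hM 0)]
  have hβ : 0 < 1 + 1 / M := by positivity
  -- With c = conj u + v and d = i (conj u - v) one has c² + d² = 4 conj u * v.
  have key := (integrable_and_integral_gauss hβ ((starRingEnd ℂ) u + v)
    (Complex.I * ((starRingEnd ℂ) u - v))).2
  have e : ∀ z : ℂ, (gaussDensity M 0 z : ℂ) * cohElem (expVec u) (expVec v) z =
      ((1 / (Real.pi * M) : ℝ) : ℂ) * (Complex.exp (-((1 + 1 / M : ℝ) : ℂ) * (z.re : ℂ) ^ 2 +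
        ((starRingEnd ℂ) u + v) * z.re + 0) * Complex.exp (-((1 + 1 / M : ℝ) : ℂ) * (z.im : ℂ) ^ 2 +
        (Complex.I * ((starRingEnd ℂ) u - v)) * z.im + 0)) := by
    intro z
    rw [gaussDensity, cohElem_expVec]
    have h1 : ‖z‖ ^ 2 = z.re ^ 2 + z.im ^ 2 := by
      rw [← Complex.normSq_eq_norm_sq, Complex.normSq_apply]; ring
    have h2 : z = z.re + z.im * Complex.I := (Complex.re_add_im z).symm
    have h3 : (starRingEnd ℂ) z = z.re - z.im * Complex.I := by
      apply Complex.ext <;> simp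
    rw [h1, h3]
    -- The fifth occurrence is the bare z in conj u * z; the others stand inside z.re and z.im.
    nth_rewrite 5 [h2]
    push_cast
    rw [mul_assoc, ← Complex.exp_add, ← Complex.exp_add]
    congr 2
    ring
  simp only [e]
  rw [integral_const_mul, key]
  have h1 : (M : ℂ) ≠ 0 := by exact_mod_cast hM.ne'
  have h2 : (Real.pi : ℂ) ≠ 0 := by exact_mod_cast Real.pi_ne_zero
  have h3 : ((1 + 1 / M : ℝ) : ℂ) ≠ 0 := by exact_mod_cast hβ.ne'
  have h4 : (((starRingEnd ℂ) u + v) ^ 2 + (Complex.I * ((starRingEnd ℂ) u - v)) ^ 2) /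
      (4 * ((1 + 1 / M : ℝ) : ℂ)) = (((1 + 1 / M)⁻¹ : ℝ) : ℂ) * ((starRingEnd ℂ) u * v) := by
    rw [mul_pow, Complex.I_sq, Complex.ofReal_inv]
    field_simp
    ring
  rw [h4, ← mul_assoc]
  congr 1
  rw [Complex.ofReal_inv, Complex.ofReal_mul]
  push_cast
  push_cast at h3
  field_simp

/-- Expanding exp (q conj u * v) in powers gives term by term the matrix elements of λ_k |k⟩⟨k|
between e(u) and e(v). The series converges in norm as Σ λ_k does. -/
theorem hasSum_rho_zero {M : ℝ} (hM : 0 < M) :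
    HasSum (fun k => (eigval M k : ℂ) • numProj k) (rho M 0) := by
  have hs : Summable fun k => (eigval M k : ℂ) • numProj k := by
    refine Summable.of_norm ((summable_eigval hM).congr fun k => ?_)
    rw [norm_smul, norm_numProj, mul_one, Complex.norm_real, Real.norm_eq_abs,
      abs_of_pos (eigval_pos hM k)]
  obtain ⟨D, hD⟩ := hs
  suffices rho M 0 = D by rwa [this]
  refine clm_ext_inner_expVec fun u v => ?_
  have h1 := hD.mapL ((innerSL ℂ (expVec u)).comp (ContinuousLinearMap.apply ℂ Fock (expVec v)))
  simp only [ContinuousLinearMap.comp_apply, ContinuousLinearMap.apply_apply,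
    innerSL_apply_apply] at h1
  rw [inner_rho_expVec hM]
  have h2 := NormedSpace.expSeries_div_hasSum_exp
    ((((1 + 1 / M)⁻¹ : ℝ) : ℂ) * ((starRingEnd ℂ) u * v))
  rw [← Complex.exp_eq_exp_ℂ] at h2
  refine (h2.mul_left (((M * (1 + 1 / M))⁻¹ : ℝ) : ℂ)).unique (h1.congr_fun ?_)
  intro k
  rw [smul_apply, numProj, InnerProductSpace.rankOne_apply, inner_smul_right, inner_smul_right,
    ← inner_conj_symm (expVec u), inner_ket_expVec, inner_ket_expVec, map_div₀, map_pow,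
    Complex.conj_ofReal, div_mul_div_comm, ← Complex.ofReal_mul,
    Real.mul_self_sqrt (by positivity), Complex.ofReal_natCast, eigval_eq, mul_pow, mul_pow]
  push_cast
  ring

theorem rho_zero_ket {M : ℝ} (hM : 0 < M) (k : ℕ) :
    rho M 0 (ket k) = (eigval M k : ℂ) • ket k := by
  have h1 := (hasSum_rho_zero hM).mapL (ContinuousLinearMap.apply ℂ Fock (ket k))
  refine h1.unique ?_
  have h2 : (ContinuousLinearMap.apply ℂ Fock (ket k)) ((eigval M k : ℂ) • numProj k) =
      (eigval M k : ℂ) • ket k := by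
    rw [ContinuousLinearMap.apply_apply, smul_apply, numProj, InnerProductSpace.rankOne_apply,
      inner_ket_ket, if_pos rfl, one_smul]
  rw [← h2]
  refine hasSum_single k fun j hj => ?_
  rw [ContinuousLinearMap.apply_apply, smul_apply, numProj, InnerProductSpace.rankOne_apply,
    inner_ket_ket, if_neg hj, zero_smul, smul_zero]

/-! ### Real analyticity in trace norm -/

/-- The mixture of coherent states with an integrable weight, as a trace class operator. -/
def mixtureTC (φ : ℂ → ℝ) (hφ : Integrable φ) : TraceClass Fock :=
  (⟨mixture φ, isTraceClass_mixture hφ⟩ : traceClassSubmodule Fock)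

theorem op_mixtureTC (φ : ℂ → ℝ) (hφ : Integrable φ) : (mixtureTC φ hφ).op = mixture φ := rfl

theorem TraceClass.op_injective {H : Type*} [NormedAddCommGroup H] [InnerProductSpace ℂ H] :
    Function.Injective (TraceClass.op : TraceClass H → H →L[ℂ] H) := Subtype.val_injective

theorem norm_mixtureTC_le (φ : ℂ → ℝ) (hφ : Integrable φ) :
    ‖mixtureTC φ hφ‖ ≤ ∫ z : ℂ, |φ z| := by
  rw [TraceClass.norm_def, op_mixtureTC]
  exact ENNReal.toReal_le_of_le_ofReal (integral_nonneg fun z => abs_nonneg _)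
    (traceNorm_mixture_le hφ)

theorem mixtureTC_smul (c : ℝ) {φ ψ : ℂ → ℝ} (hφ : Integrable φ) (hψ : Integrable ψ)
    (h : ∀ z, ψ z = c * φ z) : mixtureTC ψ hψ = c • mixtureTC φ hφ := by
  apply TraceClass.op_injective
  rw [← Complex.coe_smul, map_smul, op_mixtureTC, op_mixtureTC, mixture, mixture, ← integral_smul]
  refine integral_congr_ae (Eventually.of_forall fun z => ?_)
  simp only [h, smul_smul, Complex.ofReal_mul]

theorem sum_smul_mixtureTC_sub {F : ℕ → ℂ → ℝ} (hF : ∀ n, Integrable (F n)) {G : ℂ → ℝ}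
    (hG : Integrable G) (s : Finset ℕ) (c : ℕ → ℝ) :
    ∑ n ∈ s, c n • mixtureTC (F n) (hF n) - mixtureTC G hG =
      mixtureTC (fun z => ∑ n ∈ s, c n * F n z - G z)
        ((integrable_finsetSum s fun n _ => (hF n).const_mul (c n)).sub hG) := by
  apply TraceClass.op_injective
  simp only [map_sub, map_sum, ← Complex.coe_smul, map_smul, op_mixtureTC, mixture]
  simp only [← integral_smul]
  rw [← integral_finsetSum, ← integral_sub]
  · refine integral_congr_ae (Eventually.of_forall fun z => ?_)
    simp only [smul_smul, ← Complex.ofReal_mul, ← Finset.sum_smul, ← sub_smul]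
    congr 1
    push_cast
    rfl
  · exact integrable_finsetSum s fun n _ => (integrable_smul_cohProj (hF n)).smul (c n : ℂ)
  · exact integrable_smul_cohProj hG
  · exact fun n _ => (integrable_smul_cohProj (hF n)).smul (c n : ℂ)

/-- Dominated convergence gives L¹ convergence of the weights, which controls the trace norm. -/
theorem tendsto_mixtureTC_sum {F : ℕ → ℂ → ℝ} (hF : ∀ n, Integrable (F n)) {G D : ℂ → ℝ}
    (hG : Integrable G) (hD : Integrable D) (c : ℕ → ℝ)
    (hb : ∀ (s : Finset ℕ) z, |∑ n ∈ s, c n * F n z| ≤ D z)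
    (hs : ∀ z, HasSum (fun n => c n * F n z) (G z)) :
    HasSum (fun n => c n • mixtureTC (F n) (hF n)) (mixtureTC G hG) := by
  have hlim : Tendsto (fun s : Finset ℕ => ∫ z : ℂ, |∑ n ∈ s, c n * F n z - G z|) atTop
      (𝓝 (∫ _ : ℂ, (0 : ℝ))) := by
    refine tendsto_integral_filter_of_dominated_convergence (fun z => D z + |G z|)
      (Eventually.of_forall fun s => ?_) (Eventually.of_forall fun s => Eventually.of_forall
        fun z => ?_) (hD.add hG.abs) (Eventually.of_forall fun z => ?_)
    · exact ((integrable_finsetSum s fun n _ => (hF n).const_mul (c n)).sub hG).abs.1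
    · rw [Real.norm_eq_abs, abs_abs]
      exact (abs_sub _ _).trans (add_le_add_left (hb s z) _)
    · have := ((hs z).sub_const (G z)).abs
      rwa [sub_self, abs_zero] at this
  rw [integral_zero] at hlim
  rw [HasSum, tendsto_iff_norm_sub_tendsto_zero]
  refine squeeze_zero (fun _ => norm_nonneg _) (fun s => ?_) hlim
  rw [sum_smul_mixtureTC_sub hF hG]
  exact norm_mixtureTC_le _ _

/-- The Taylor coefficients of a displaced Gaussian density in its displacement, up to the factor
`exp (-h²/M)`. -/
def gaussCoeff (M θ : ℝ) (n : ℕ) (z : ℂ) : ℝ :=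
  gaussDensity M θ z * ((2 * (z.re - θ) / M) ^ n / n.factorial)

theorem continuous_gaussDensity (M θ : ℝ) : Continuous (gaussDensity M θ) := by
  unfold gaussDensity
  fun_prop

theorem integrable_gaussDensity_mul_exp {M : ℝ} (hM : 0 < M) (θ h : ℝ) :
    Integrable fun z : ℂ => gaussDensity M θ z * Real.exp (2 * (z.re - θ) / M * h) := by
  refine ((integrable_gaussDensity hM (θ + h)).const_mul (Real.exp (h ^ 2 / M))).congr
    (Eventually.of_forall fun z => ?_)
  simp only [gaussDensity_add, ← mul_assoc]
  rw [← Real.exp_add]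
  simp

/-- Since e^|x| ≤ e^x + e^(-x), the weight is dominated by multiples of the Gaussians displaced to θ
+ 1 and θ - 1. It is the common majorant for all |h| ≤ 1. -/
theorem integrable_gaussDensity_mul_exp_abs {M : ℝ} (hM : 0 < M) (θ : ℝ) :
    Integrable fun z : ℂ => gaussDensity M θ z * Real.exp |2 * (z.re - θ) / M| := by
  refine ((integrable_gaussDensity_mul_exp hM θ 1).add
    (integrable_gaussDensity_mul_exp hM θ (-1))).mono' ?_ (Eventually.of_forall fun z => ?_)
  · have := continuous_gaussDensity M θ
    exact Continuous.aestronglyMeasurable (by fun_prop)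
  · have h0 := gaussDensity_nonneg hM θ z
    rw [Real.norm_eq_abs, abs_of_nonneg (by positivity)]
    simp only [Pi.add_apply]
    rw [← mul_add, mul_one, mul_neg_one]
    gcongr
    rcases abs_cases (2 * (z.re - θ) / M) with ⟨h, _⟩ | ⟨h, _⟩ <;> rw [h]
    · linarith [Real.exp_pos (-(2 * (z.re - θ) / M))]
    · linarith [Real.exp_pos (2 * (z.re - θ) / M)]

theorem sum_abs_le_exp {x h : ℝ} (hh : |h| ≤ 1) (s : Finset ℕ) :
    ∑ n ∈ s, |h ^ n * (x ^ n / n.factorial)| ≤ Real.exp |x| := by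
  have h1 := NormedSpace.expSeries_div_hasSum_exp |x|
  rw [← Real.exp_eq_exp_ℝ] at h1
  refine le_trans (Finset.sum_le_sum fun n _ => ?_) (sum_le_hasSum s (fun n _ => by positivity) h1)
  rw [abs_mul, abs_div, abs_pow, abs_pow, Nat.abs_cast]
  exact mul_le_of_le_one_left (by positivity) (pow_le_one₀ (abs_nonneg _) hh)

theorem integrable_gaussCoeff {M : ℝ} (hM : 0 < M) (θ : ℝ) (n : ℕ) :
    Integrable (gaussCoeff M θ n) ∧ ∀ z, |gaussCoeff M θ n z| ≤
      gaussDensity M θ z * Real.exp |2 * (z.re - θ) / M| := by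
  have hb : ∀ z, |gaussCoeff M θ n z| ≤
      gaussDensity M θ z * Real.exp |2 * (z.re - θ) / M| := by
    intro z
    have h0 := gaussDensity_nonneg hM θ z
    have h1 := sum_abs_le_exp (x := 2 * (z.re - θ) / M) (h := 1) (by simp) {n}
    rw [Finset.sum_singleton, one_pow, one_mul] at h1
    rw [gaussCoeff, abs_mul, abs_of_nonneg h0]
    gcongr
  refine ⟨(integrable_gaussDensity_mul_exp_abs hM θ).mono' ?_ (Eventually.of_forall hb), hb⟩
  have := continuous_gaussDensity M θ
  unfold gaussCoeff
  exact Continuous.aestronglyMeasurable (by fun_prop)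

theorem hasSum_gaussCoeff {M : ℝ} (hM : 0 < M) (θ : ℝ) {h : ℝ} (hh : |h| ≤ 1) :
    HasSum (fun n => h ^ n • mixtureTC (gaussCoeff M θ n) (integrable_gaussCoeff hM θ n).1)
      (mixtureTC _ (integrable_gaussDensity_mul_exp hM θ h)) := by
  refine tendsto_mixtureTC_sum _ _ (integrable_gaussDensity_mul_exp_abs hM θ) _
    (fun s z => ?_) fun z => ?_
  · have h0 := gaussDensity_nonneg hM θ z
    simp only [gaussCoeff, mul_left_comm _ (gaussDensity M θ z)]
    rw [← Finset.mul_sum, abs_mul, abs_of_nonneg h0]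
    gcongr
    exact (Finset.abs_sum_le_sum_abs _ _).trans (sum_abs_le_exp hh s)
  · have h1 := NormedSpace.expSeries_div_hasSum_exp (2 * (z.re - θ) / M * h)
    rw [← Real.exp_eq_exp_ℝ] at h1
    refine (h1.mul_left (gaussDensity M θ z)).congr_fun (fun n => ?_)
    rw [gaussCoeff, mul_pow]
    ring

theorem analyticOnNhd_rho {M : ℝ} (hM : 0 < M) :
    AnalyticOnNhd ℝ (fun θ => mixtureTC (gaussDensity M θ) (integrable_gaussDensity hM θ))
      univ := by
  intro θ _
  have hps : HasFPowerSeriesOnBall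
      (fun t => mixtureTC _ (integrable_gaussDensity_mul_exp hM θ (t - θ)))
      (fun n => ContinuousMultilinearMap.mkPiRing ℝ (Fin n)
        (mixtureTC (gaussCoeff M θ n) (integrable_gaussCoeff hM θ n).1)) θ 1 := by
    refine ⟨?_, one_pos, ?_⟩
    · rw [← ENNReal.coe_one]
      refine FormalMultilinearSeries.le_radius_of_bound _
        (∫ z : ℂ, gaussDensity M θ z * Real.exp |2 * (z.re - θ) / M|) fun n => ?_
      rw [NNReal.coe_one, one_pow, mul_one, ContinuousMultilinearMap.norm_mkPiRing]
      refine (norm_mixtureTC_le _ _).trans (integral_mono (integrable_gaussCoeff hM θ n).1.abs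
        (integrable_gaussDensity_mul_exp_abs hM θ) (integrable_gaussCoeff hM θ n).2)
    · intro y hy
      have hy1 : |y| ≤ 1 := by
        have : ‖y‖ₑ < 1 := by simpa [enorm_eq_nnnorm] using hy
        rw [← ofReal_norm, Real.norm_eq_abs, ENNReal.ofReal_lt_one] at this
        exact this.le
      simpa using hasSum_gaussCoeff hM θ hy1
  -- The scalar factor exp (-(t-θ)²/M) split off by `gaussDensity_add` is restored here.
  have han : AnalyticAt ℝ (fun t : ℝ => Real.exp (-((t - θ) ^ 2 / M))) θ := by fun_prop
  refine (han.smul hps.analyticAt).congr (Eventually.of_forall fun t => ?_)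
  refine (mixtureTC_smul _ _ _ fun z => ?_).symm
  rw [← gaussDensity_add, add_sub_cancel]

/-! ### The generator of the Weyl group -/

theorem hasDerivAt_expVec (w : ℂ) : HasDerivAt expVec (deriv expVec w) w :=
  (differentiable_expVec w).hasDerivAt

theorem inner_ket_deriv_expVec (n : ℕ) (w : ℂ) :
    ⟪ket n, deriv expVec w⟫_ℂ = n * w ^ (n - 1) * ((√(n.factorial : ℝ) : ℂ))⁻¹ := by
  have h1 : HasDerivAt (fun w => ⟪ket n, expVec w⟫_ℂ) ⟪ket n, deriv expVec w⟫_ℂ w :=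
    (innerSL ℂ (ket n)).hasFDerivAt.comp_hasDerivAt w (hasDerivAt_expVec w)
  simp only [inner_ket_expVec, div_eq_mul_inv] at h1
  exact h1.unique ((hasDerivAt_pow n w).mul_const _)

theorem hasSum_deriv_expVec (w : ℂ) :
    HasSum (fun n : ℕ => w ^ n • (((n : ℂ) + 1) • expCoeff (n + 1))) (deriv expVec w) := by
  have h := ketBasis.hasSum_repr (deriv expVec w)
  simp only [ketBasis.repr_apply_apply, ketBasis_apply, inner_ket_deriv_expVec] at h
  rw [← hasSum_nat_add_iff' 1] at h
  simp only [Finset.range_one, Finset.sum_singleton, CharP.cast_eq_zero, zero_mul, zero_smul,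
    sub_zero] at h
  refine h.congr_fun (fun n => ?_)
  rw [expCoeff, smul_smul, smul_smul, Nat.add_sub_cancel]
  push_cast
  congr 1
  ring

theorem hasSum_smul_expVec (w : ℂ) :
    HasSum (fun n : ℕ => w ^ n • (if n = 0 then 0 else expCoeff (n - 1))) (w • expVec w) := by
  rw [← hasSum_nat_add_iff' 1]
  simp only [Finset.range_one, Finset.sum_singleton, if_pos, smul_zero,
    sub_zero, Nat.add_eq_zero_iff, one_ne_zero, and_false, if_false, Nat.add_sub_cancel]
  refine ((hasSum_expVec w).const_smul w).congr_fun fun n => ?_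
  rw [smul_smul, pow_succ']

/-- Since e'(w) = a† e(w) and w e(w) = a e(w), the Taylor coefficients of e'(w) - w e(w) are those
of e(w) acted on by a† - a. -/
theorem ladderDiff_coeff (n : ℕ) :
    ((n : ℂ) + 1) • expCoeff (n + 1) - (if n = 0 then 0 else expCoeff (n - 1)) =
      ((√(n.factorial : ℝ) : ℂ))⁻¹ • ladderDiff ket n := by
  have hs : ∀ m : ℕ, ((√(m.factorial : ℝ) : ℝ) : ℂ) ≠ 0 := fun m => by
    have : (0 : ℝ) < √(m.factorial : ℝ) := by positivity
    exact_mod_cast this.ne'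
  have hsucc : ∀ m : ℕ, ((√((m + 1).factorial : ℝ) : ℝ) : ℂ) =
      (√((m : ℝ) + 1) : ℝ) * (√(m.factorial : ℝ) : ℝ) := fun m => by
    rw [← Complex.ofReal_mul, ← Real.sqrt_mul (by positivity), Nat.factorial_succ]
    push_cast
    rfl
  have hsq : ∀ m : ℕ, ((√((m : ℝ) + 1) : ℝ) : ℂ) * ((√((m : ℝ) + 1) : ℝ) : ℂ) = m + 1 := fun m => by
    rw [← Complex.ofReal_mul, Real.mul_self_sqrt (by positivity)]
    push_cast
    rfl
  have hs1 : ∀ m : ℕ, ((√((m : ℝ) + 1) : ℝ) : ℂ) ≠ 0 := fun m => by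
    have : (0 : ℝ) < √((m : ℝ) + 1) := by positivity
    exact_mod_cast this.ne'
  have hup : ((n : ℂ) + 1) • expCoeff (n + 1) =
      ((√(n.factorial : ℝ) : ℂ))⁻¹ • (((√(n + 1 : ℝ) : ℝ) : ℂ) • ket (n + 1)) := by
    rw [expCoeff, smul_smul, smul_smul, hsucc, ← hsq]
    congr 1
    have := hs1 n
    have := hs n
    field_simp
  rw [ladderDiff, smul_sub, ← hup]
  congr 1
  rcases n with _ | m
  · simp
  · rw [if_neg (by omega), expCoeff, smul_smul, hsucc, Nat.add_sub_cancel]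
    congr 1
    push_cast
    have := hs1 m
    have := hs m
    field_simp

/-- Orbits of combinations of exponential vectors are explicit; as all W_0(s) are isometric, any
orbit is a uniform limit of these. -/
theorem continuous_weyl0_apply (u : Fock) : Continuous fun s : ℝ => weyl0 s u := by
  have hspan : ∀ w ∈ Submodule.span ℂ (range expVec), Continuous fun s : ℝ => weyl0 s w := by
    intro w hw
    induction hw using Submodule.span_induction with
    | mem x hx =>
      obtain ⟨w, rfl⟩ := hx
      simp only [weyl0_expVec]
      have := continuous_expVec
      fun_prop
    | zero => simp only [map_zero]; exact continuous_const
    | add x y _ _ hx hy => simp only [map_add]; exact hx.add hy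
    | smul c x _ hx => simp only [map_smul]; exact hx.const_smul c
  refine continuous_of_uniform_approx_of_continuous fun V hV => ?_
  obtain ⟨ε, hε, hV⟩ := Metric.mem_uniformity_dist.1 hV
  obtain ⟨w, hw, hd⟩ := span_expVec_dense.exists_dist_lt u hε
  refine ⟨_, hspan w hw, fun s => hV ?_⟩
  rw [dist_eq_norm, ← map_sub, ContinuousLinearMap.norm_map_of_mem_unitary (weyl0_unitary s),
    ← dist_eq_norm]
  exact hd

theorem norm_weyl0_apply (s : ℝ) (u : Fock) : ‖weyl0 s u‖ = ‖u‖ :=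
  ContinuousLinearMap.norm_map_of_mem_unitary (weyl0_unitary s) u

/-- The integrated orbit `∫₀ʰ W₀(s) u ds`. -/
def orbitIntegral (h : ℝ) : Fock →L[ℂ] Fock :=
  LinearMap.mkContinuous
    { toFun := fun u => ∫ s in (0 : ℝ)..h, weyl0 s u
      map_add' := fun u v => by
        simp only [map_add]
        exact intervalIntegral.integral_add ((continuous_weyl0_apply u).intervalIntegrable _ _)
          ((continuous_weyl0_apply v).intervalIntegrable _ _)
      map_smul' := fun c u => by
        simp only [map_smul, RingHom.id_apply]
        exact intervalIntegral.integral_smul c _ } |h| fun u => by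
    refine (intervalIntegral.norm_integral_le_of_norm_le_const (C := ‖u‖)
      fun s _ => (norm_weyl0_apply s u).le).trans ?_
    rw [sub_zero, mul_comm]

theorem orbitIntegral_apply (h : ℝ) (u : Fock) :
    orbitIntegral h u = ∫ s in (0 : ℝ)..h, weyl0 s u := rfl

/-- Differentiate the defining relation of W_0(s) in w. -/
theorem weyl0_deriv_expVec (s : ℝ) (w : ℂ) : weyl0 s (deriv expVec w) =
    Complex.exp (-((s : ℂ) ^ 2 / 2) - s * w) • deriv expVec (s + w) -
      (s * Complex.exp (-((s : ℂ) ^ 2 / 2) - s * w)) • expVec (s + w) := by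
  have h1 : HasDerivAt (fun w => weyl0 s (expVec w)) (weyl0 s (deriv expVec w)) w :=
    (weyl0 s).hasFDerivAt.comp_hasDerivAt w (hasDerivAt_expVec w)
  simp only [weyl0_expVec] at h1
  have h2 : HasDerivAt (fun w : ℂ => Complex.exp (-((s : ℂ) ^ 2 / 2) - s * w))
      (Complex.exp (-((s : ℂ) ^ 2 / 2) - s * w) * (-(s : ℂ))) w := by
    refine HasDerivAt.cexp ?_
    simpa using ((hasDerivAt_id w).const_mul (s : ℂ)).const_sub (-((s : ℂ) ^ 2 / 2))
  have h3 : HasDerivAt (fun w : ℂ => expVec (s + w)) (deriv expVec (s + w)) w := by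
    exact (hasDerivAt_expVec (s + w)).comp_const_add (s : ℂ) w
  rw [h1.unique (h2.smul h3)]
  module

theorem hasDerivAt_weyl0_expVec (w : ℂ) (s : ℝ) :
    HasDerivAt (fun s : ℝ => weyl0 s (expVec w)) (weyl0 s (deriv expVec w - w • expVec w)) s := by
  rw [map_sub, map_smul, weyl0_deriv_expVec]
  simp only [weyl0_expVec]
  have h2 : HasDerivAt (fun s : ℂ => Complex.exp (-(s ^ 2 / 2) - s * w))
      (Complex.exp (-((s : ℂ) ^ 2 / 2) - s * w) * (-(s : ℂ) - w)) (s : ℂ) := by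
    refine HasDerivAt.cexp ?_
    have h := (((hasDerivAt_pow 2 (s : ℂ)).div_const 2).neg).sub
      ((hasDerivAt_id (s : ℂ)).mul_const w)
    refine h.congr_deriv ?_
    simp
  have h3 : HasDerivAt (fun s : ℂ => expVec (s + w)) (deriv expVec (s + w)) (s : ℂ) := by
    exact (hasDerivAt_expVec (s + w)).comp_add_const (s : ℂ) w
  have h4 := (h2.smul h3).scomp s Complex.ofRealCLM.hasDerivAt
  refine h4.congr_deriv ?_
  rw [Complex.ofRealCLM_apply, Complex.ofReal_one, one_smul]
  module

/-- The integrated relation W_0(h) u - u = ∫₀ʰ W_0(s) g ds is a closed linear condition on (u, g).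
It holds for the entire curve w ↦ (e(w), e'(w) - w e(w)), hence for its Taylor coefficients, which
are multiples of (|k⟩, (a† - a)|k⟩). No domain of the unbounded generator is needed. -/
theorem weyl0_ket_sub (h : ℝ) (k : ℕ) :
    weyl0 h (ket k) - ket k = ∫ s in (0 : ℝ)..h, weyl0 s (ladderDiff ket k) := by
  let L : Fock × Fock →L[ℂ] Fock :=
    (weyl0 h - 1).comp (ContinuousLinearMap.fst ℂ Fock Fock) -
      (orbitIntegral h).comp (ContinuousLinearMap.snd ℂ Fock Fock)
  have hL : ∀ p, L p = weyl0 h p.1 - p.1 - orbitIntegral h p.2 := fun p => rfl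
  have hsum : ∀ w : ℂ, HasSum (fun n : ℕ => w ^ n •
      ((expCoeff n, ((√(n.factorial : ℝ) : ℂ))⁻¹ • ladderDiff ket n) : Fock × Fock))
      (expVec w, deriv expVec w - w • expVec w) := by
    intro w
    refine HasSum.prodMk (hasSum_expVec w) ?_
    refine ((hasSum_deriv_expVec w).sub (hasSum_smul_expVec w)).congr_fun fun n => ?_
    rw [← smul_sub, ladderDiff_coeff]
  have hmem := coeff_mem_of_hasSum L.ker L.isClosed_ker hsum (fun w => by
    rw [LinearMap.mem_ker]
    change L _ = 0
    rw [hL, orbitIntegral_apply, intervalIntegral.integral_eq_sub_of_hasDerivAt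
      (fun s _ => hasDerivAt_weyl0_expVec w s)
      ((continuous_weyl0_apply _).intervalIntegrable _ _), weyl0_zero, one_apply_eq_self, sub_self]) k
  rw [LinearMap.mem_ker] at hmem
  have h1 : L (expCoeff k, ((√(k.factorial : ℝ) : ℂ))⁻¹ • ladderDiff ket k) = 0 := hmem
  have hs : ((√(k.factorial : ℝ) : ℝ) : ℂ)⁻¹ ≠ 0 := by
    have : (0 : ℝ) < √(k.factorial : ℝ) := by positivity
    exact inv_ne_zero (by exact_mod_cast this.ne')
  rw [hL, expCoeff, map_smul, map_smul, ← smul_sub, ← smul_sub, smul_eq_zero_iff_right hs,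
    orbitIntegral_apply] at h1
  exact sub_eq_zero.1 h1

theorem hasDerivAt_weyl0_ket (k : ℕ) (θ : ℝ) :
    HasDerivAt (fun θ : ℝ => weyl0 θ (ket k)) (weyl0 θ (ladderDiff ket k)) θ := by
  have hc := continuous_weyl0_apply (ladderDiff ket k)
  have h := (intervalIntegral.integral_hasDerivAt_right (hc.intervalIntegrable 0 θ)
    (hc.stronglyMeasurableAtFilter _ _) hc.continuousAt).add_const (ket k)
  refine h.congr_of_eventuallyEq (Eventually.of_forall fun t => ?_)
  simp only [← weyl0_ket_sub, sub_add_cancel]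

/-! ### Displaced number states -/

/-- The displaced number basis `W₀(θ)|k⟩`. -/
def dispBasis (θ : ℝ) : HilbertBasis ℕ ℂ Fock :=
  HilbertBasis.ofRepr
    ((Unitary.linearIsometryEquiv ⟨weyl0 θ, weyl0_unitary θ⟩).symm.trans ketBasis.repr)

theorem dispBasis_apply (θ : ℝ) (k : ℕ) : dispBasis θ k = weyl0 θ (ket k) := by
  rw [← ketBasis_apply]
  rfl

theorem weyl0_ladderDiff (θ : ℝ) (k : ℕ) :
    weyl0 θ (ladderDiff ket k) = ladderDiff (dispBasis θ) k := by
  simp only [ladderDiff, map_sub, map_smul, dispBasis_apply]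

theorem dispProj_eq (k : ℕ) (θ : ℝ) :
    dispProj k θ = InnerProductSpace.rankOne ℂ (dispBasis θ k) (dispBasis θ k) := by
  rw [dispProj, numProj, rankOne_conj_of_unitary, dispBasis_apply]

/-- The derivative of `dispProj k` at `θ`. -/
def projDeriv (k : ℕ) (θ : ℝ) : Fock →L[ℂ] Fock :=
  InnerProductSpace.rankOne ℂ (dispBasis θ k) (ladderDiff (dispBasis θ) k) +
    InnerProductSpace.rankOne ℂ (ladderDiff (dispBasis θ) k) (dispBasis θ k)

/-- Real scalars are essential: the rank one operator is conjugate-linear in its second vector. -/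
theorem isBoundedBilinearMap_rankOne : IsBoundedBilinearMap ℝ
    fun p : Fock × Fock => (InnerProductSpace.rankOne ℂ p.1 p.2 : Fock →L[ℂ] Fock) where
  add_left x y z := by simp
  smul_left c x y := by
    ext v
    simp only [InnerProductSpace.rankOne_apply, smul_apply]
    exact smul_comm _ _ _
  add_right x y z := by simp
  smul_right c x y := by
    ext v
    simp only [InnerProductSpace.rankOne_apply, smul_apply]
    rw [← Complex.coe_smul, inner_smul_left, Complex.conj_ofReal, ← Complex.coe_smul, smul_smul]
  bound := ⟨1, one_pos, fun x y => by simp⟩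

theorem hasDerivAt_dispProj (k : ℕ) (θ : ℝ) : HasDerivAt (dispProj k) (projDeriv k θ) θ := by
  have h1 : HasDerivAt (fun θ => dispBasis θ k) (ladderDiff (dispBasis θ) k) θ := by
    simp only [dispBasis_apply, ← weyl0_ladderDiff]
    exact hasDerivAt_weyl0_ket k θ
  have h2 := (isBoundedBilinearMap_rankOne.hasFDerivAt
    (dispBasis θ k, dispBasis θ k)).comp_hasDerivAt θ (h1.prodMk h1)
  have h3 : dispProj k = fun θ => InnerProductSpace.rankOne ℂ (dispBasis θ k) (dispBasis θ k) :=
    funext (dispProj_eq k)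
  rw [h3]
  exact h2

/-- A crude linear bound, sufficient because Σ (k+1) λ_k converges. -/
theorem norm_projDeriv_le (k : ℕ) (θ : ℝ) : ‖projDeriv k θ‖ ≤ 4 * ((k : ℝ) + 1) := by
  have hk : (0 : ℝ) ≤ k := k.cast_nonneg
  have hs : ∀ x : ℝ, 0 ≤ x → √(x + 1) ≤ x + 1 := fun x hx => by
    rw [Real.sqrt_le_left (by linarith)]
    nlinarith
  have hs0 : √(k : ℝ) ≤ k + 1 := (Real.sqrt_le_sqrt (by linarith)).trans (hs k hk)
  have h1 : ‖ladderDiff (dispBasis θ) k‖ ≤ 2 * ((k : ℝ) + 1) := by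
    refine (norm_sub_le _ _).trans ?_
    rw [norm_smul, norm_smul, (dispBasis θ).orthonormal.1, (dispBasis θ).orthonormal.1,
      Complex.norm_real, Complex.norm_real, Real.norm_eq_abs, Real.norm_eq_abs,
      abs_of_nonneg (Real.sqrt_nonneg _), abs_of_nonneg (Real.sqrt_nonneg _)]
    linarith [hs k hk]
  refine (norm_add_le _ _).trans ?_
  rw [InnerProductSpace.norm_rankOne, InnerProductSpace.norm_rankOne,
    (dispBasis θ).orthonormal.1]
  linarith

theorem hasSum_succ_mul_eigval {M : ℝ} (hM : 0 < M) :
    HasSum (fun k : ℕ => ((k : ℝ) + 1) * eigval M k) (M + 1) := by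
  have hr0 : 0 ≤ (1 + 1 / M)⁻¹ := by positivity
  have hr : ‖(1 + 1 / M)⁻¹‖ < 1 := by
    rw [Real.norm_eq_abs, abs_of_nonneg hr0]
    exact ratio_lt_one hM
  have h := ((hasSum_coe_mul_geometric_of_norm_lt_one hr).add
    (hasSum_geometric_of_norm_lt_one hr)).mul_left (M * (1 + 1 / M))⁻¹
  have e : 1 - (1 + 1 / M)⁻¹ = (M + 1)⁻¹ := by field_simp; ring
  rw [e] at h
  have e2 : (M * (1 + 1 / M))⁻¹ * ((1 + 1 / M)⁻¹ / (M + 1)⁻¹ ^ 2 + (M + 1)⁻¹⁻¹) = M + 1 := by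
    field_simp
  rw [e2] at h
  refine h.congr_fun (fun k => ?_)
  rw [eigval_eq]
  ring

theorem hasSum_rho {M : ℝ} (hM : 0 < M) (θ : ℝ) :
    HasSum (fun k => (eigval M k : ℂ) • dispProj k θ) (rho M θ) := by
  have h := (hasSum_rho_zero hM).mapL
    (((ContinuousLinearMap.mul ℂ (Fock →L[ℂ] Fock)).flip (star (weyl0 θ))).comp
      (ContinuousLinearMap.mul ℂ (Fock →L[ℂ] Fock) (weyl0 θ)))
  simp only [ContinuousLinearMap.comp_apply, ContinuousLinearMap.flip_apply,
    ContinuousLinearMap.mul_apply', mul_smul_comm, smul_mul_assoc, ← rho_eq_conj hM] at h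
  exact h

theorem summable_eigval_smul_projDeriv {M : ℝ} (hM : 0 < M) (θ : ℝ) :
    Summable fun k => (eigval M k : ℂ) • projDeriv k θ := by
  refine Summable.of_norm_bounded ((hasSum_succ_mul_eigval hM).summable.mul_left 4) fun k => ?_
  rw [norm_smul, Complex.norm_real, Real.norm_eq_abs, abs_of_pos (eigval_pos hM k)]
  have := norm_projDeriv_le k θ
  have := eigval_pos hM k
  nlinarith

theorem hasDerivAt_rho {M : ℝ} (hM : 0 < M) (θ : ℝ) :
    HasDerivAt (rho M) (∑' k, (eigval M k : ℂ) • projDeriv k θ) θ := by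
  have h := hasDerivAt_tsum (𝕜 := ℝ) (g := fun k θ => (eigval M k : ℂ) • dispProj k θ)
    (g' := fun k θ => (eigval M k : ℂ) • projDeriv k θ)
    ((hasSum_succ_mul_eigval hM).summable.mul_left 4)
    (fun k θ => (hasDerivAt_dispProj k θ).const_smul (eigval M k : ℂ))
    (fun k θ => by
      rw [norm_smul, Complex.norm_real, Real.norm_eq_abs, abs_of_pos (eigval_pos hM k)]
      have := norm_projDeriv_le k θ
      have := eigval_pos hM k
      nlinarith) (hasSum_rho hM 0).summable θ
  have e : rho M = fun θ => ∑' k, (eigval M k : ℂ) • dispProj k θ :=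
    funext fun θ => (hasSum_rho hM θ).tsum_eq.symm
  rw [e]
  exact h

theorem inner_dispBasis (θ : ℝ) (j k : ℕ) :
    ⟪dispBasis θ j, dispBasis θ k⟫_ℂ = if j = k then 1 else 0 :=
  orthonormal_iff_ite.1 (dispBasis θ).orthonormal j k

/-- The commutator of a diagonal operator with the difference of the ladder operators. -/
theorem hasSum_smul_projDeriv_apply (c : ℕ → ℝ) (θ : ℝ) (j : ℕ) :
    HasSum (fun k => (c k : ℂ) • projDeriv k θ (dispBasis θ j))
      ((((c j - c (j + 1)) * √(j + 1 : ℝ) : ℝ) : ℂ) • dispBasis θ (j + 1) +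
        (((c (j - 1) - c j) * √(j : ℝ) : ℝ) : ℂ) • dispBasis θ (j - 1)) := by
  set b := dispBasis θ with hb
  have h1 : HasSum (fun k => (if k = j then (c k : ℂ) • ladderDiff b k else 0))
      ((c j : ℂ) • ladderDiff b j) := hasSum_ite_eq j _ |>.congr_fun (fun k => by
        by_cases h : k = j
        · simp [h]
        · simp [h])
  have h2 : HasSum (fun k => (if k + 1 = j then ((c k * √(k + 1 : ℝ) : ℝ) : ℂ) • b k else 0))
      (((c (j - 1) * √(j : ℝ) : ℝ) : ℂ) • b (j - 1)) := by
    convert hasSum_single (j - 1) ?_ using 1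
    · rcases j with _ | m
      · simp
      · simp
    · intro k hk
      rw [if_neg (by omega)]
  -- For j = 0 the condition k - 1 = j also holds at k = 0, where √0 makes the extra term vanish.
  have h3 : HasSum (fun k => (if k - 1 = j then ((c k * √(k : ℝ) : ℝ) : ℂ) • b k else 0))
      (((c (j + 1) * √(j + 1 : ℝ) : ℝ) : ℂ) • b (j + 1)) := by
    convert hasSum_single (j + 1) ?_ using 1
    · simp
    · intro k hk
      rcases k with _ | m
      · simp
      · rw [if_neg (by omega)]
  convert (h1.add h2).sub h3 using 1
  · ext1 k
    rw [projDeriv, add_apply, InnerProductSpace.rankOne_apply, InnerProductSpace.rankOne_apply,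
      ladderDiff, inner_sub_left, inner_smul_left, inner_smul_left, ← hb]
    simp only [hb, inner_dispBasis, Complex.conj_ofReal]
    split_ifs <;> push_cast <;> module
  · rw [ladderDiff]
    push_cast
    module

theorem isLadderPair_rho {M : ℝ} (hM : 0 < M) (θ : ℝ) :
    IsLadderPair (dispBasis θ) (eigval M) (1 + 1 / M)⁻¹ (rho M θ) (deriv (rho M) θ) where
  nonneg := (ContinuousLinearMap.nonneg_iff_isPositive _).2
    (isPositive_mixture (integrable_gaussDensity hM θ) (gaussDensity_nonneg hM θ))
  selfAdjoint := by
    -- The family is fixed by the adjoint, so its derivative is as well.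
    have h := hasDerivAt_rho hM θ
    have h2 := h.star
    have e : (fun θ => star (rho M θ)) = rho M := funext fun θ =>
      IsSelfAdjoint.star_eq (isPositive_mixture (integrable_gaussDensity hM θ)
        (gaussDensity_nonneg hM θ)).isSelfAdjoint
    rw [e] at h2
    rw [h.deriv]
    exact h2.unique h
  q_pos := by positivity
  q_lt_one := ratio_lt_one hM
  pos := eigval_pos hM
  succ := eigval_succ M
  apply_basis k := by
    rw [rho_eq_conj hM, dispBasis_apply, mul_apply_eq_comp, mul_apply_eq_comp,
      star_apply_apply_of_unitary (weyl0_unitary θ), rho_zero_ket hM, map_smul]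
  apply_deriv j := by
    rw [(hasDerivAt_rho hM θ).deriv]
    have h := (summable_eigval_smul_projDeriv hM θ).hasSum.mapL
      (ContinuousLinearMap.apply ℂ Fock (dispBasis θ j))
    exact h.unique (hasSum_smul_projDeriv_apply (eigval M) θ j)

/-! ### Spectral decompositions of the family -/

theorem eigval_injective {M : ℝ} (hM : 0 < M) : Function.Injective (eigval M) := by
  refine StrictAnti.injective (strictAnti_nat_of_succ_lt fun k => ?_)
  rw [eigval_succ]
  have := eigval_pos hM k
  have := ratio_lt_one hM
  nlinarith

theorem isSpectralFamily_dispProj {M : ℝ} (hM : 0 < M) :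
    IsSpectralFamily (rho M) (fun k _ => eigval M k) dispProj where
  pos k _ := eigval_pos hM k
  distinct _ := eigval_injective hM
  isProj k θ := by
    rw [dispProj_eq]
    exact InnerProductSpace.isStarProjection_rankOne_self ((dispBasis θ).orthonormal.1 k)
  ne_zero k θ := by
    rw [dispProj_eq]
    have : dispBasis θ k ≠ 0 := (dispBasis θ).orthonormal.ne_zero k
    exact InnerProductSpace.rankOne_ne_zero this this
  orthogonal j k θ hjk := by
    rw [dispProj_eq, dispProj_eq]
    ext1 v
    rw [mul_apply_eq_comp, InnerProductSpace.rankOne_apply, InnerProductSpace.rankOne_apply,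
      inner_smul_right, inner_dispBasis, if_neg hjk, mul_zero, zero_smul]
    rfl
  hasSum := hasSum_rho hM
  differentiable_eigenvalue k := differentiable_const _
  differentiable_proj k θ := (hasDerivAt_dispProj k θ).differentiableAt

namespace IsSpectralFamily

theorem apply_of_proj {H : Type*} [NormedAddCommGroup H] [InnerProductSpace ℂ H] [CompleteSpace H]
    {ρ : ℝ → H →L[ℂ] H} {lam : ℕ → ℝ → ℝ} {P : ℕ → ℝ → H →L[ℂ] H} (h : IsSpectralFamily ρ lam P)
    (j : ℕ) (θ : ℝ) (v : H) : ρ θ (P j θ v) = (lam j θ : ℂ) • P j θ v := by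
  have h1 := (h.hasSum θ).mapL (ContinuousLinearMap.apply ℂ H (P j θ v))
  have hid : P j θ (P j θ v) = P j θ v := by
    rw [← mul_apply_eq_comp, (h.isProj j θ).isIdempotentElem]
  have h2 := hasSum_single (f := fun k => ((lam k θ : ℂ) • P k θ) (P j θ v)) j fun k hk => by
    rw [smul_apply, ← mul_apply_eq_comp, h.orthogonal k j θ hk, zero_apply, smul_zero]
  rw [smul_apply, hid] at h2
  exact h1.unique h2

variable {M : ℝ} {lam : ℕ → ℝ → ℝ} {P : ℕ → ℝ → Fock →L[ℂ] Fock}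

/-- Comparing coordinates in ρ P = λ P, with simple eigenvalues, confines the range of P to one
basis line; a nonzero projection with range in a line is the projection onto it. -/
theorem exists_eq_dispProj (hM : 0 < M) (h : IsSpectralFamily (rho M) lam P) (j : ℕ) (θ : ℝ) :
    ∃ k, lam j θ = eigval M k ∧ P j θ = dispProj k θ := by
  have hl := isLadderPair_rho hM θ
  set b := dispBasis θ with hb
  have hcoord : ∀ (i : ℕ) (v : Fock), (eigval M i : ℂ) * ⟪b i, P j θ v⟫_ℂ =
      (lam j θ : ℂ) * ⟪b i, P j θ v⟫_ℂ := by
    intro i v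
    have h1 : ⟪rho M θ (b i), P j θ v⟫_ℂ = ⟪b i, rho M θ (P j θ v)⟫_ℂ :=
      (IsSelfAdjoint.of_nonneg hl.nonneg).isSymmetric _ _
    rwa [hl.apply_basis, h.apply_of_proj, inner_smul_left, inner_smul_right,
      Complex.conj_ofReal] at h1
  obtain ⟨x, hx⟩ : ∃ x, P j θ x ≠ 0 := by
    by_contra hcon
    push Not at hcon
    exact h.ne_zero j θ (ContinuousLinearMap.ext hcon)
  obtain ⟨i, hi⟩ : ∃ i, ⟪b i, P j θ x⟫_ℂ ≠ 0 := by
    by_contra hcon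
    push Not at hcon
    exact hx (hilbertBasis_ext_inner b fun i => by rw [hcon, inner_zero_right])
  have hlam : lam j θ = eigval M i := by
    have := mul_right_cancel₀ hi (hcoord i x)
    exact_mod_cast this.symm
  refine ⟨i, hlam, ?_⟩
  have hoff : ∀ k, k ≠ i → ∀ v, ⟪b k, P j θ v⟫_ℂ = 0 := by
    intro k hk v
    by_contra h0
    have h1 := mul_right_cancel₀ h0 (hcoord k v)
    rw [hlam] at h1
    exact hk (eigval_injective hM (by exact_mod_cast h1))
  have hone : ∀ v, P j θ v = ⟪b i, P j θ v⟫_ℂ • b i := by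
    intro v
    refine hilbertBasis_ext_inner b fun k => ?_
    rw [inner_smul_right, inner_dispBasis]
    by_cases hk : k = i
    · rw [hk, if_pos rfl, mul_one]
    · rw [if_neg hk, mul_zero, hoff k hk]
  set c := ⟪b i, P j θ (b i)⟫_ℂ with hc
  have hsym : ∀ v, ⟪b i, P j θ v⟫_ℂ = (starRingEnd ℂ) c * ⟪b i, v⟫_ℂ := by
    intro v
    have h1 : ⟪P j θ (b i), v⟫_ℂ = ⟪b i, P j θ v⟫_ℂ := (h.isProj j θ).isSelfAdjoint.isSymmetric _ _
    rw [← h1, hone (b i), inner_smul_left]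
  have hP : ∀ v, P j θ v = ((starRingEnd ℂ) c * ⟪b i, v⟫_ℂ) • b i := fun v => by
    rw [← hsym]; exact hone v
  have hidem : P j θ (P j θ x) = P j θ x := by
    rw [← mul_apply_eq_comp, (h.isProj j θ).isIdempotentElem]
  have hc1 : (starRingEnd ℂ) c = 1 := by
    have h1 := hsym (P j θ x)
    rw [hidem] at h1
    exact (mul_right_cancel₀ hi ((one_mul _).trans h1)).symm
  rw [dispProj_eq]
  ext1 v
  rw [hP, hc1, one_mul, InnerProductSpace.rankOne_apply]

/-- The range is connected and countable; two distinct values would put a whole interval into it. -/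
theorem eigenvalue_const (hM : 0 < M) (h : IsSpectralFamily (rho M) lam P) (j : ℕ) (s t : ℝ) :
    lam j s = lam j t := by
  have hpre : IsPreconnected (range (lam j)) :=
    isPreconnected_range (h.differentiable_eigenvalue j).continuous
  have hcount : (range (lam j)).Countable := by
    refine (countable_range (eigval M)).mono ?_
    rintro _ ⟨θ, rfl⟩
    obtain ⟨k, hk, -⟩ := h.exists_eq_dispProj hM j θ
    exact ⟨k, hk.symm⟩
  by_contra hne
  wlog hlt : lam j s < lam j t generalizing s t
  · exact this t s (Ne.symm hne) (lt_of_le_of_ne (not_lt.1 hlt) (Ne.symm hne))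
  have hsub : Icc (lam j s) (lam j t) ⊆ range (lam j) :=
    hpre.ordConnected.out ⟨s, rfl⟩ ⟨t, rfl⟩
  exact absurd (Cardinal.Real.Icc_countable_iff.1 (hcount.mono hsub)) (not_le.2 hlt)

theorem exists_equiv (hM : 0 < M) (h : IsSpectralFamily (rho M) lam P) :
    ∃ σ : ℕ ≃ ℕ, (∀ j, lam j = fun _ => eigval M (σ j)) ∧ ∀ j, P j = dispProj (σ j) := by
  choose σ hσ using fun j => h.exists_eq_dispProj hM j 0
  have hlam : ∀ j θ, lam j θ = eigval M (σ j) := fun j θ => by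
    rw [h.eigenvalue_const hM j θ 0, (hσ j).1]
  have hP : ∀ j θ, P j θ = dispProj (σ j) θ := fun j θ => by
    obtain ⟨k, hk, hk2⟩ := h.exists_eq_dispProj hM j θ
    rw [hlam] at hk
    rw [hk2, eigval_injective hM hk]
  have hinj : Function.Injective σ := fun i j hij => h.distinct 0 (by
    simp only [hlam, hij])
  -- An index missed by σ would give an eigenvector annihilated by every term of the series,
  -- although its eigenvalue is positive.
  have hsurj : Function.Surjective σ := by
    intro i
    by_contra hcon
    push Not at hcon
    have h1 := (h.hasSum 0).mapL (ContinuousLinearMap.apply ℂ Fock (dispBasis 0 i))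
    have h2 : ∀ k, (ContinuousLinearMap.apply ℂ Fock (dispBasis 0 i)) ((lam k 0 : ℂ) • P k 0) = 0 :=
      fun k => by
        rw [ContinuousLinearMap.apply_apply, smul_apply, hP, dispProj_eq,
          InnerProductSpace.rankOne_apply, inner_dispBasis, if_neg (hcon k), zero_smul, smul_zero]
    simp only [h2] at h1
    have h3 := h1.unique hasSum_zero
    rw [ContinuousLinearMap.apply_apply, (isLadderPair_rho hM 0).apply_basis,
      smul_eq_zero_iff_left ((dispBasis 0).orthonormal.ne_zero i)] at h3
    exact (eigval_pos hM i).ne' (by exact_mod_cast h3)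
  exact ⟨Equiv.ofBijective σ ⟨hinj, hsurj⟩, fun j => funext (hlam j), fun j => funext (hP j)⟩

theorem ldPart1_eq (hM : 0 < M) (h : IsSpectralFamily (rho M) lam P) (m : LDModel) (θ : ℝ) :
    ldPart1 m (rho M) lam P θ = ⟨ldDomain m (rho M θ), 0⟩ := by
  obtain ⟨σ, hlam, -⟩ := h.exists_equiv hM
  have hX : (∑' k, ((deriv (lam k) θ : ℝ) : ℂ) • P k θ) = 0 := by
    simp only [hlam, deriv_const, Complex.ofReal_zero, zero_smul, tsum_zero]
  rw [ldPart1, hX, ld]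
  refine formOperator_zero (dispBasis θ) ((isLadderPair_rho hM θ).basis_mem_ldDomain m)
    fun u _ v _ => ?_
  cases m <;> simp [ldForm]

theorem deriv_proj {σ : ℕ ≃ ℕ} (hP : ∀ j, P j = dispProj (σ j)) (j : ℕ) (θ : ℝ) :
    deriv (P j) θ = projDeriv (σ j) θ := by
  rw [hP, (hasDerivAt_dispProj _ θ).deriv]

theorem ldPart2_eq (hM : 0 < M) (h : IsSpectralFamily (rho M) lam P) (m : LDModel) (θ : ℝ) :
    ldPart2 m (rho M) lam P θ = ld m (rho M θ) (deriv (rho M) θ) := by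
  obtain ⟨σ, hlam, hP⟩ := h.exists_equiv hM
  rw [ldPart2, (hasDerivAt_rho hM θ).deriv,
    ← σ.tsum_eq fun k => (eigval M k : ℂ) • projDeriv k θ]
  simp only [hlam, deriv_proj hP]

theorem qfiPart1_eq (hM : 0 < M) (h : IsSpectralFamily (rho M) lam P) (m : LDModel) (θ : ℝ) :
    qfiPart1 m (rho M) lam P θ = 0 := by
  have hl := isLadderPair_rho hM θ
  rw [qfiPart1, h.ldPart1_eq hM]
  exact ldVariance_zero m hl.nonneg hl.pos hl.apply_basis

theorem qfiPart2_eq (hM : 0 < M) (h : IsSpectralFamily (rho M) lam P) (m : LDModel) (θ : ℝ) :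
    qfiPart2 m (rho M) lam P θ = qfi m (rho M) θ := by
  rw [qfiPart2, h.qfiPart1_eq hM, tsub_zero]

/-- The series is the commutator of log ρ with the ladder difference. Consecutive log λ_k differ by
the constant -log q, which is exactly `ldFactor` in this model. -/
theorem hasSum_log_smul_deriv (hM : 0 < M) (h : IsSpectralFamily (rho M) lam P) (θ : ℝ) (j : ℕ)
    (v : Fock) (hv : P j θ v = v) : ∃ hd : v ∈ (ldPart2 .bvn (rho M) lam P θ).domain,
      HasSum (fun k => ((Real.log (lam k θ) : ℝ) : ℂ) • (deriv (P k) θ) v)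
        (ldPart2 .bvn (rho M) lam P θ ⟨v, hd⟩) := by
  rw [h.ldPart2_eq hM]
  obtain ⟨σ, hlam, hP⟩ := h.exists_equiv hM
  have hl := isLadderPair_rho hM θ
  set b := dispBasis θ with hb
  obtain ⟨c, hc⟩ : ∃ c : ℂ, v = c • b (σ j) := by
    refine ⟨⟪b (σ j), v⟫_ℂ, ?_⟩
    rw [hP, dispProj_eq, InnerProductSpace.rankOne_apply] at hv
    exact hv.symm
  have hmem : v ∈ (ld .bvn (rho M θ) (deriv (rho M) θ)).domain := by
    rw [hc]
    exact Submodule.smul_mem _ c (hl.basis_mem_domain .bvn (σ j))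
  refine ⟨hmem, ?_⟩
  have hval : ld .bvn (rho M θ) (deriv (rho M) θ) ⟨v, hmem⟩ =
      c • ((ldFactor .bvn (1 + 1 / M)⁻¹ : ℂ) • ladderSum b (σ j)) := by
    rw [← hl.ld_apply_basis, ← LinearPMap.map_smul]
    congr 1
    exact Subtype.ext hc
  rw [hval]
  simp only [hlam, deriv_proj hP]
  refine (σ.hasSum_iff (f := fun k => ((Real.log (eigval M k) : ℝ) : ℂ) • projDeriv k θ v)).2 ?_
  have h1 := (hasSum_smul_projDeriv_apply (fun k => Real.log (eigval M k)) θ (σ j)).const_smul c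
  have hq := hl.q_pos
  have hfac : ldFactor .bvn (1 + 1 / M)⁻¹ = -Real.log (1 + 1 / M)⁻¹ := by
    have h2 : (1 + 1 / M)⁻¹ - 1 ≠ 0 := by have := hl.q_lt_one; linarith
    simp only [ldFactor, ldKernel, Real.log_one, sub_zero]
    generalize (1 + 1 / M)⁻¹ = q at *
    field_simp
    ring
  have hstep : ∀ k, Real.log (eigval M k) - Real.log (eigval M (k + 1)) =
      -Real.log (1 + 1 / M)⁻¹ := fun k => by
    rw [eigval_succ, Real.log_mul hq.ne' (eigval_pos hM k).ne']
    ring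
  convert h1 using 1
  · ext1 k
    rw [hc, map_smul, smul_comm]
  · congr 1
    rw [ladderSum, hfac, hstep, smul_add, smul_smul, smul_smul, ← Complex.ofReal_mul,
      ← Complex.ofReal_mul]
    congr 2
    rcases σ j with _ | i
    · simp
    · rw [Nat.add_sub_cancel, hstep]

end IsSpectralFamily

/-! ### Covariance and values of the Fisher information for the Gaussian family. -/

theorem deriv_rho_conj {M : ℝ} (hM : 0 < M) (θ : ℝ) :
    deriv (rho M) θ = weyl0 θ * deriv (rho M) 0 * star (weyl0 θ) := by
  have h : ∀ k, star (weyl0 θ) (dispBasis θ k) = dispBasis 0 k := fun k => by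
    rw [dispBasis_apply, dispBasis_apply, star_apply_apply_of_unitary (weyl0_unitary θ), weyl0_zero,
      one_apply_eq_self]
  have h' : ∀ k, weyl0 θ (dispBasis 0 k) = dispBasis θ k := fun k => by
    rw [← h, apply_star_apply_of_unitary (weyl0_unitary θ)]
  -- The matrix of ρ_θ' in the displaced basis does not involve θ, so no composition law of Weyl
  -- operators is used.
  refine hilbertBasis_clm_ext (dispBasis θ) fun j => ?_
  rw [mul_apply_eq_comp, mul_apply_eq_comp, h, (isLadderPair_rho hM θ).apply_deriv,
    (isLadderPair_rho hM 0).apply_deriv, (weyl0 θ).map_add, (weyl0 θ).map_smul,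
    (weyl0 θ).map_smul, h', h']

theorem ld_rho_conj {M : ℝ} (hM : 0 < M) (m : LDModel) (θ : ℝ) :
    ld m (rho M θ) (deriv (rho M) θ) =
      sandwich (weyl0 θ) (ld m (rho M 0) (deriv (rho M) 0)) (star (weyl0 θ)) := by
  have h := isLadderPair_rho hM θ
  rw [rho_eq_conj hM, deriv_rho_conj hM] at h ⊢
  exact ld_conj_of_unitary (weyl0_unitary θ) m (isLadderPair_rho hM 0) h

theorem qfi_bvn_rho {M : ℝ} (hM : 0 < M) (θ : ℝ) :
    qfi .bvn (rho M) θ = ENNReal.ofReal (2 * Real.log (1 + 1 / M)) := by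
  rw [qfi, (isLadderPair_rho hM θ).ldVariance_bvn (hasSum_succ_mul_eigval hM), Real.log_inv,
    neg_neg]
  -- Here 1 - q = 1 / (M + 1) cancels N = M + 1.
  congr 2
  field_simp
  ring

theorem qfi_rho {M : ℝ} (hM : 0 < M) {m : LDModel} (hm : m ≠ .bvn) (θ : ℝ) :
    qfi m (rho M) θ =
      ENNReal.ofReal (ldFactor m (1 + 1 / M)⁻¹ ^ 2 * (M + 1) * ((1 + 1 / M)⁻¹ + 1)) := by
  rw [qfi, (isLadderPair_rho hM θ).ldVariance_eq hm (hasSum_succ_mul_eigval hM)]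

theorem qfi_rho_eq {M : ℝ} (hM : 0 < M) (m : LDModel) (θ : ℝ) :
    qfi m (rho M) θ = qfi m (rho M) 0 ∧ qfi m (rho M) θ ≠ ⊤ := by
  by_cases hm : m = .bvn
  · rw [hm, qfi_bvn_rho hM, qfi_bvn_rho hM]
    exact ⟨rfl, ENNReal.ofReal_ne_top⟩
  · rw [qfi_rho hM hm, qfi_rho hM hm]
    exact ⟨rfl, ENNReal.ofReal_ne_top⟩

theorem qfi_ld2_rho {M : ℝ} (hM : 0 < M) (θ : ℝ) :
    qfi .ld2 (rho M) θ = ENNReal.ofReal ((2 * M + 1) / (M * (M + 1))) := by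
  rw [qfi_rho hM (by simp)]
  congr 1
  have hq : 0 < (1 + 1 / M)⁻¹ := by positivity
  -- The squared factor is (1 - q)² / q, with q = M / (M + 1).
  have hsq : (((1 + 1 / M)⁻¹ : ℝ) ^ (1 / 2 : ℝ)) ^ 2 = (1 + 1 / M)⁻¹ := by
    rw [← Real.rpow_natCast, ← Real.rpow_mul hq.le]
    norm_num
  simp only [ldFactor, ldKernel, Real.one_rpow, inv_one, mul_one]
  rw [mul_pow, inv_pow, hsq]
  field_simp
  ring

end CoherentQFI

end

theorem theorem5p8 :
    -- the Weyl operators exist and are unique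
    (∀ z : ℂ, IsWeyl z (weyl z) ∧ ∀ U, IsWeyl z U → U = weyl z) ∧
    -- every mixture of coherent states is a state
    (∀ φ : ℂ → ℝ, IsProbDensity φ →
      MeasureTheory.Integrable (fun z : ℂ => (φ z : ℂ) • cohProj z) ∧
      (mixture φ).IsPositive ∧ IsTraceClass (mixture φ) ∧ opTrace (mixture φ) = 1) ∧
    ∀ M : ℝ, 0 < M →
      -- states, related by the Weyl operators
      (∀ θ : ℝ, IsProbDensity (gaussDensity M θ) ∧
        (rho M θ).IsPositive ∧ IsTraceClass (rho M θ) ∧ opTrace (rho M θ) = 1 ∧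
        rho M θ = weyl0 θ * rho M 0 * star (weyl0 θ)) ∧
      -- real analyticity in trace norm
      (∃ R : ℝ → TraceClass Fock, (∀ θ, (R θ).op = rho M θ) ∧
        AnalyticOnNhd ℝ R Set.univ) ∧
      -- spectral representation at 0
      (HasSum (fun k => (eigval M k : ℂ) • numProj k) (rho M 0) ∧
        ∀ k, rho M 0 (ket k) = (eigval M k : ℂ) • ket k) ∧
      -- spectral representation at every parameter
      (IsSpectralFamily (rho M) (fun k _ => eigval M k) dispProj ∧
        ∀ θ, Function.Injective (rho M θ)) ∧
      -- parts of the logarithmic derivatives and of the Fisher informations, for every spectral decomposition of the family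
      (∀ (lam : ℕ → ℝ → ℝ) (P : ℕ → ℝ → Fock →L[ℂ] Fock), IsSpectralFamily (rho M) lam P →
        ∀ (m : LDModel) (θ : ℝ),
          Dense ((ldPart2 m (rho M) lam P θ).domain : Set Fock) ∧
          ldPart1 m (rho M) lam P θ = ⟨ldDomain m (rho M θ), 0⟩ ∧
          ldPart2 m (rho M) lam P θ = ld m (rho M θ) (deriv (rho M) θ) ∧
          ldPart2 m (rho M) lam P θ =
            sandwich (weyl0 θ) (ldPart2 m (rho M) lam P 0) (star (weyl0 θ)) ∧
          qfiPart1 m (rho M) lam P θ = 0 ∧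
          qfiPart2 m (rho M) lam P θ = qfiPart2 m (rho M) lam P 0 ∧
          qfiPart2 m (rho M) lam P θ = qfi m (rho M) θ) ∧
      -- in the Boltzmann - von Neumann model, H₂ is `∑ ln (lam k) P k'` on eigenvectors
      (∀ (lam : ℕ → ℝ → ℝ) (P : ℕ → ℝ → Fock →L[ℂ] Fock), IsSpectralFamily (rho M) lam P →
        ∀ (θ : ℝ) (j : ℕ) (v : Fock), P j θ v = v →
          ∃ hv : v ∈ (ldPart2 .bvn (rho M) lam P θ).domain,
            HasSum (fun k => ((Real.log (lam k θ) : ℝ) : ℂ) • (deriv (P k) θ) v)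
              (ldPart2 .bvn (rho M) lam P θ ⟨v, hv⟩)) ∧
      (∀ (m : LDModel) (θ : ℝ), qfi m (rho M) θ = qfi m (rho M) 0 ∧ qfi m (rho M) θ ≠ ⊤) ∧
      -- the two explicit values
      qfi .bvn (rho M) 0 = ENNReal.ofReal (2 * Real.log (1 + 1 / M)) ∧
      qfi .ld2 (rho M) 0 = ENNReal.ofReal ((2 * M + 1) / (M * (M + 1))) := by
  refine ⟨fun z => ⟨isWeyl_weyl z, fun U hU => isWeyl_unique hU (isWeyl_weyl z)⟩,
    fun φ hφ => ⟨integrable_smul_cohProj hφ.integrable,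
      isPositive_mixture hφ.integrable hφ.nonneg, isTraceClass_mixture hφ.integrable, ?_⟩,
    fun M hM => ⟨fun θ => ?_, ?_, ⟨hasSum_rho_zero hM, rho_zero_ket hM⟩,
      ⟨isSpectralFamily_dispProj hM, fun θ => (isLadderPair_rho hM θ).injective⟩,
      fun lam P h m θ => ?_, fun lam P h θ j v hv => h.hasSum_log_smul_deriv hM θ j v hv,
      fun m θ => qfi_rho_eq hM m θ, qfi_bvn_rho hM 0, qfi_ld2_rho hM 0⟩⟩
  · rw [opTrace_mixture hφ.integrable, hφ.integral_eq_one, Complex.ofReal_one]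
  · have hφ := isProbDensity_gaussDensity hM θ
    refine ⟨hφ, isPositive_mixture hφ.integrable hφ.nonneg, isTraceClass_mixture hφ.integrable,
      ?_, rho_eq_conj hM θ⟩
    rw [rho, opTrace_mixture hφ.integrable, hφ.integral_eq_one, Complex.ofReal_one]
  · exact ⟨fun θ => mixtureTC (gaussDensity M θ) (integrable_gaussDensity hM θ),
      fun θ => rfl, analyticOnNhd_rho hM⟩
  · rw [h.ldPart2_eq hM, h.ldPart2_eq hM, h.qfiPart2_eq hM, h.qfiPart2_eq hM]
    exact ⟨(isLadderPair_rho hM θ).dense_domain m, h.ldPart1_eq hM m θ, rfl, ld_rho_conj hM m θ,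
      h.qfiPart1_eq hM m θ, (qfi_rho_eq hM m θ).1, rfl⟩
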